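/- **Setting.** An instance of the constrained ranking maximization problem (LU) consists of $m$ items, $n\ge 1$ positions and $p\le m$ properties (the latter holds whenever $\Delta=1$ and no property is empty), weights $W\in\mathbb R^{m\times n}$, sets $P_1,\dots,P_p\subseteq[m]$ ($P_\ell$ is the set of items with property $\ell$), and bounds $L_{k\ell},U_{k\ell}\in\mathbb Z_{\ge 0}$ for $k\in[n]$, $\ell\in[p]$. A ranking is a one-to-one map $\pi:[n]\to[m]$; it is feasible if $L_{k\ell}\le|\{j\le k:\pi(j)\in P_\ell\}|\le U_{k\ell}$ for all $k,\ell$, and its value is $\sum_j W_{\pi(j)j}$. An optimal ranking is a feasible ranking of maximum value. Let $\Delta=\max_i|\{\ell:i\in P_\ell\}|$, and assume that $\Delta=1$, that $W_{ij}$ is non-increasing in $i$ and in $j$, and that $W_{i_1j_1}+W_{i_2j_2}\ge W_{i_1j_2}+W_{i_2j_1}$ for all $i_1<i_2$, $j_1<j_2$. **The network.** Call each property a class, and let the items without any property form one further class, with lower bounds $0$ and upper bounds $n$. For $M\in\mathbb R$ let $G_M$ be the following directed multigraph, in which all capacities are $1$. Its vertices are $s$, $t$, $\gamma_k$ ($k\in[n]$)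 and $\rho_{c,0},\dots,\rho_{c,n}$ for every class $c$. It has zero-cost edges $\gamma_k\to t$ and $\rho_{c,k-1}\to\gamma_k$ for all $c$, $k$, and one zero-cost edge $s\to\rho_{c,n}$ for every item of $c$. If $i_1<i_2<\dots<i_S$ are the items of $c$, then for every $k\in[n]$ it has one edge $\rho_{c,k}\to\rho_{c,k-1}$ for each $r\le\min(S,U_{kc})$, of cost $W_{i_r,k+1}-W_{i_r,k}$, decreased by $M$ if $r\le L_{kc}$; here $W_{i,n+1}:=0$. **Theorem.** There are an absolute constant $C$ and a single program for a unit-cost real RAM (additions, subtractions and comparisons of real numbers and of natural numbers, indirect addressing) such that the following holds for every such instance. 1. For every $M>2\sum_{i,j}|W_{ij}|$: * $G_M$ is acyclic and has at most $C\,np$ vertices and at most $C\,nm$ edges. * A feasible ranking exists if and only if there is an integral minimum-cost flow of value $n$ in $G_M$ that sends at least $L_{k\ell}$ units from $\rho_{\ell,k}$ to $\rho_{\ell,k-1}$ for all $k,\ell$. * If a feasible ranking exists, then from every integral minimum-cost flow $f$ of value $n$ an optimal ranking is read off: $\pi(k)$ is the $r$-th item of the class $c$ for which $f$ uses $\rho_{c,k-1}\to\gamma_k$,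 where $r$ is the number of $k'\le k$ for which $f$ uses $\rho_{c,k'-1}\to\gamma_{k'}$. Its value is $-\mathrm{cost}(f)-M\sum_{k,\ell}L_{k\ell}$. * Successive shortest paths (start from the zero flow; repeatedly augment by one unit along a minimum-cost simple $s$–$t$ path of the residual network) solves this flow problem: after $n$ augmentations the flow is an integral minimum-cost flow of value $n$, and if a flow of value $n$ exists, then a shortest augmenting path exists after any $r<n$ augmentations. 2. Given $m,n,p$, the matrices $W,L,U$ and a list of all pairs $(i,\ell)$ with $i\in P_\ell$ in any order, the program halts after at most $C\,n^2m\log(m+1)$ steps, and outputs an optimal ranking if a feasible ranking exists, and otherwise reports that there is none. -/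

import Mathlib

namespace FairRanking

/-! # The constrained ranking maximization problem -/

/-- An instance with `m` items, `n` positions and `p` properties.  Items, positions and properties
are numbered from `0`; the position `k : Fin n` is the `(k+1)`-st from the top. -/
structure Instance (m n p : ℕ) where
  /-- `W i j` is the value of placing item `i` at position `j`. -/
  W : Fin m → Fin n → ℝ
  /-- `P ℓ` is the set of items that have property `ℓ`. -/
  P : Fin p → Finset (Fin m)
  /-- `L k ℓ`: lower bound on the number of items with property `ℓ` down to position `k`. -/
  L : Fin n → Fin p → ℕ
  /-- `U k ℓ`: upper bound on the number of items with property `ℓ` down to position `k`. -/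
  U : Fin n → Fin p → ℕ

namespace Instance

variable {m n p : ℕ} (I : Instance m n p)

/-- The weights are non-increasing in the item and in the position, and satisfy the Monge
condition. -/
def MonotoneMonge : Prop :=
  (∀ (i₁ i₂ : Fin m) (j : Fin n), i₁ < i₂ → I.W i₂ j ≤ I.W i₁ j) ∧
  (∀ (i : Fin m) (j₁ j₂ : Fin n), j₁ < j₂ → I.W i j₂ ≤ I.W i j₁) ∧
  (∀ (i₁ i₂ : Fin m) (j₁ j₂ : Fin n), i₁ < i₂ → j₁ < j₂ →
    I.W i₁ j₂ + I.W i₂ j₁ ≤ I.W i₁ j₁ + I.W i₂ j₂)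

/-- The type `T_i` of an item: the set of the properties it has. -/
def itemType (i : Fin m) : Finset (Fin p) := {ℓ | i ∈ I.P ℓ}

/-- `Δ`, the largest number of properties of an item. -/
def Delta : ℕ := Finset.univ.sup fun i => (I.itemType i).card

/-- The number of items with property `ℓ` that the ranking `π` places at the positions down to
and including `k`. A ranking is a one-to-one function from positions to items. -/
def topCount (π : Fin n ↪ Fin m) (k : Fin n) (ℓ : Fin p) : ℕ :=
  (Finset.univ.filter fun j : Fin n => j ≤ k ∧ π j ∈ I.P ℓ).card

/-- The ranking satisfies all fairness constraints. -/
def Feasible (π : Fin n ↪ Fin m) : Prop :=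
  ∀ k ℓ, I.L k ℓ ≤ I.topCount π k ℓ ∧ I.topCount π k ℓ ≤ I.U k ℓ

/-- The total value of a ranking. -/
noncomputable def value (π : Fin n ↪ Fin m) : ℝ := ∑ j, I.W (π j) j

/-- The ranking is a solution of the constrained ranking maximization problem. -/
def Optimal (π : Fin n ↪ Fin m) : Prop :=
  I.Feasible π ∧ ∀ π', I.Feasible π' → I.value π' ≤ I.value π

end Instance

/-! # Minimum cost flow and successive shortest paths -/

/-- A directed multigraph with capacities, costs, a source and a sink. The edges of the network
are the elements of `edges`; parallel edges are allowed. -/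
structure Network (V E : Type) where
  edges : Finset E
  tail : E → V
  head : E → V
  cap : E → ℕ
  cost : E → ℝ
  source : V
  sink : V

namespace Network

variable {V E : Type} (N : Network V E)

/-- There is no directed cycle. -/
def Acyclic : Prop :=
  ∀ v, ¬ Relation.TransGen (fun u w => ∃ e ∈ N.edges, N.tail e = u ∧ N.head e = w) v v

open Classical in
/-- Flow out of `v` minus flow into `v`. -/
noncomputable def excess (f : E → ℝ) (v : V) : ℝ :=
  (∑ e ∈ N.edges with N.tail e = v, f e) - ∑ e ∈ N.edges with N.head e = v, f e

/-- `f` is a feasible flow of value `r`. -/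
def IsFlow (f : E → ℝ) (r : ℝ) : Prop :=
  (∀ e ∈ N.edges, 0 ≤ f e ∧ f e ≤ N.cap e) ∧
  (∀ v, v ≠ N.source → v ≠ N.sink → N.excess f v = 0) ∧
  N.excess f N.source = r

/-- The cost of a flow. -/
noncomputable def flowCost (f : E → ℝ) : ℝ := ∑ e ∈ N.edges, N.cost e * f e

/-- `f` has minimum cost among all (real-valued) feasible flows of value `r`. -/
def IsMinCostFlow (f : E → ℝ) (r : ℝ) : Prop :=
  N.IsFlow f r ∧ ∀ g, N.IsFlow g r → N.flowCost f ≤ N.flowCost g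

/-- `f` takes integer values on the edges. -/
def Integral (f : E → ℝ) : Prop := ∀ e ∈ N.edges, ∃ z : ℤ, f e = z

/-- The start of a residual arc: `(e, true)` is `e` and `(e, false)` is `e` reversed. -/
def arcTail (a : E × Bool) : V := if a.2 then N.tail a.1 else N.head a.1

/-- The end of a residual arc. -/
def arcHead (a : E × Bool) : V := if a.2 then N.head a.1 else N.tail a.1

/-- The cost of a residual arc. -/
def arcCost (a : E × Bool) : ℝ := if a.2 then N.cost a.1 else - N.cost a.1

/-- The arc belongs to the residual network of the flow `f`. -/
def InResidual (f : E → ℝ) (a : E × Bool) : Prop :=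
  a.1 ∈ N.edges ∧ if a.2 then f a.1 < N.cap a.1 else 0 < f a.1

/-- The list of arcs is a directed walk from `u` to `v`. -/
def IsWalk : V → List (E × Bool) → V → Prop
  | u, [], v => u = v
  | u, a :: l, v => N.arcTail a = u ∧ IsWalk (N.arcHead a) l v

/-- A path without repeated vertices from source to sink in the residual network of `f`. -/
def IsAugmentingPath (f : E → ℝ) (l : List (E × Bool)) : Prop :=
  N.IsWalk N.source l N.sink ∧ (∀ a ∈ l, N.InResidual f a) ∧
  (N.source :: l.map N.arcHead).Nodup

/-- The cost (length) of a list of arcs. -/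
def pathCost (l : List (E × Bool)) : ℝ := (l.map N.arcCost).sum

/-- A cheapest augmenting path. -/
def IsShortestAugmentingPath (f : E → ℝ) (l : List (E × Bool)) : Prop :=
  N.IsAugmentingPath f l ∧ ∀ l', N.IsAugmentingPath f l' → N.pathCost l ≤ N.pathCost l'

open Classical in
/-- Send one unit along the path. -/
noncomputable def augment (f : E → ℝ) (l : List (E × Bool)) : E → ℝ := fun e =>
  f e + (if (e, true) ∈ l then 1 else 0) - (if (e, false) ∈ l then 1 else 0)

/-- `N.SSP r f`: the flow `f` can arise from the zero flow by `r` steps of the successive shortest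
path algorithm, each of which augments one unit along some shortest augmenting path. (For unit
capacities, one unit is the residual capacity of every augmenting path.) -/
inductive SSP : ℕ → (E → ℝ) → Prop
  | start : SSP 0 (fun _ => 0)
  | step {r : ℕ} {f : E → ℝ} {l : List (E × Bool)} :
      SSP r f → N.IsShortestAugmentingPath f l → SSP (r + 1) (augment f l)

end Network

/-! # The network of a ranking instance -/

/-- The vertices: source `s`, sink `t`, a vertex `γ_k` for every position, and a chain of `n + 1`
vertices `ρ_{c,0}, …, ρ_{c,n}` for every class `c` of items. The class `some ℓ` is the property
`ℓ`; the class `none` collects the items without any property. -/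
inductive Vertex (n p : ℕ) : Type
  | s : Vertex n p
  | t : Vertex n p
  | γ (k : Fin n) : Vertex n p
  | ρ (c : Option (Fin p)) (k : Fin (n + 1)) : Vertex n p
  deriving DecidableEq, Fintype

/-- Names for the edges; which of them are present is decided by `Instance.IsEdge`. -/
inductive Edge (m n p : ℕ) : Type
  /-- from `γ k` to `t` -/
  | toSink (k : Fin n) : Edge m n p
  /-- from `ρ c k` to `γ k`: the chain of `c` serves position `k` -/
  | exit (c : Option (Fin p)) (k : Fin n) : Edge m n p
  /-- from `s` to the start `ρ c n` of the chain of `c`, for an item `i` of the class `c` -/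
  | entry (c : Option (Fin p)) (i : Fin m) : Edge m n p
  /-- from `ρ c (k + 1)` to `ρ c k`, for an item `i` of the class `c` -/
  | chain (c : Option (Fin p)) (k : Fin n) (i : Fin m) : Edge m n p
  deriving DecidableEq, Fintype

namespace Instance

variable {m n p : ℕ} (I : Instance m n p)

/-- The items of a class. -/
def classItems : Option (Fin p) → Finset (Fin m)
  | some ℓ => I.P ℓ
  | none => {i | ∀ ℓ, i ∉ I.P ℓ}

/-- Upper bounds of a class; the class of the items without property is not restricted. -/
def upper (k : Fin n) : Option (Fin p) → ℕ
  | some ℓ => I.U k ℓ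
  | none => n

/-- Lower bounds of a class. -/
def lower (k : Fin n) : Option (Fin p) → ℕ
  | some ℓ => I.L k ℓ
  | none => 0

/-- The number of items of the class `c` that precede `i`. -/
def rank (c : Option (Fin p)) (i : Fin m) : ℕ := ((I.classItems c).filter (· < i)).card

/-- The edges of the network: all edges `toSink` and `exit`, an edge `entry` for every item of the
class, and edges `chain` at position `k` for the first `upper k c` items of the class. -/
def IsEdge : Edge m n p → Prop
  | .toSink _ => True
  | .exit _ _ => True
  | .entry c i => i ∈ I.classItems c
  | .chain c k i => i ∈ I.classItems c ∧ I.rank c i < I.upper k c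

/-- The weight of item `i` at the (zero-based) position `k`, and `0` beyond the last position. -/
noncomputable def extW (i : Fin m) (k : ℕ) : ℝ := if h : k < n then I.W i ⟨k, h⟩ else 0

open Classical in
/-- The unit-capacity network of the instance, with the parameter `M` by which the costs of the
first `lower k c` chain edges are decreased. -/
noncomputable def network (M : ℝ) : Network (Vertex n p) (Edge m n p) where
  edges := Finset.univ.filter I.IsEdge
  tail
    | .toSink k => .γ k
    | .exit c k => .ρ c k.castSucc
    | .entry _ _ => .s
    | .chain c k _ => .ρ c k.succ
  head
    | .toSink _ => .t
    | .exit _ k => .γ k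
    | .entry c _ => .ρ c (Fin.last n)
    | .chain c k _ => .ρ c k.castSucc
  cap _ := 1
  cost
    | .toSink _ => 0
    | .exit _ _ => 0
    | .entry _ _ => 0
    | .chain c k i =>
        I.extW i (k + 1) - I.W i k - if I.rank c i < I.lower k c then M else 0
  source := .s
  sink := .t

open Classical in
/-- The amount of flow from `ρ c (k + 1)` to `ρ c k`. -/
noncomputable def chainFlow (f : Edge m n p → ℝ) (c : Option (Fin p)) (k : Fin n) : ℝ :=
  ∑ i with I.IsEdge (.chain c k i), f (.chain c k i)

/-- The flow sends at least `L k ℓ` units through position `k` of the chain of `ℓ`. -/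
def MeetsLowerBounds (f : Edge m n p → ℝ) : Prop :=
  ∀ k ℓ, (I.L k ℓ : ℝ) ≤ I.chainFlow f (some ℓ) k

/-- `π` is the ranking read off the flow `f`: the item at position `k` is from the class `c` whose
chain sends a unit to `γ k`, and if this is the `r`-th exit of flow from that chain, counted from
the top position, then it is the `r`-th item of the class. -/
def ReadsOff (f : Edge m n p → ℝ) (π : Fin n ↪ Fin m) : Prop :=
  ∀ k, ∃ c, f (.exit c k) = 1 ∧ π k ∈ I.classItems c ∧
    ((I.rank c (π k) : ℝ) + 1 = ∑ k' with k' ≤ k, f (.exit c k'))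

end Instance

/-! # A real RAM with unit costs

Programs with natural-number and real registers, and random access memory in finitely many
one-dimensional arrays of natural numbers and of real numbers. Integer arithmetic is restricted to
addition and (truncated) subtraction, real arithmetic to addition and subtraction; both kinds of
numbers can be compared. Every operation, memory access, constant, assignment and test costs
one. -/

/-- Natural-number expressions. -/
inductive NExpr : Type
  | const (c : ℕ) : NExpr
  | reg (x : ℕ) : NExpr
  | get (a : ℕ) (e : NExpr) : NExpr
  | add (e₁ e₂ : NExpr) : NExpr
  | sub (e₁ e₂ : NExpr) : NExpr

/-- Real expressions. -/
inductive RExpr : Type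
  | zero : RExpr
  | one : RExpr
  | reg (x : ℕ) : RExpr
  | get (a : ℕ) (e : NExpr) : RExpr
  | add (e₁ e₂ : RExpr) : RExpr
  | sub (e₁ e₂ : RExpr) : RExpr

/-- Tests. -/
inductive Cond : Type
  | nlt (e₁ e₂ : NExpr) : Cond
  | rlt (e₁ e₂ : RExpr) : Cond
  | neg (b : Cond) : Cond
  | conj (b₁ b₂ : Cond) : Cond

/-- Programs. -/
inductive Prog : Type
  | skip : Prog
  | setN (x : ℕ) (e : NExpr) : Prog
  | setR (x : ℕ) (e : RExpr) : Prog
  | putN (a : ℕ) (i e : NExpr) : Prog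
  | putR (a : ℕ) (i : NExpr) (e : RExpr) : Prog
  | seq (s₁ s₂ : Prog) : Prog
  | cond (b : Cond) (s₁ s₂ : Prog) : Prog
  | loop (b : Cond) (s : Prog) : Prog

/-- A memory state: registers and arrays. -/
structure State where
  nreg : ℕ → ℕ
  rreg : ℕ → ℝ
  narr : ℕ → ℕ → ℕ
  rarr : ℕ → ℕ → ℝ

/-- The value of a natural-number expression. -/
def NExpr.eval (σ : State) : NExpr → ℕ
  | .const c => c
  | .reg x => σ.nreg x
  | .get a e => σ.narr a (e.eval σ)
  | .add e₁ e₂ => e₁.eval σ + e₂.eval σ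
  | .sub e₁ e₂ => e₁.eval σ - e₂.eval σ

/-- The number of steps for evaluating a natural-number expression. -/
def NExpr.size : NExpr → ℕ
  | .const _ => 1
  | .reg _ => 1
  | .get _ e => e.size + 1
  | .add e₁ e₂ => e₁.size + e₂.size + 1
  | .sub e₁ e₂ => e₁.size + e₂.size + 1

/-- The value of a real expression. -/
noncomputable def RExpr.eval (σ : State) : RExpr → ℝ
  | .zero => 0
  | .one => 1
  | .reg x => σ.rreg x
  | .get a e => σ.rarr a (e.eval σ)
  | .add e₁ e₂ => e₁.eval σ + e₂.eval σ
  | .sub e₁ e₂ => e₁.eval σ - e₂.eval σ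

/-- The number of steps for evaluating a real expression. -/
def RExpr.size : RExpr → ℕ
  | .zero => 1
  | .one => 1
  | .reg _ => 1
  | .get _ e => e.size + 1
  | .add e₁ e₂ => e₁.size + e₂.size + 1
  | .sub e₁ e₂ => e₁.size + e₂.size + 1

/-- The truth of a test. -/
def Cond.Holds (σ : State) : Cond → Prop
  | .nlt e₁ e₂ => e₁.eval σ < e₂.eval σ
  | .rlt e₁ e₂ => e₁.eval σ < e₂.eval σ
  | .neg b => ¬ b.Holds σ
  | .conj b₁ b₂ => b₁.Holds σ ∧ b₂.Holds σ

/-- The number of steps for evaluating a test. -/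
def Cond.size : Cond → ℕ
  | .nlt e₁ e₂ => e₁.size + e₂.size + 1
  | .rlt e₁ e₂ => e₁.size + e₂.size + 1
  | .neg b => b.size + 1
  | .conj b₁ b₂ => b₁.size + b₂.size + 1

/-- `Run s σ σ' t`: the program `s`, started in the state `σ`, halts in the state `σ'` after `t`
steps. -/
inductive Run : Prog → State → State → ℕ → Prop
  | skip (σ : State) : Run .skip σ σ 1
  | setN (σ : State) (x : ℕ) (e : NExpr) :
      Run (.setN x e) σ { σ with nreg := Function.update σ.nreg x (e.eval σ) } (e.size + 1)
  | setR (σ : State) (x : ℕ) (e : RExpr) :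
      Run (.setR x e) σ { σ with rreg := Function.update σ.rreg x (e.eval σ) } (e.size + 1)
  | putN (σ : State) (a : ℕ) (i e : NExpr) :
      Run (.putN a i e) σ
        { σ with narr := Function.update σ.narr a
                  (Function.update (σ.narr a) (i.eval σ) (e.eval σ)) }
        (i.size + e.size + 1)
  | putR (σ : State) (a : ℕ) (i : NExpr) (e : RExpr) :
      Run (.putR a i e) σ
        { σ with rarr := Function.update σ.rarr a
                  (Function.update (σ.rarr a) (i.eval σ) (e.eval σ)) }
        (i.size + e.size + 1)
  | seq {s₁ s₂ : Prog} {σ₀ σ₁ σ₂ : State} {t₁ t₂ : ℕ} :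
      Run s₁ σ₀ σ₁ t₁ → Run s₂ σ₁ σ₂ t₂ → Run (.seq s₁ s₂) σ₀ σ₂ (t₁ + t₂)
  | condTrue {b : Cond} {s₁ s₂ : Prog} {σ σ' : State} {t : ℕ} :
      b.Holds σ → Run s₁ σ σ' t → Run (.cond b s₁ s₂) σ σ' (b.size + 1 + t)
  | condFalse {b : Cond} {s₁ s₂ : Prog} {σ σ' : State} {t : ℕ} :
      ¬ b.Holds σ → Run s₂ σ σ' t → Run (.cond b s₁ s₂) σ σ' (b.size + 1 + t)
  | loopTrue {b : Cond} {s : Prog} {σ₀ σ₁ σ₂ : State} {t₁ t₂ : ℕ} :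
      b.Holds σ₀ → Run s σ₀ σ₁ t₁ → Run (.loop b s) σ₁ σ₂ t₂ →
        Run (.loop b s) σ₀ σ₂ (b.size + 1 + t₁ + t₂)
  | loopFalse {b : Cond} {s : Prog} {σ : State} :
      ¬ b.Holds σ → Run (.loop b s) σ σ (b.size + 1)

/-! # Input and output -/

/-- The matrix `A` stored row by row in an array: cell `b * i + j` holds `A i j`, all other cells
hold `0`. -/
def rowMajor {α : Type} [Zero α] {a b : ℕ} (A : Fin a → Fin b → α) (x : ℕ) : α :=
  if h : x < a * b then
    A (finProdFinEquiv.symm ⟨x, h⟩).1 (finProdFinEquiv.symm ⟨x, h⟩).2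
  else 0

namespace Instance

variable {m n p : ℕ} (I : Instance m n p)

/-- `inc` lists, without repetition and in any order, the pairs `(i, ℓ)` with `i ∈ P ℓ`. -/
def Lists (inc : List (Fin m × Fin p)) : Prop :=
  inc.Nodup ∧ ∀ i ℓ, (i, ℓ) ∈ inc ↔ i ∈ I.P ℓ

/-- The initial memory. The registers `0, 1, 2, 3` hold `m`, `n`, `p` and the length of the list
`inc`; the real array `0` holds `W`; the natural-number arrays `0`, `1`, `2`, `3` hold `L`, `U`,
and the items and the properties of the pairs in `inc`. Everything else is `0`. -/
noncomputable def input (inc : List (Fin m × Fin p)) : State where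
  nreg
    | 0 => m
    | 1 => n
    | 2 => p
    | 3 => inc.length
    | _ => 0
  rreg _ := 0
  narr
    | 0 => rowMajor I.L
    | 1 => rowMajor I.U
    | 2 => fun x => (inc.map fun q => (q.1 : ℕ)).getD x 0
    | 3 => fun x => (inc.map fun q => (q.2 : ℕ)).getD x 0
    | _ => fun _ => 0
  rarr
    | 0 => rowMajor I.W
    | _ => fun _ => 0

/-- The final memory holds the answer: register `0` is `1` and the array `0` holds an optimal
ranking, or register `0` is `0` and there is no feasible ranking. -/
def Answers (σ : State) : Prop :=
  (σ.nreg 0 = 1 ∧ ∃ π, I.Optimal π ∧ ∀ j : Fin n, σ.narr 0 j = π j) ∨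
  (σ.nreg 0 = 0 ∧ ¬ ∃ π, I.Feasible π)

end Instance

end FairRanking

namespace FairRanking

/-! ### Minimum cost flow: potentials, shortest augmenting paths, cuts. -/

namespace Network

variable {V E : Type} (N : Network V E)

/-! Reduction. Telescoping writes the value of a ranking as minus a sum, over positions `k` and
classes `c`, of the differences W_{i,k+1} - W_{i,k} of the items of `c` placed down to `k`
(`value_eq_neg_sum`). By the Monge condition, and by monotonicity at the last position, these
differences are nondecreasing in the item. So among subsets of a class of given size the initial
segment is cheapest (`sum_firstItems_le`), and putting the items of every class in their natural
order keeps all class counts and does not lower the value (`IsSorted.value_le`). What remains to be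
chosen is only the class of each position. Such a choice is what an integral flow of value `n`
encodes: each γ_k receives one unit from one chain, and position `k` of the chain of `c` carries as
many units as there are exits from it down to `k`. The cheapest flow for a given choice uses the
first edges everywhere and costs -value - M * ∑ min(count, L) (`IsSorted.classCost_eq`). Since `M`
exceeds any possible difference of values, a minimum cost flow meets all lower bounds as soon as
some ranking does, and then maximizes the value (`optimal_of_isMinCostFlow`). Successive shortest
paths is handled with potentials. A potential certifies optimality (`IsPotential.isMinCostFlow`);
acyclicity supplies one for the zero flow; adding shortest distances carries it through an
augmentation (`IsShortestAugmentingPath.exists_isPotential`); a cut argument shows that an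
augmenting path exists while the value is below an attainable one. Program. It does not touch the
network but solves an assignment problem of `n` positions against `m` items. An item of rank `r` in
the class ℓ placed at `j` pays, for every k ≥ j, a penalty `B` if r ≥ U_{kℓ} and earns `B` if r <
L_{kℓ}. The total is -value + B * (violations - ∑ L) (`sum_assignCost`). Violations are zero only
for feasible rankings, and are zero for sorted feasible ones. Hence for large `B` a cheapest
assignment is feasible if any ranking is, and is then optimal; feasibility of the result is tested
at the end. The costs are suffix sums, found in O(nm) steps. The Hungarian method matches each of
the `n` rows by a Dijkstra search in O(nm) steps. The total is O(n²m), so the logarithm in the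
theorem is slack. -/

theorem sum_mul_excess [Fintype V] (f : E → ℝ) (φ : V → ℝ) :
    ∑ v, φ v * N.excess f v = ∑ e ∈ N.edges, (φ (N.tail e) - φ (N.head e)) * f e := by
  classical
  simp only [excess, mul_sub, Finset.sum_sub_distrib, Finset.mul_sum, Finset.sum_filter, sub_mul]
  congr 1 <;>
  · rw [Finset.sum_comm]
    refine Finset.sum_congr rfl fun e _ => ?_
    simp

open Classical in
theorem excess_eq_sum (f : E → ℝ) (v : V) :
    N.excess f v = ∑ e ∈ N.edges, ((if N.tail e = v then (1 : ℝ) else 0) -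
      if N.head e = v then 1 else 0) * f e := by
  simp [excess, Finset.sum_filter, sub_mul, Finset.sum_sub_distrib]

/-- The potential `φ` makes all reduced costs of residual arcs nonnegative. -/
def IsPotential (f : E → ℝ) (φ : V → ℝ) : Prop :=
  ∀ a, N.InResidual f a → 0 ≤ N.arcCost a + φ (N.arcTail a) - φ (N.arcHead a)

theorem sum_mul_excess_of_isFlow [Fintype V] (hst : N.source ≠ N.sink) {f : E → ℝ} {r : ℝ}
    (hf : N.IsFlow f r) (φ : V → ℝ) :
    ∑ v, φ v * N.excess f v = (φ N.source - φ N.sink) * r := by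
  classical
  have key : ∀ ψ : V → ℝ, ∑ v, ψ v * N.excess f v =
      ψ N.source * r + ψ N.sink * N.excess f N.sink := by
    intro ψ
    rw [← Finset.sum_subset (Finset.subset_univ {N.source, N.sink}), Finset.sum_pair hst, hf.2.2]
    intro v _ hv
    simp only [Finset.mem_insert, Finset.mem_singleton, not_or] at hv
    rw [hf.2.1 v hv.1 hv.2, mul_zero]
  -- Constant weights annihilate every edge, so all excesses cancel and the sink has excess `-r`.
  have h1 := key fun _ => 1
  rw [sum_mul_excess] at h1
  simp only [sub_self, zero_mul, Finset.sum_const_zero, one_mul] at h1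
  rw [key, show N.excess f N.sink = -r by linarith]
  ring

/-- Complementary slackness. The potential terms sum to the same amount for all flows of value `r`,
so costs may be replaced by reduced costs. Then `f` wins edge by edge: where `f` is below `g` the
forward arc is residual, where it is above the backward arc is. -/
theorem IsPotential.isMinCostFlow [Fintype V] {N : Network V E} (hst : N.source ≠ N.sink)
    {f : E → ℝ} {φ : V → ℝ} (hφ : N.IsPotential f φ) {r : ℝ} (hf : N.IsFlow f r) :
    N.IsMinCostFlow f r := by
  refine ⟨hf, fun g hg => ?_⟩
  have e1 := N.sum_mul_excess f φ
  have e2 := N.sum_mul_excess g φ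
  rw [N.sum_mul_excess_of_isFlow hst hf] at e1
  rw [N.sum_mul_excess_of_isFlow hst hg] at e2
  have : ∑ e ∈ N.edges, (N.cost e + (φ (N.tail e) - φ (N.head e))) * f e ≤
      ∑ e ∈ N.edges, (N.cost e + (φ (N.tail e) - φ (N.head e))) * g e := by
    refine Finset.sum_le_sum fun e he => ?_
    have b := hf.1 e he
    have b' := hg.1 e he
    have h1 : f e < N.cap e → 0 ≤ N.cost e + φ (N.tail e) - φ (N.head e) := fun h => by
      simpa [arcCost, arcTail, arcHead] using hφ (e, true) ⟨he, by simpa using h⟩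
    have h2 : 0 < f e → 0 ≤ -N.cost e + φ (N.head e) - φ (N.tail e) := fun h => by
      simpa [arcCost, arcTail, arcHead] using hφ (e, false) ⟨he, by simpa using h⟩
    rcases lt_trichotomy (f e) (g e) with h | h | h
    · exact mul_le_mul_of_nonneg_left h.le (by have := h1 (h.trans_le b'.2); linarith)
    · rw [h]
    · have := h2 (b'.1.trans_lt h)
      nlinarith
  simp only [add_mul, Finset.sum_add_distrib] at this
  unfold flowCost
  linarith

theorem IsWalk.append {N : Network V E} : ∀ {l₁ l₂ : List (E × Bool)} {u v w : V},
    N.IsWalk u l₁ v → N.IsWalk v l₂ w → N.IsWalk u (l₁ ++ l₂) w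
  | [], _, _, _, _, h₁, h₂ => by cases h₁; exact h₂
  | _ :: _, _, _, _, _, h₁, h₂ => ⟨h₁.1, h₁.2.append h₂⟩

theorem isWalk_append_iff {N : Network V E} : ∀ {l₁ l₂ : List (E × Bool)} {u w : V},
    N.IsWalk u (l₁ ++ l₂) w ↔ ∃ v, N.IsWalk u l₁ v ∧ N.IsWalk v l₂ w
  | [], _, u, _ => by simp [IsWalk]
  | a :: l, l₂, u, w => by
    have := isWalk_append_iff (N := N) (l₁ := l) (l₂ := l₂) (u := N.arcHead a) (w := w)
    simp only [List.cons_append, IsWalk, this]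
    tauto

theorem pathCost_append (l₁ l₂ : List (E × Bool)) :
    N.pathCost (l₁ ++ l₂) = N.pathCost l₁ + N.pathCost l₂ := by
  simp [pathCost]

theorem pathCost_cons (a : E × Bool) (l : List (E × Bool)) :
    N.pathCost (a :: l) = N.arcCost a + N.pathCost l := by
  simp [pathCost]

theorem IsPotential.nonneg_of_isWalk {N : Network V E} {f : E → ℝ} {φ : V → ℝ}
    (hφ : N.IsPotential f φ) : ∀ {l : List (E × Bool)} {u v : V}, N.IsWalk u l v →
    (∀ a ∈ l, N.InResidual f a) → 0 ≤ N.pathCost l + φ u - φ v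
  | [], u, v, h, _ => by cases h; simp [pathCost]
  | a :: l, u, v, h, hr => by
    have h1 := hφ a (hr a (by simp))
    have h2 := hφ.nonneg_of_isWalk h.2 fun b hb => hr b (by simp [hb])
    rw [h.1] at h1
    rw [pathCost_cons]
    linarith

/-- The sublist clause is what lets the part after `x` inherit distinctness of vertices. -/
theorem IsWalk.split {N : Network V E} : ∀ {l : List (E × Bool)} {u v x : V}, N.IsWalk u l v →
    x ∈ u :: l.map N.arcHead → ∃ l₁ l₂, l = l₁ ++ l₂ ∧ N.IsWalk u l₁ x ∧ N.IsWalk x l₂ v ∧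
      (x :: l₂.map N.arcHead).Sublist (u :: l.map N.arcHead)
  | [], u, v, x, h, hx => by
    simp only [List.map_nil, List.mem_singleton] at hx
    subst hx
    exact ⟨[], [], rfl, rfl, h, List.Sublist.refl _⟩
  | a :: l, u, v, x, h, hx => by
    by_cases hxu : x = u
    · subst hxu
      exact ⟨[], a :: l, rfl, rfl, h, List.Sublist.refl _⟩
    · obtain ⟨l₁, l₂, e, w₁, w₂, s⟩ := h.2.split (x := x) (by simpa [hxu] using hx)
      exact ⟨a :: l₁, l₂, by simp [e], ⟨h.1, w₁⟩, w₂, by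
        simpa using s.trans (List.sublist_cons_self _ _)⟩

/-- A closed walk of residual arcs has nonnegative cost, because the potential telescopes away; so
cutting out loops does not raise the cost. -/
theorem IsPotential.exists_simple {N : Network V E} {f : E → ℝ} {φ : V → ℝ}
    (hφ : N.IsPotential f φ) : ∀ {l : List (E × Bool)} {u v : V}, N.IsWalk u l v →
    (∀ a ∈ l, N.InResidual f a) → ∃ l', N.IsWalk u l' v ∧ (∀ a ∈ l', N.InResidual f a) ∧
      (u :: l'.map N.arcHead).Nodup ∧ N.pathCost l' ≤ N.pathCost l
  | [], u, v, h, _ => ⟨[], h, by simp, by simp, le_rfl⟩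
  | a :: l, u, v, h, hr => by
    obtain ⟨l', w, hr', hn, hc⟩ := hφ.exists_simple h.2 fun b hb => hr b (by simp [hb])
    by_cases hu : u ∈ N.arcHead a :: l'.map N.arcHead
    · obtain ⟨l₁, l₂, rfl, w₁, w₂, s⟩ := w.split hu
      refine ⟨l₂, w₂, fun b hb => hr' b (by simp [hb]), s.nodup hn, ?_⟩
      have h1 := hφ a (hr a (by simp))
      have h2 := hφ.nonneg_of_isWalk w₁ fun b hb => hr' b (by simp [hb])
      rw [pathCost_append] at hc
      rw [h.1] at h1
      rw [pathCost_cons]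
      linarith
    · refine ⟨a :: l', ⟨h.1, w⟩, ?_, List.nodup_cons.2 ⟨hu, hn⟩, ?_⟩
      · intro b hb
        rcases List.mem_cons.1 hb with rfl | hb
        · exact hr _ (by simp)
        · exact hr' b hb
      · rw [pathCost_cons, pathCost_cons]
        linarith

theorem IsShortestAugmentingPath.pathCost_le_of_isWalk {N : Network V E} {f : E → ℝ} {φ : V → ℝ}
    (hφ : N.IsPotential f φ) {l l' : List (E × Bool)} (hl : N.IsShortestAugmentingPath f l)
    (w : N.IsWalk N.source l' N.sink) (hr : ∀ a ∈ l', N.InResidual f a) :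
    N.pathCost l ≤ N.pathCost l' := by
  obtain ⟨l₁, h1, h2, h3, h4⟩ := hφ.exists_simple w hr
  exact (hl.2 l₁ ⟨h1, h2, h3⟩).trans h4

theorem sum_map_arcs {l : List (E × Bool)} (hn : l.Nodup) (hl : ∀ a ∈ l, a.1 ∈ N.edges)
    (g : E × Bool → ℝ) [DecidablePred (· ∈ l)] :
    (l.map g).sum = ∑ e ∈ N.edges, ((if (e, true) ∈ l then g (e, true) else 0) +
      if (e, false) ∈ l then g (e, false) else 0) := by
  classical
  rw [← List.sum_toFinset _ hn]
  have : ∀ e, ((if (e, true) ∈ l then g (e, true) else 0) +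
      if (e, false) ∈ l then g (e, false) else 0) =
      ∑ b : Bool, if (e, b) ∈ l then g (e, b) else 0 := fun e => by simp
  simp only [this]
  rw [← Finset.sum_product' N.edges Finset.univ (fun e b => if (e, b) ∈ l then g (e, b) else 0),
    ← Finset.sum_filter]
  refine Finset.sum_congr ?_ fun _ _ => rfl
  ext a
  simp only [List.mem_toFinset, Finset.mem_filter, Finset.mem_product, Finset.mem_univ, and_true]
  exact ⟨fun h => ⟨hl a h, h⟩, fun h => h.2⟩

theorem IsWalk.sum_sub {N : Network V E} (φ : V → ℝ) : ∀ {l : List (E × Bool)} {u v : V},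
    N.IsWalk u l v → (l.map fun a => φ (N.arcTail a) - φ (N.arcHead a)).sum = φ u - φ v
  | [], u, v, h => by cases h; simp
  | a :: l, u, v, h => by
    have := h.2.sum_sub φ
    simp only [List.map_cons, List.sum_cons, this, h.1]
    ring

theorem IsAugmentingPath.nodup {N : Network V E} {f : E → ℝ} {l : List (E × Bool)}
    (h : N.IsAugmentingPath f l) : l.Nodup :=
  List.Nodup.of_map _ (List.nodup_cons.1 h.2.2).2

open Classical in
theorem IsAugmentingPath.excess_augment {N : Network V E} {f : E → ℝ} {l : List (E × Bool)}
    (h : N.IsAugmentingPath f l) (v : V) :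
    N.excess (augment f l) v =
      N.excess f v + (if N.source = v then 1 else 0) - if N.sink = v then 1 else 0 := by
  have h1 := h.1.sum_sub fun x => if x = v then (1 : ℝ) else 0
  rw [N.sum_map_arcs h.nodup (fun a ha => (h.2.1 a ha).1)] at h1
  rw [excess_eq_sum, excess_eq_sum, add_sub_assoc, ← h1, ← Finset.sum_add_distrib]
  refine Finset.sum_congr rfl fun e _ => ?_
  simp only [augment, arcTail, arcHead, if_true]
  split_ifs <;> simp_all <;> ring

/-- Integrality turns the strict inequalities that define residual arcs into room for a whole unit.
-/
theorem IsAugmentingPath.isFlow_augment {N : Network V E} (hst : N.source ≠ N.sink) {f : E → ℝ}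
    {l : List (E × Bool)} (h : N.IsAugmentingPath f l) {r : ℝ} (hf : N.IsFlow f r)
    (hi : N.Integral f) : N.IsFlow (augment f l) (r + 1) ∧ N.Integral (augment f l) := by
  classical
  refine ⟨⟨fun e he => ?_, fun v hs ht => ?_, ?_⟩, fun e he => ?_⟩
  · obtain ⟨z, hz⟩ := hi e he
    have b := hf.1 e he
    have h1 : (e, true) ∈ l → f e + 1 ≤ N.cap e := fun hm => by
      have := (h.2.1 _ hm).2
      simp only [if_true, hz] at this ⊢
      exact_mod_cast this
    have h2 : (e, false) ∈ l → 1 ≤ f e := fun hm => by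
      have := (h.2.1 _ hm).2
      simp only [Bool.false_eq_true, if_false, hz] at this ⊢
      exact_mod_cast this
    simp only [augment]
    constructor <;> split_ifs with a1 a2 a2 <;> simp only [a1, a2, forall_const] at h1 h2 <;>
      linarith
  · rw [h.excess_augment, hf.2.1 v hs ht]
    simp [hs.symm, ht.symm]
  · rw [h.excess_augment, hf.2.2]
    simp [hst.symm]
  · obtain ⟨z, hz⟩ := hi e he
    refine ⟨z + (if (e, true) ∈ l then 1 else 0) - (if (e, false) ∈ l then 1 else 0), ?_⟩
    simp only [augment, hz]
    push_cast
    rfl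

/-- The new potential adds to `φ` the distances `d` from the source in reduced costs. Old residual
arcs stay nonnegative by the triangle inequality. Arcs of the path become tight, so their reversals,
the only new residual arcs, have reduced cost zero. -/
theorem IsShortestAugmentingPath.exists_isPotential {N : Network V E} {f : E → ℝ} {φ : V → ℝ}
    (hφ : N.IsPotential f φ) {l : List (E × Bool)} (hl : N.IsShortestAugmentingPath f l) :
    ∃ φ', N.IsPotential (augment f l) φ' := by
  classical
  set D := N.pathCost l + φ N.source - φ N.sink with hD
  -- Including `D`, the reduced length of the path, truncates the distances there; this also gives a
  -- value to unreachable vertices.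
  let S : V → Set ℝ := fun v => insert D
    {x | ∃ w, N.IsWalk N.source w v ∧ (∀ a ∈ w, N.InResidual f a) ∧
      x = N.pathCost w + φ N.source - φ v}
  let d : V → ℝ := fun v => sInf (S v)
  have hD0 : 0 ≤ D := hφ.nonneg_of_isWalk hl.1.1 hl.1.2.1
  have hb : ∀ v, BddBelow (S v) := by
    refine fun v => ⟨0, ?_⟩
    rintro x (rfl | ⟨w, h1, h2, rfl⟩)
    · exact hD0
    · exact hφ.nonneg_of_isWalk h1 h2
  have hne : ∀ v, (S v).Nonempty := fun v => ⟨D, Or.inl rfl⟩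
  have step : ∀ a, N.InResidual f a → d (N.arcHead a) ≤ d (N.arcTail a) +
      (N.arcCost a + φ (N.arcTail a) - φ (N.arcHead a)) := by
    intro a ha
    rw [← sub_le_iff_le_add]
    refine le_csInf (hne _) ?_
    have := hφ a ha
    rintro x (rfl | ⟨w, h1, h2, rfl⟩)
    · have := csInf_le (hb (N.arcHead a)) (Or.inl rfl : D ∈ S (N.arcHead a))
      simp only [d]
      linarith
    · have hm : N.pathCost (w ++ [a]) + φ N.source - φ (N.arcHead a) ∈ S (N.arcHead a) := by
        refine Or.inr ⟨w ++ [a], h1.append ⟨rfl, rfl⟩, ?_, rfl⟩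
        intro b hb
        rcases List.mem_append.1 hb with hb | hb
        · exact h2 b hb
        · rw [List.mem_singleton.1 hb]; exact ha
      have := csInf_le (hb _) hm
      rw [pathCost_append, pathCost_cons] at this
      simp only [pathCost, List.map_nil, List.sum_nil] at this
      simp only [d, pathCost]
      linarith
  -- On the path neither truncation nor a shortcut matters: the rest of the path has nonnegative
  -- reduced cost, and a cheaper walk to `x` followed by that rest would beat `l`.
  have exact_on : ∀ l₁ l₂ x, l = l₁ ++ l₂ → N.IsWalk N.source l₁ x → N.IsWalk x l₂ N.sink →
      d x = N.pathCost l₁ + φ N.source - φ x := by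
    intro l₁ l₂ x e w1 w2
    have r1 : ∀ a ∈ l₁, N.InResidual f a := fun a ha => hl.1.2.1 a (by simp [e, ha])
    have r2 : ∀ a ∈ l₂, N.InResidual f a := fun a ha => hl.1.2.1 a (by simp [e, ha])
    refine le_antisymm (csInf_le (hb x) (Or.inr ⟨l₁, w1, r1, rfl⟩)) (le_csInf (hne x) ?_)
    have p2 := hφ.nonneg_of_isWalk w2 r2
    rintro y (rfl | ⟨w, h1, h2, rfl⟩)
    · rw [hD, e, pathCost_append]
      linarith
    · have := hl.pathCost_le_of_isWalk hφ (h1.append w2) (fun a ha => by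
        rcases List.mem_append.1 ha with ha | ha
        · exact h2 a ha
        · exact r2 a ha)
      rw [e, pathCost_append, pathCost_append] at this
      linarith
  have tight : ∀ a ∈ l, d (N.arcHead a) = d (N.arcTail a) +
      (N.arcCost a + φ (N.arcTail a) - φ (N.arcHead a)) := by
    intro a ha
    obtain ⟨l₁, l₂, e⟩ := List.append_of_mem ha
    have w := hl.1.1
    rw [e] at w
    obtain ⟨x, w1, w2⟩ := isWalk_append_iff.1 w
    have hx := w2.1
    subst hx
    have e1 := exact_on l₁ (a :: l₂) _ e w1 w2
    have e2 := exact_on (l₁ ++ [a]) l₂ _ (by simp [e]) (w1.append ⟨rfl, rfl⟩) w2.2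
    rw [e1, e2, pathCost_append, pathCost_cons]
    simp only [pathCost, List.map_nil, List.sum_nil]
    ring
  refine ⟨fun v => φ v + d v, ?_⟩
  have old : ∀ a, N.InResidual f a → 0 ≤ N.arcCost a +
      (φ (N.arcTail a) + d (N.arcTail a)) - (φ (N.arcHead a) + d (N.arcHead a)) := by
    intro a ha
    have := step a ha
    linarith
  rintro ⟨e, b⟩ ⟨he, hres⟩
  -- An arc that is residual only after the augmentation is the reversal of an arc of `l`.
  by_cases hold : N.InResidual f (e, b)
  · exact old _ hold
  · cases b
    · have hm : (e, true) ∈ l := by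
        by_contra hm
        refine hold ⟨he, ?_⟩
        simp only [Bool.false_eq_true, if_false, augment, hm] at hres ⊢
        split_ifs at hres <;> linarith
      have := tight _ hm
      simp only [arcHead, arcTail, arcCost, if_true, Bool.false_eq_true, if_false] at this ⊢
      linarith
    · have hm : (e, false) ∈ l := by
        by_contra hm
        refine hold ⟨he, ?_⟩
        simp only [if_true, augment, hm] at hres ⊢
        split_ifs at hres <;> simp_all
        linarith
      have := tight _ hm
      simp only [arcHead, arcTail, arcCost, if_true, Bool.false_eq_true, if_false] at this ⊢
      linarith

theorem isFlow_zero : N.IsFlow (fun _ => 0) 0 :=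
  ⟨fun e _ => ⟨le_rfl, Nat.cast_nonneg _⟩, fun v _ _ => by simp [excess], by simp [excess]⟩

theorem SSP.invariant {N : Network V E} (hst : N.source ≠ N.sink)
    (h0 : ∃ φ, N.IsPotential (fun _ => 0) φ) {r : ℕ} {f : E → ℝ} (h : N.SSP r f) :
    N.IsFlow f r ∧ N.Integral f ∧ ∃ φ, N.IsPotential f φ := by
  induction h with
  | start => exact ⟨by simpa using N.isFlow_zero, fun e _ => ⟨0, by simp⟩, h0⟩
  | step _ hl ih =>
    obtain ⟨h1, h2, φ, h3⟩ := ih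
    have := hl.1.isFlow_augment hst h1 h2
    exact ⟨by simpa using this.1, this.2, hl.exists_isPotential h3⟩

theorem SSP.isMinCostFlow [Fintype V] {N : Network V E} (hst : N.source ≠ N.sink)
    (h0 : ∃ φ, N.IsPotential (fun _ => 0) φ) {r : ℕ} {f : E → ℝ} (h : N.SSP r f) :
    N.IsMinCostFlow f r ∧ N.Integral f := by
  obtain ⟨h1, h2, φ, h3⟩ := h.invariant hst h0
  exact ⟨h3.isMinCostFlow hst h1, h2⟩

/-- If the sink is unreachable, the reachable vertices form a cut whose outgoing edges are saturated
and whose incoming edges are empty, so no flow can have a larger value than `f`. -/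
theorem exists_residual_walk [Fintype V] {N : Network V E} {f g : E → ℝ} {r s : ℝ}
    (hst : N.source ≠ N.sink) (hf : N.IsFlow f r) (hg : N.IsFlow g s) (hrs : r < s) :
    ∃ l, N.IsWalk N.source l N.sink ∧ ∀ a ∈ l, N.InResidual f a := by
  classical
  by_contra hno
  let R : V → Prop := fun v => ∃ l, N.IsWalk N.source l v ∧ ∀ a ∈ l, N.InResidual f a
  have hs : R N.source := ⟨[], rfl, by simp⟩
  have ht : ¬ R N.sink := hno
  have step : ∀ a, N.InResidual f a → R (N.arcTail a) → R (N.arcHead a) := by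
    rintro a ha ⟨l, h1, h2⟩
    refine ⟨l ++ [a], h1.append ⟨rfl, rfl⟩, fun b hb => ?_⟩
    rcases List.mem_append.1 hb with hb | hb
    · exact h2 b hb
    · rw [List.mem_singleton.1 hb]; exact ha
  -- Against the indicator of the reachable set, summation by parts yields the net flow across the
  -- cut.
  let φ : V → ℝ := fun v => if R v then 1 else 0
  have e1 := N.sum_mul_excess f φ
  have e2 := N.sum_mul_excess g φ
  rw [N.sum_mul_excess_of_isFlow hst hf] at e1
  rw [N.sum_mul_excess_of_isFlow hst hg] at e2
  have hle : ∑ e ∈ N.edges, (φ (N.tail e) - φ (N.head e)) * g e ≤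
      ∑ e ∈ N.edges, (φ (N.tail e) - φ (N.head e)) * f e := by
    refine Finset.sum_le_sum fun e he => ?_
    have b := hf.1 e he
    have b' := hg.1 e he
    by_cases t1 : R (N.tail e) <;> by_cases t2 : R (N.head e) <;> simp only [φ, t1, t2, if_true,
      if_false, sub_self, zero_mul, le_refl, sub_zero, one_mul, zero_sub, neg_mul]
    · have : ¬ N.InResidual f (e, true) := fun h => t2 (step _ h t1)
      simp only [InResidual, he, true_and, if_true, not_lt] at this
      linarith
    · have : ¬ N.InResidual f (e, false) := fun h => t1 (step _ h t2)
      simp only [InResidual, he, true_and, Bool.false_eq_true, if_false, not_lt] at this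
      linarith
  rw [← e1, ← e2] at hle
  simp only [φ, hs, ht, if_true, if_false, sub_zero, one_mul] at hle
  linarith

/-- Simple paths have bounded length and there are finitely many arcs, so the minimum is taken over
a finite set. -/
theorem exists_isShortestAugmentingPath [Fintype V] [Finite E] {N : Network V E} {f g : E → ℝ}
    {φ : V → ℝ} {r s : ℝ} (hst : N.source ≠ N.sink) (hφ : N.IsPotential f φ) (hf : N.IsFlow f r)
    (hg : N.IsFlow g s) (hrs : r < s) : ∃ l, N.IsShortestAugmentingPath f l := by
  classical
  obtain ⟨l, h1, h2⟩ := exists_residual_walk hst hf hg hrs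
  obtain ⟨l', w, hr, hn, -⟩ := hφ.exists_simple h1 h2
  have hfin : {l | N.IsAugmentingPath f l}.Finite := by
    refine (List.finite_length_le (E × Bool) (Fintype.card V)).subset fun l hl => ?_
    have := hl.2.2.length_le_card
    simp only [List.length_cons, List.length_map] at this
    simp only [Set.mem_ofPred_eq]
    omega
  obtain ⟨l₀, h0, hmin⟩ := Set.exists_min_image _ N.pathCost hfin ⟨l', w, hr, hn⟩
  exact ⟨l₀, h0, hmin⟩

theorem SSP.exists_next [Fintype V] [Finite E] {N : Network V E} (hst : N.source ≠ N.sink)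
    (h0 : ∃ φ, N.IsPotential (fun _ => 0) φ) {n : ℕ} (hg : ∃ g, N.IsFlow g n) {r : ℕ}
    {f : E → ℝ} (hr : r < n) (h : N.SSP r f) : ∃ l, N.IsShortestAugmentingPath f l := by
  obtain ⟨h1, -, φ, h3⟩ := h.invariant hst h0
  obtain ⟨g, hg⟩ := hg
  exact exists_isShortestAugmentingPath hst h3 h1 hg (by exact_mod_cast hr)

theorem exists_ssp [Fintype V] [Finite E] {N : Network V E} (hst : N.source ≠ N.sink)
    (h0 : ∃ φ, N.IsPotential (fun _ => 0) φ) {n : ℕ} (hg : ∃ g, N.IsFlow g n) :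
    ∃ f, N.SSP n f := by
  have : ∀ r ≤ n, ∃ f, N.SSP r f := by
    intro r
    induction r with
    | zero => exact fun _ => ⟨_, .start⟩
    | succ r ih =>
      intro hr
      obtain ⟨f, hf⟩ := ih (by omega)
      obtain ⟨l, hl⟩ := hf.exists_next hst h0 hg (by omega)
      exact ⟨_, hf.step hl⟩
  exact this n le_rfl

end Network

/-! ### Classes, ranks, and initial segments of a class. -/

namespace Instance

variable {m n p : ℕ} (I : Instance m n p)

open Classical in
/-- The class of an item. -/
noncomputable def classOf (i : Fin m) : Option (Fin p) :=
  if h : ∃ ℓ, i ∈ I.P ℓ then some h.choose else none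

variable {I}

theorem eq_of_mem_of_mem (hΔ : I.Delta = 1) {i : Fin m} {ℓ ℓ' : Fin p} (h : i ∈ I.P ℓ)
    (h' : i ∈ I.P ℓ') : ℓ = ℓ' := by
  have h1 : (I.itemType i).card ≤ 1 :=
    hΔ ▸ Finset.le_sup (f := fun i => (I.itemType i).card) (Finset.mem_univ i)
  exact Finset.card_le_one.1 h1 ℓ (by simpa [itemType] using h) ℓ' (by simpa [itemType] using h')

theorem mem_classItems_iff (hΔ : I.Delta = 1) {i : Fin m} {c : Option (Fin p)} :
    i ∈ I.classItems c ↔ I.classOf i = c := by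
  unfold classOf
  split_ifs with h
  · cases c with
    | none => simpa [classItems] using h
    | some ℓ =>
      simp only [classItems, Option.some.injEq]
      exact ⟨fun h' => eq_of_mem_of_mem hΔ h.choose_spec h', fun e => e ▸ h.choose_spec⟩
  · push Not at h
    cases c with
    | none => simpa [classItems] using h
    | some ℓ => simpa [classItems] using h ℓ

theorem rank_lt_rank {c : Option (Fin p)} {i j : Fin m} (hi : i ∈ I.classItems c) (h : i < j) :
    I.rank c i < I.rank c j := by
  refine Finset.card_lt_card (Finset.ssubset_iff_subset_ne.2 ⟨?_, fun e => ?_⟩)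
  · exact Finset.monotone_filter_right _ fun x _ hx => lt_trans hx h
  · have : i ∈ (I.classItems c).filter (· < j) := by simp [hi, h]
    rw [← e] at this
    simp at this

theorem rank_injOn (c : Option (Fin p)) : Set.InjOn (I.rank c) (I.classItems c) := by
  intro i hi j hj e
  rcases lt_trichotomy i j with h | h | h
  · exact absurd e (rank_lt_rank hi h).ne
  · exact h
  · exact absurd e (rank_lt_rank hj h).ne'

theorem rank_lt_card {c : Option (Fin p)} {i : Fin m} (hi : i ∈ I.classItems c) :
    I.rank c i < (I.classItems c).card :=
  Finset.card_lt_card (Finset.filter_ssubset.2 ⟨i, hi, by simp⟩)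

theorem image_rank (c : Option (Fin p)) :
    (I.classItems c).image (I.rank c) = Finset.range (I.classItems c).card := by
  refine Finset.eq_of_subset_of_card_le (fun r hr => ?_) ?_
  · obtain ⟨i, hi, rfl⟩ := Finset.mem_image.1 hr
    simpa using rank_lt_card hi
  · rw [Finset.card_image_of_injOn (rank_injOn c), Finset.card_range]

theorem exists_rank_eq {c : Option (Fin p)} {r : ℕ} (hr : r < (I.classItems c).card) :
    ∃ i ∈ I.classItems c, I.rank c i = r := by
  have : r ∈ (I.classItems c).image (I.rank c) := by simpa [image_rank] using hr
  simpa using this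

variable (I) in
/-- The first `x` items of a class. -/
def firstItems (c : Option (Fin p)) (x : ℕ) : Finset (Fin m) :=
  (I.classItems c).filter fun i => I.rank c i < x

theorem mem_firstItems {c : Option (Fin p)} {x : ℕ} {i : Fin m} :
    i ∈ I.firstItems c x ↔ i ∈ I.classItems c ∧ I.rank c i < x := by
  simp [firstItems]

theorem card_firstItems (c : Option (Fin p)) (x : ℕ) :
    (I.firstItems c x).card = min x (I.classItems c).card := by
  have h : (I.firstItems c x).image (I.rank c) = Finset.range (min x (I.classItems c).card) := by
    ext r
    simp only [Finset.mem_image, mem_firstItems, Finset.mem_range, lt_min_iff]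
    constructor
    · rintro ⟨i, ⟨hi, h⟩, rfl⟩
      exact ⟨h, rank_lt_card hi⟩
    · rintro ⟨h, h'⟩
      obtain ⟨i, hi, rfl⟩ := exists_rank_eq h'
      exact ⟨i, ⟨hi, h⟩, rfl⟩
  rw [← Finset.card_range (min x (I.classItems c).card), ← h, Finset.card_image_of_injOn]
  exact (rank_injOn c).mono fun i hi => (mem_firstItems.1 hi).1

theorem card_firstItems_le (c : Option (Fin p)) (x : ℕ) : (I.firstItems c x).card ≤ x :=
  (card_firstItems c x).trans_le (min_le_left _ _)

/-- Among the subsets of a class of a given size, the set of the first items has minimum weight,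
if the weights are nondecreasing. -/
theorem sum_firstItems_le {c : Option (Fin p)} {A : Finset (Fin m)} (hA : A ⊆ I.classItems c)
    {g : Fin m → ℝ} (hg : ∀ i j, i < j → g i ≤ g j) :
    ∑ i ∈ I.firstItems c A.card, g i ≤ ∑ i ∈ A, g i := by
  set B := I.firstItems c A.card with hB
  have hcard : B.card = A.card := by
    rw [hB, card_firstItems, min_eq_left (Finset.card_le_card hA)]
  have h1 := Finset.sum_inter_add_sum_sdiff B A g
  have h2 := Finset.sum_inter_add_sum_sdiff A B g
  rw [Finset.inter_comm] at h2
  have hc : (B \ A).card = (A \ B).card := Finset.card_sdiff_comm hcard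
  suffices ∑ i ∈ B \ A, g i ≤ ∑ i ∈ A \ B, g i by linarith
  rcases (A \ B).eq_empty_or_nonempty with he | he
  · rw [he, Finset.card_empty, Finset.card_eq_zero] at hc
    rw [he, hc]
  · obtain ⟨a, ha, hmin⟩ := Finset.exists_min_image _ g he
    have l1 : ∑ i ∈ B \ A, g i ≤ (B \ A).card • g a := by
      refine Finset.sum_le_card_nsmul _ _ _ fun b hb => ?_
      rw [Finset.mem_sdiff] at ha hb
      have hb' := mem_firstItems.1 hb.1
      -- Elements of `B` have rank below `A.card`, elements of `A` outside `B` do not; hence `b`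
      -- precedes `a`, and `g a` separates the two differences.
      have ha' : A.card ≤ I.rank c a := by
        by_contra h
        exact ha.2 (mem_firstItems.2 ⟨hA ha.1, not_le.1 h⟩)
      rcases lt_trichotomy b a with h | h | h
      · exact hg _ _ h
      · rw [h]
      · have := rank_lt_rank (hA ha.1) h
        omega
    have l2 : (A \ B).card • g a ≤ ∑ i ∈ A \ B, g i :=
      Finset.card_nsmul_le_sum _ _ _ hmin
    rw [hc] at l1
    exact l1.trans l2

/-! ### Items at the top of a ranking -/

variable (I) in
/-- The items of the class `c` at the positions down to `k`. -/
def topItems (π : Fin n ↪ Fin m) (c : Option (Fin p)) (k : Fin n) : Finset (Fin m) :=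
  (Finset.univ.filter fun j => j ≤ k ∧ π j ∈ I.classItems c).map π

theorem topItems_subset (π : Fin n ↪ Fin m) (c : Option (Fin p)) (k : Fin n) :
    I.topItems π c k ⊆ I.classItems c := by
  intro i hi
  simp only [topItems, Finset.mem_map, Finset.mem_filter] at hi
  obtain ⟨j, h, rfl⟩ := hi
  exact h.2.2

theorem card_topItems (π : Fin n ↪ Fin m) (ℓ : Fin p) (k : Fin n) :
    (I.topItems π (some ℓ) k).card = I.topCount π k ℓ := by
  rw [topItems, Finset.card_map]
  rfl

/-- The item at position `j` lies in the top set of exactly one class, its own, and only for k ≥ j.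
This exchange serves both the value and the penalties. -/
theorem sum_sum_topItems (hΔ : I.Delta = 1) (π : Fin n ↪ Fin m)
    (h : Option (Fin p) → Fin n → Fin m → ℝ) :
    ∑ k, ∑ c, ∑ i ∈ I.topItems π c k, h c k i =
      ∑ j, ∑ k with j ≤ k, h (I.classOf (π j)) k (π j) := by
  simp only [topItems, Finset.sum_map, Finset.sum_filter, mem_classItems_iff hΔ]
  rw [Finset.sum_comm' (t' := Finset.univ) (s' := fun _ => Finset.univ) (by simp)]
  simp only [ite_and]
  rw [Finset.sum_comm]
  conv_rhs => rw [Finset.sum_comm]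
  refine Finset.sum_congr rfl fun k _ => ?_
  rw [Finset.sum_comm]
  refine Finset.sum_congr rfl fun j _ => ?_
  split_ifs with hjk
  · simp
  · simp

theorem extW_of_fin (i : Fin m) (k : Fin n) : I.extW i k = I.W i k := by
  simp [extW]

/-- Replacing `k` by `max j k` makes the summands below `j` vanish, so the sum telescopes over the
full range; it ends at the convention that weights beyond the last position are `0`. -/
theorem sum_extW_sub (i : Fin m) (j : Fin n) :
    ∑ k with j ≤ k, (I.extW i (k + 1) - I.W i k) = -I.W i j := by
  have h : ∀ k : Fin n, (if j ≤ k then I.extW i (k + 1) - I.W i k else 0) =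
      (fun k : ℕ => I.extW i (max j (k + 1)) - I.extW i (max j k)) k := by
    intro k
    simp only
    split_ifs with hk
    · rw [max_eq_right (by have : (j : ℕ) ≤ k := hk; omega), max_eq_right (show (j : ℕ) ≤ k from hk),
        extW_of_fin]
    · have : (k : ℕ) < j := not_le.1 hk
      rw [max_eq_left (by omega), max_eq_left (by omega), sub_self]
  rw [Finset.sum_filter, Finset.sum_congr rfl fun k _ => h k,
    Fin.sum_univ_eq_sum_range (fun k : ℕ => I.extW i (max j (k + 1)) - I.extW i (max j k)),
    Finset.sum_range_sub (fun k : ℕ => I.extW i (max j k))]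
  rw [max_eq_right j.2.le, Nat.max_zero, extW_of_fin]
  simp [extW]

/-- In this form the value depends only on the sets of top items, and the summands are the chain
edge costs without `M`. -/
theorem value_eq_neg_sum (hΔ : I.Delta = 1) (π : Fin n ↪ Fin m) :
    I.value π = -∑ k : Fin n, ∑ c, ∑ i ∈ I.topItems π c k, (I.extW i (k + 1) - I.W i k) := by
  rw [sum_sum_topItems hΔ π fun _ k i => I.extW i (k + 1) - I.W i k]
  simp only [sum_extW_sub, value, Finset.sum_neg_distrib, neg_neg]

/-- Monge before the last position; at the last position the difference is `-W`, and monotonicity in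
the item takes over. -/
theorem extW_sub_mono (hM : I.MonotoneMonge) (k : Fin n) (i j : Fin m) (h : i < j) :
    I.extW i (k + 1) - I.W i k ≤ I.extW j (k + 1) - I.W j k := by
  unfold extW
  split_ifs with hk
  · have := hM.2.2 i j k ⟨k + 1, hk⟩ h (by simp [Fin.lt_def])
    linarith
  · have := hM.1 i j k h
    linarith

/-! ### Class assignments and sorted rankings -/

/-- The number of positions down to `k` to which `cs` assigns the class `c`. -/
def count (cs : Fin n → Option (Fin p)) (c : Option (Fin p)) (k : Fin n) : ℕ :=
  (Finset.univ.filter fun j => j ≤ k ∧ cs j = c).card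

variable (I) in
/-- The ranking `π` places items of the class `cs k` at position `k`, and the items of each class
in their order. -/
def IsSorted (cs : Fin n → Option (Fin p)) (π : Fin n ↪ Fin m) : Prop :=
  ∀ k, π k ∈ I.classItems (cs k) ∧ I.rank (cs k) (π k) + 1 = count cs (cs k) k

theorem count_lt_count {cs : Fin n → Option (Fin p)} {j k : Fin n} (h : j < k) :
    count cs (cs k) j < count cs (cs k) k := by
  refine Finset.card_lt_card (Finset.ssubset_iff_subset_ne.2 ⟨?_, fun e => ?_⟩)
  · exact Finset.monotone_filter_right _ fun x _ hx => ⟨hx.1.trans h.le, hx.2⟩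
  · have : k ∈ Finset.univ.filter fun x => x ≤ k ∧ cs x = cs k := by simp
    rw [← e] at this
    simp only [Finset.mem_filter, Finset.mem_univ, true_and, and_true] at this
    exact absurd h (not_lt.2 this)

theorem one_le_count (cs : Fin n → Option (Fin p)) (k : Fin n) : 1 ≤ count cs (cs k) k :=
  Finset.card_pos.2 ⟨k, by simp⟩

/-- Position `k` gets the item whose rank is the number of earlier positions of the same class.
Within a class these numbers strictly increase, and different classes are disjoint, so the map is
injective. -/
theorem exists_isSorted (hΔ : I.Delta = 1) {cs : Fin n → Option (Fin p)}
    (h : ∀ c k, count cs c k ≤ (I.classItems c).card) : ∃ π, I.IsSorted cs π := by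
  have h1 : ∀ k, ∃ i ∈ I.classItems (cs k), I.rank (cs k) i + 1 = count cs (cs k) k := by
    intro k
    have := one_le_count cs k
    have := h (cs k) k
    obtain ⟨i, hi, e⟩ := exists_rank_eq (I := I) (c := cs k) (r := count cs (cs k) k - 1) (by omega)
    exact ⟨i, hi, by omega⟩
  choose π h2 h3 using h1
  refine ⟨⟨π, fun j k e => ?_⟩, fun k => ⟨h2 k, h3 k⟩⟩
  have hc : cs j = cs k := by
    rw [← (mem_classItems_iff hΔ).1 (h2 j), ← (mem_classItems_iff hΔ).1 (h2 k), e]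
  have e1 := h3 j
  have e2 := h3 k
  rw [e, hc] at e1
  rcases lt_trichotomy j k with hl | hl | hl
  · have := count_lt_count (cs := cs) hl
    omega
  · exact hl
  · have := count_lt_count (cs := cs) hl
    rw [hc] at this
    omega

theorem IsSorted.mem_classItems_iff (hΔ : I.Delta = 1) {cs : Fin n → Option (Fin p)}
    {π : Fin n ↪ Fin m} (h : I.IsSorted cs π) {j : Fin n} {c : Option (Fin p)} :
    π j ∈ I.classItems c ↔ cs j = c := by
  rw [Instance.mem_classItems_iff hΔ, (Instance.mem_classItems_iff hΔ).1 (h j).1]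

/-- Ranks at positions down to `k` are below the count; a comparison of cardinalities makes the
inclusion an equality. -/
theorem IsSorted.topItems_eq (hΔ : I.Delta = 1) {cs : Fin n → Option (Fin p)}
    {π : Fin n ↪ Fin m} (h : I.IsSorted cs π) (c : Option (Fin p)) (k : Fin n) :
    I.topItems π c k = I.firstItems c (count cs c k) := by
  refine Finset.eq_of_subset_of_card_le (fun i hi => ?_) ?_
  · simp only [topItems, Finset.mem_map, Finset.mem_filter, h.mem_classItems_iff hΔ] at hi
    obtain ⟨j, ⟨-, hj, rfl⟩, rfl⟩ := hi
    refine mem_firstItems.2 ⟨(h j).1, ?_⟩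
    have h2 := (h j).2
    rcases hj.lt_or_eq with hl | rfl
    · have : count cs (cs j) j ≤ count cs (cs j) k := Finset.card_le_card
        (Finset.monotone_filter_right _ fun x _ hx => ⟨hx.1.trans hj, hx.2⟩)
      omega
    · omega
  · refine (card_firstItems_le _ _).trans_eq ?_
    simp only [topItems, Finset.card_map, h.mem_classItems_iff hΔ, count]

theorem card_topItems_eq_count (hΔ : I.Delta = 1) (π : Fin n ↪ Fin m) (c : Option (Fin p))
    (k : Fin n) : (I.topItems π c k).card = count (fun j => I.classOf (π j)) c k := by
  simp only [topItems, Finset.card_map, mem_classItems_iff hΔ, count]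

/-- Sorting the items of each class. -/
theorem exists_isSorted_classOf (hΔ : I.Delta = 1) (π : Fin n ↪ Fin m) :
    ∃ σ, I.IsSorted (fun j => I.classOf (π j)) σ :=
  exists_isSorted hΔ fun c k => by
    rw [← card_topItems_eq_count hΔ]
    exact Finset.card_le_card (topItems_subset _ _ _)

theorem IsSorted.topCount_eq (hΔ : I.Delta = 1) {cs : Fin n → Option (Fin p)}
    {π : Fin n ↪ Fin m} (h : I.IsSorted cs π) (ℓ : Fin p) (k : Fin n) :
    I.topCount π k ℓ = count cs (some ℓ) k := by
  simp only [← card_topItems, topItems, Finset.card_map, h.mem_classItems_iff hΔ, count]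

theorem topCount_eq_count (hΔ : I.Delta = 1) (π : Fin n ↪ Fin m) (ℓ : Fin p) (k : Fin n) :
    I.topCount π k ℓ = count (fun j => I.classOf (π j)) (some ℓ) k := by
  rw [← card_topItems, card_topItems_eq_count hΔ]

theorem IsSorted.feasible_iff (hΔ : I.Delta = 1) {π σ : Fin n ↪ Fin m}
    (h : I.IsSorted (fun j => I.classOf (π j)) σ) : I.Feasible σ ↔ I.Feasible π := by
  simp only [Feasible, h.topCount_eq hΔ, topCount_eq_count hΔ π]

/-- Sorting keeps the size of every top set and makes it an initial segment, which is cheapest for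
each `k` and `c` separately. -/
theorem IsSorted.value_le (hΔ : I.Delta = 1) (hM : I.MonotoneMonge) {π σ : Fin n ↪ Fin m}
    (h : I.IsSorted (fun j => I.classOf (π j)) σ) : I.value π ≤ I.value σ := by
  rw [value_eq_neg_sum hΔ, value_eq_neg_sum hΔ, neg_le_neg_iff]
  refine Finset.sum_le_sum fun k _ => Finset.sum_le_sum fun c _ => ?_
  rw [h.topItems_eq hΔ, ← card_topItems_eq_count hΔ]
  exact sum_firstItems_le (topItems_subset _ _ _) (extW_sub_mono hM k)

theorem abs_value_le (π : Fin n ↪ Fin m) : |I.value π| ≤ ∑ i, ∑ j, |I.W i j| := by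
  rw [Finset.sum_comm]
  refine (Finset.abs_sum_le_sum_abs _ _).trans (Finset.sum_le_sum fun j _ => ?_)
  exact Finset.single_le_sum (f := fun i => |I.W i j|) (fun i _ => abs_nonneg _)
    (Finset.mem_univ (π j))

end Instance

/-! ### The network of an instance: rankings as flows. -/

namespace Instance

variable {m n p : ℕ} {I : Instance m n p}

theorem one_le_items (hΔ : I.Delta = 1) : 1 ≤ m := by
  rcases Nat.eq_zero_or_pos m with rfl | h
  · simp [Delta] at hΔ
  · exact h

theorem one_le_properties (hΔ : I.Delta = 1) : 1 ≤ p := by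
  rcases Nat.eq_zero_or_pos p with rfl | h
  · have : I.Delta ≤ 0 := Finset.sup_le fun i _ => by
      simpa using Finset.card_le_univ (I.itemType i)
    omega
  · exact h

/-! ### Size and acyclicity of the network -/

theorem card_vertex_le (hn : 1 ≤ n) (hp : 1 ≤ p) : Fintype.card (Vertex n p) ≤ 7 * (n * p) := by
  let F : Vertex n p → Unit ⊕ Unit ⊕ Fin n ⊕ (Option (Fin p) × Fin (n + 1))
    | .s => .inl ()
    | .t => .inr (.inl ())
    | .γ k => .inr (.inr (.inl k))
    | .ρ c k => .inr (.inr (.inr (c, k)))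
  have hF : Function.Injective F := by
    intro u v h
    cases u <;> cases v <;> simp_all [F]
  refine (Fintype.card_le_of_injective F hF).trans ?_
  simp only [Fintype.card_sum, Fintype.card_unit, Fintype.card_fin, Fintype.card_prod,
    Fintype.card_option]
  -- The count is 2 + n + (p + 1)(n + 1), at most (2 + 1 + 4)np.
  nlinarith

/-- An item determines its class, so `F` may forget the class of entry and chain edges. The four
kinds contribute at most n + (p + 1)n + m + nm, which is at most (1 + 2 + 1 + 1)nm. -/
theorem card_edges_le (hΔ : I.Delta = 1) (hn : 1 ≤ n) (hpm : p ≤ m) (M : ℝ) :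
    (I.network M).edges.card ≤ 5 * (n * m) := by
  classical
  let F : Edge m n p → Fin n ⊕ (Option (Fin p) × Fin n) ⊕ Fin m ⊕ (Fin n × Fin m)
    | .toSink k => .inl k
    | .exit c k => .inr (.inl (c, k))
    | .entry _ i => .inr (.inr (.inl i))
    | .chain _ k i => .inr (.inr (.inr (k, i)))
  have hF : Set.InjOn F (I.network M).edges := by
    intro u hu v hv h
    simp only [network, Finset.coe_filter, Finset.mem_univ, true_and, Set.mem_ofPred_eq] at hu hv
    cases u <;> cases v <;> simp_all [F, IsEdge, mem_classItems_iff hΔ]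
  have h := Finset.card_le_card_of_injOn (t := Finset.univ) F (by simp) hF
  simp only [Finset.card_univ, Fintype.card_sum, Fintype.card_fin, Fintype.card_prod,
    Fintype.card_option] at h
  have := one_le_items hΔ
  nlinarith

/-- The layers of the network. -/
def depth : Vertex n p → ℕ
  | .s => 0
  | .ρ _ j => 1 + (n - j)
  | .γ _ => n + 2
  | .t => n + 3

theorem depth_lt (M : ℝ) (e : Edge m n p) :
    depth ((I.network M).tail e) + 1 ≤ depth ((I.network M).head e) := by
  cases e with
  | toSink k => simp [network, depth]
  | exit c k => simp only [network, depth, Fin.val_castSucc]; omega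
  | entry c i => simp [network, depth]
  | chain c k i => simp only [network, depth, Fin.val_castSucc, Fin.val_succ]; omega

theorem acyclic_network (M : ℝ) : (I.network M).Acyclic := by
  intro v h
  have : ∀ u w, Relation.TransGen (fun u w => ∃ e ∈ (I.network M).edges,
      (I.network M).tail e = u ∧ (I.network M).head e = w) u w → depth u < depth w := by
    intro u w h
    induction h with
    | single h =>
      obtain ⟨e, -, rfl, rfl⟩ := h
      exact depth_lt M e
    | tail _ h ih =>
      obtain ⟨e, -, rfl, rfl⟩ := h
      have := depth_lt (I := I) M e
      omega
  exact lt_irrefl _ (this v v h)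

/-- The zero flow has only forward residual arcs, and each of them increases the depth by at least
one; a multiple of the depth that dominates every cost absorbs the negative ones. -/
theorem exists_isPotential_zero (M : ℝ) : ∃ φ, (I.network M).IsPotential (fun _ => 0) φ := by
  set B := ∑ e ∈ (I.network M).edges, |(I.network M).cost e| with hB
  have hB0 : 0 ≤ B := Finset.sum_nonneg fun e _ => abs_nonneg _
  refine ⟨fun v => -(B * depth v), ?_⟩
  rintro ⟨e, b⟩ ⟨he, h⟩
  cases b with
  | false => simp at h
  | true =>
    have h1 : |(I.network M).cost e| ≤ B :=
      Finset.single_le_sum (f := fun e => |(I.network M).cost e|) (fun i _ => abs_nonneg _) he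
    have h2 : (depth ((I.network M).tail e) : ℝ) + 1 ≤ depth ((I.network M).head e) := by
      exact_mod_cast depth_lt M e
    have h3 := neg_abs_le ((I.network M).cost e)
    simp only [Network.arcCost, Network.arcTail, Network.arcHead, if_true]
    nlinarith

theorem source_ne_sink (M : ℝ) : (I.network M).source ≠ (I.network M).sink := by
  simp [network]

/-! ### Sums over the edges -/

/-- Edges as a sum type. -/
def edgeEquiv : Edge m n p ≃ Fin n ⊕ (Option (Fin p) × Fin n) ⊕ (Option (Fin p) × Fin m) ⊕
    (Option (Fin p) × Fin n × Fin m) where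
  toFun
    | .toSink k => .inl k
    | .exit c k => .inr (.inl (c, k))
    | .entry c i => .inr (.inr (.inl (c, i)))
    | .chain c k i => .inr (.inr (.inr (c, k, i)))
  invFun
    | .inl k => .toSink k
    | .inr (.inl (c, k)) => .exit c k
    | .inr (.inr (.inl (c, i))) => .entry c i
    | .inr (.inr (.inr (c, k, i))) => .chain c k i
  left_inv e := by cases e <;> rfl
  right_inv e := by rcases e with _ | _ | _ | _ <;> rfl

theorem sum_edges (M : ℝ) (F : Edge m n p → ℝ) :
    ∑ e ∈ (I.network M).edges, F e = ∑ k, F (.toSink k) + ∑ c, ∑ k, F (.exit c k) +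
      ∑ c, ∑ i ∈ I.classItems c, F (.entry c i) +
      ∑ c, ∑ k, ∑ i ∈ I.firstItems c (I.upper k c), F (.chain c k i) := by
  classical
  simp only [network, Finset.sum_filter]
  rw [← edgeEquiv.symm.sum_comp]
  simp only [Fintype.sum_sum_type, Fintype.sum_prod_type, ← add_assoc]
  congr 1
  · congr 1
    · congr 1
      · exact Finset.sum_congr rfl fun k _ => if_pos trivial
      · exact Finset.sum_congr rfl fun c _ => Finset.sum_congr rfl fun k _ => if_pos trivial
    · refine Finset.sum_congr rfl fun c _ => ?_
      rw [← Finset.sum_filter]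
      refine Finset.sum_congr ?_ fun _ _ => rfl
      ext i
      rw [Finset.mem_filter]
      exact ⟨fun h => h.2, fun h => ⟨Finset.mem_univ _, h⟩⟩
  · refine Finset.sum_congr rfl fun c _ => Finset.sum_congr rfl fun k _ => ?_
    rw [← Finset.sum_filter]
    refine Finset.sum_congr ?_ fun _ _ => rfl
    ext i
    rw [Finset.mem_filter, mem_firstItems]
    exact ⟨fun h => h.2, fun h => ⟨Finset.mem_univ _, h⟩⟩

theorem chainFlow_eq (f : Edge m n p → ℝ) (c : Option (Fin p)) (k : Fin n) :
    I.chainFlow f c k = ∑ i ∈ I.firstItems c (I.upper k c), f (.chain c k i) := by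
  classical
  unfold chainFlow
  refine Finset.sum_congr ?_ fun _ _ => rfl
  ext i
  rw [Finset.mem_filter, mem_firstItems]
  simp [IsEdge]

/-- The cost of a chain edge. -/
noncomputable def chainCost (I : Instance m n p) (M : ℝ) (c : Option (Fin p)) (k : Fin n)
    (i : Fin m) : ℝ :=
  I.extW i (k + 1) - I.W i k - if I.rank c i < I.lower k c then M else 0

theorem flowCost_eq (M : ℝ) (f : Edge m n p → ℝ) : (I.network M).flowCost f =
    ∑ c, ∑ k, ∑ i ∈ I.firstItems c (I.upper k c), I.chainCost M c k i * f (.chain c k i) := by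
  rw [Network.flowCost, sum_edges]
  simp [network, chainCost]

theorem rank_mono (c : Option (Fin p)) {i j : Fin m} (h : i ≤ j) : I.rank c i ≤ I.rank c j :=
  Finset.card_le_card (Finset.monotone_filter_right _ fun _ _ hx => lt_of_lt_of_le hx h)

theorem chainCost_mono (hM : I.MonotoneMonge) {M : ℝ} (hM0 : 0 ≤ M) (c : Option (Fin p))
    (k : Fin n) (i j : Fin m) (h : i < j) : I.chainCost M c k i ≤ I.chainCost M c k j := by
  have h1 := extW_sub_mono hM k i j h
  have h2 := rank_mono (I := I) c h.le
  unfold chainCost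
  split_ifs with a b b
  · linarith
  · linarith
  · omega
  · linarith

/-! ### Flows of value `n` -/

section Flow

variable {M : ℝ} {f : Edge m n p → ℝ}

theorem sum_exit_eq {r : ℝ} (hf : (I.network M).IsFlow f r) (k : Fin n) :
    ∑ c, f (.exit c k) = f (.toSink k) := by
  have h := (I.network M).sum_mul_excess_of_isFlow (source_ne_sink M) hf
    fun v => if v = .γ k then 1 else 0
  rw [Network.sum_mul_excess, sum_edges] at h
  simp [network] at h
  rw [Fintype.sum_option]
  linarith

theorem sum_toSink_eq {r : ℝ} (hf : (I.network M).IsFlow f r) : ∑ k, f (.toSink k) = r := by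
  have h := (I.network M).sum_mul_excess_of_isFlow (source_ne_sink M) hf
    fun v => if v = .t then 0 else 1
  rw [Network.sum_mul_excess, sum_edges] at h
  simpa [network] using h

/-- The chain vertices of the class `c` up to `k`. -/
def chainInd (c : Option (Fin p)) (k : Fin n) : Vertex n p → ℝ
  | .ρ c' j => if c' = c ∧ (j : ℕ) ≤ k then 1 else 0
  | _ => 0

/-- Conservation on the vertices ρ_{c,0}, …, ρ_{c,k}: flow enters this set only through position `k`
of the chain and leaves only through the exits at positions down to `k`. -/
theorem chainFlow_eq_sum_exit {r : ℝ} (hf : (I.network M).IsFlow f r) (c : Option (Fin p))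
    (k : Fin n) : I.chainFlow f c k = ∑ k' with k' ≤ k, f (.exit c k') := by
  have h := (I.network M).sum_mul_excess_of_isFlow (source_ne_sink M) hf (chainInd c k)
  rw [Network.sum_mul_excess, sum_edges] at h
  have h1 : ∀ (c' : Option (Fin p)) (k' : Fin n),
      ((if c' = c ∧ (k' : ℕ) + 1 ≤ k then (1 : ℝ) else 0) -
        if c' = c ∧ (k' : ℕ) ≤ k then 1 else 0) = if c' = c then if k' = k then -1 else 0 else 0 := by
    intro c' k'
    by_cases hc : c' = c
    · simp only [hc, true_and, if_true, Fin.ext_iff]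
      split_ifs <;> first | omega | norm_num
    · simp [hc]
  have h2 : ∀ (c' : Option (Fin p)) (k' : Fin n),
      (if c' = c ∧ (k' : ℕ) ≤ k then (1 : ℝ) else 0) =
        if c' = c then if k' ≤ k then 1 else 0 else 0 := by
    intro c' k'
    simp only [ite_and]
    rfl
  simp only [network, chainInd, Fin.val_succ, Fin.val_castSucc, Fin.val_last, h1] at h
  simp only [h2, sub_self, zero_mul, Finset.sum_const_zero, zero_add, sub_zero,
    not_le.2 k.2, and_false, if_false, add_zero, ite_mul, zero_mul, one_mul] at h
  simp only [Finset.sum_ite_irrel, Finset.sum_const_zero, Finset.sum_ite_eq', Finset.mem_univ,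
    if_true, neg_mul, one_mul, Finset.sum_neg_distrib] at h
  rw [chainFlow_eq, Finset.sum_filter]
  linarith

theorem zero_or_one (hf : ∃ r, (I.network M).IsFlow f r) (hi : (I.network M).Integral f)
    {e : Edge m n p} (he : I.IsEdge e) : f e = 0 ∨ f e = 1 := by
  classical
  obtain ⟨r, hf⟩ := hf
  have he' : e ∈ (I.network M).edges := by simpa [network] using he
  obtain ⟨z, hz⟩ := hi e he'
  have b := hf.1 e he'
  simp only [network, Nat.cast_one, hz] at b
  have b1 : 0 ≤ z := by exact_mod_cast b.1
  have b2 : z ≤ 1 := by exact_mod_cast b.2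
  rw [hz]
  rcases (by omega : z = 0 ∨ z = 1) with h | h <;> simp [h]

/-- Value `n` saturates all `n` unit edges into the sink, so each γ_k receives exactly one unit, and
by integrality it comes from a single chain. -/
theorem exists_classAssignment (hf : (I.network M).IsFlow f n) (hi : (I.network M).Integral f) :
    ∃ cs : Fin n → Option (Fin p), ∀ c k, f (.exit c k) = if cs k = c then 1 else 0 := by
  classical
  have h01 : ∀ c k, f (.exit c k) = 0 ∨ f (.exit c k) = 1 := fun c k =>
    zero_or_one ⟨_, hf⟩ hi trivial
  have ht : ∀ k, f (.toSink k) = 1 := by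
    have hle : ∀ k, f (.toSink k) ≤ 1 := fun k => by
      simpa [network] using (hf.1 (.toSink k) (by simp [network, IsEdge])).2
    have hs := sum_toSink_eq hf
    have : ∑ k : Fin n, (1 - f (.toSink k)) = 0 := by simp [Finset.sum_sub_distrib, hs]
    rw [Finset.sum_eq_zero_iff_of_nonneg fun k _ => by linarith [hle k]] at this
    intro k
    linarith [this k (Finset.mem_univ k)]
  have hs : ∀ k, ∑ c, f (.exit c k) = 1 := fun k => by rw [sum_exit_eq hf, ht]
  have hex : ∀ k, ∃ c, f (.exit c k) = 1 := by
    intro k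
    by_contra hno
    push Not at hno
    have := hs k
    rw [Finset.sum_eq_zero fun c _ => (h01 c k).resolve_right (hno c)] at this
    norm_num at this
  choose cs hcs using hex
  refine ⟨cs, fun c k => ?_⟩
  split_ifs with h
  · rw [← h, hcs]
  · refine (h01 c k).resolve_right fun h1 => ?_
    have h2 : ∑ c' ∈ {cs k, c}, f (.exit c' k) ≤ ∑ c', f (.exit c' k) :=
      Finset.sum_le_sum_of_subset_of_nonneg (Finset.subset_univ _) fun c' _ _ => by
        rcases h01 c' k with h | h <;> simp [h]
    rw [Finset.sum_pair h, hs, hcs, h1] at h2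
    norm_num at h2

theorem sum_exit_eq_count {cs : Fin n → Option (Fin p)}
    (h : ∀ c k, f (.exit c k) = if cs k = c then 1 else 0) (c : Option (Fin p)) (k : Fin n) :
    ∑ k' with k' ≤ k, f (.exit c k') = count cs c k := by
  simp only [h, count, ← Finset.filter_filter, Finset.card_filter]
  rw [Finset.sum_boole]
  simp

open Classical in
/-- The items that a flow uses in a chain. -/
noncomputable def usedItems (I : Instance m n p) (f : Edge m n p → ℝ) (c : Option (Fin p))
    (k : Fin n) : Finset (Fin m) :=
  (I.firstItems c (I.upper k c)).filter fun i => f (.chain c k i) = 1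

theorem sum_mul_chain_eq (hf : ∃ r, (I.network M).IsFlow f r) (hi : (I.network M).Integral f)
    (c : Option (Fin p)) (k : Fin n) (g : Fin m → ℝ) :
    ∑ i ∈ I.firstItems c (I.upper k c), g i * f (.chain c k i) = ∑ i ∈ I.usedItems f c k, g i := by
  classical
  rw [usedItems, Finset.sum_filter]
  refine Finset.sum_congr rfl fun i hI => ?_
  rcases zero_or_one hf hi (e := .chain c k i) (mem_firstItems.1 hI) with h | h <;> simp [h]

/-- The flow on the chain edges is 0 or 1, so their number is the chain flow, which equals the
number of exits above. -/
theorem card_usedItems (hf : (I.network M).IsFlow f n) (hi : (I.network M).Integral f)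
    {cs : Fin n → Option (Fin p)} (h : ∀ c k, f (.exit c k) = if cs k = c then 1 else 0)
    (c : Option (Fin p)) (k : Fin n) : (I.usedItems f c k).card = count cs c k := by
  have h1 := sum_mul_chain_eq ⟨_, hf⟩ hi c k fun _ => 1
  simp only [one_mul, ← chainFlow_eq] at h1
  rw [chainFlow_eq_sum_exit hf, sum_exit_eq_count h] at h1
  simp only [Finset.sum_const, nsmul_eq_mul, mul_one] at h1
  exact_mod_cast h1.symm

theorem usedItems_subset (f : Edge m n p → ℝ) (c : Option (Fin p)) (k : Fin n) :
    I.usedItems f c k ⊆ I.classItems c := fun i hi => by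
  classical
  exact (mem_firstItems.1 (Finset.mem_filter.1 hi).1).1

theorem card_usedItems_le (f : Edge m n p → ℝ) (c : Option (Fin p)) (k : Fin n) :
    (I.usedItems f c k).card ≤ I.upper k c := by
  classical
  exact (Finset.card_filter_le _ _).trans (card_firstItems_le _ _)

/-- The least cost of a flow that serves the positions according to `cs`. -/
noncomputable def classCost (I : Instance m n p) (M : ℝ) (cs : Fin n → Option (Fin p)) : ℝ :=
  ∑ c, ∑ k, ∑ i ∈ I.firstItems c (count cs c k), I.chainCost M c k i

/-- At each chain position the used edges are replaced by equally many first ones. The discount `M`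
goes to the lowest ranks, so it preserves the monotonicity of the edge costs. -/
theorem classCost_le_flowCost (hM : I.MonotoneMonge) (hM0 : 0 ≤ M)
    (hf : (I.network M).IsFlow f n) (hi : (I.network M).Integral f)
    {cs : Fin n → Option (Fin p)} (h : ∀ c k, f (.exit c k) = if cs k = c then 1 else 0) :
    I.classCost M cs ≤ (I.network M).flowCost f := by
  rw [flowCost_eq, classCost]
  refine Finset.sum_le_sum fun c _ => Finset.sum_le_sum fun k _ => ?_
  rw [sum_mul_chain_eq ⟨_, hf⟩ hi, ← card_usedItems hf hi h]
  exact sum_firstItems_le (usedItems_subset _ _ _) (chainCost_mono hM hM0 c k)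

end Flow

theorem IsSorted.count_le_card (hΔ : I.Delta = 1) {cs : Fin n → Option (Fin p)}
    {π : Fin n ↪ Fin m} (h : I.IsSorted cs π) (c : Option (Fin p)) (k : Fin n) :
    count cs c k ≤ (I.classItems c).card := by
  have h1 := Finset.card_le_card (topItems_subset (I := I) π c k)
  simpa only [topItems, Finset.card_map, h.mem_classItems_iff hΔ, count] using h1

/-- Of the first `count` edges at a chain position, exactly min(count, L) carry the discount; the
rest of the cost is the telescoped value. -/
theorem IsSorted.classCost_eq (hΔ : I.Delta = 1) {cs : Fin n → Option (Fin p)}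
    {π : Fin n ↪ Fin m} (h : I.IsSorted cs π) (M : ℝ) : I.classCost M cs =
      -I.value π - M * ((∑ k, ∑ ℓ, min (count cs (some ℓ) k) (I.L k ℓ) : ℕ) : ℝ) := by
  have h1 : ∀ c k, ∑ i ∈ I.firstItems c (count cs c k),
      (if I.rank c i < I.lower k c then M else 0) = M * (min (count cs c k) (I.lower k c) : ℕ) := by
    intro c k
    have : (I.firstItems c (count cs c k)).filter (fun i => I.rank c i < I.lower k c) =
        I.firstItems c (min (count cs c k) (I.lower k c)) := by
      ext i
      simp only [Finset.mem_filter, mem_firstItems, lt_min_iff]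
      tauto
    rw [← Finset.sum_filter, this, Finset.sum_const, card_firstItems, nsmul_eq_mul, mul_comm,
      min_eq_left]
    exact (min_le_left _ _).trans (h.count_le_card hΔ c k)
  simp only [classCost, chainCost, Finset.sum_sub_distrib, h1]
  rw [value_eq_neg_sum hΔ, neg_neg, Finset.sum_comm (γ := Fin n) (s := Finset.univ (α := Fin n))]
  congr 1
  · simp only [h.topItems_eq hΔ]
    simp only [Finset.sum_sub_distrib]
  · rw [Finset.sum_comm]
    push_cast
    rw [Finset.mul_sum]
    refine Finset.sum_congr rfl fun k _ => ?_
    rw [Finset.mul_sum, Fintype.sum_option]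
    simp [lower]

/-! ### The flow of a class assignment -/

/-- The number of positions before `j` to which `cs` assigns the class `c`. -/
def countBefore (cs : Fin n → Option (Fin p)) (c : Option (Fin p)) (j : ℕ) : ℕ :=
  (Finset.univ.filter fun k : Fin n => (k : ℕ) < j ∧ cs k = c).card

theorem countBefore_succ (cs : Fin n → Option (Fin p)) (c : Option (Fin p)) (k : Fin n) :
    countBefore cs c (k + 1) = count cs c k := by
  simp only [countBefore, count, Nat.lt_succ_iff, Fin.le_def]

theorem countBefore_zero (cs : Fin n → Option (Fin p)) (c : Option (Fin p)) :
    countBefore cs c 0 = 0 := by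
  simp [countBefore]

theorem countBefore_succ_eq (cs : Fin n → Option (Fin p)) (c : Option (Fin p)) (k : Fin n) :
    countBefore cs c (k + 1) = countBefore cs c k + if cs k = c then 1 else 0 := by
  have : (Finset.univ.filter fun x : Fin n => (x : ℕ) < k + 1 ∧ cs x = c) =
      (Finset.univ.filter fun x : Fin n => (x : ℕ) < k ∧ cs x = c) ∪
        if cs k = c then {k} else ∅ := by
    ext x
    simp only [Finset.mem_union, Finset.mem_filter, Finset.mem_univ, true_and]
    split_ifs with h
    · simp only [Finset.mem_singleton, Fin.ext_iff]
      constructor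
      · rintro ⟨h1, h2⟩
        rcases Nat.lt_succ_iff_lt_or_eq.1 h1 with h3 | h3
        · exact Or.inl ⟨h3, h2⟩
        · exact Or.inr h3
      · rintro (h1 | h1)
        · exact ⟨by omega, h1.2⟩
        · exact ⟨by omega, by rw [Fin.ext h1, h]⟩
    · simp only [Finset.notMem_empty, or_false, and_congr_left_iff]
      intro hx
      have : (x : ℕ) ≠ k := fun e => h (by rw [← Fin.ext e, hx])
      omega
  rw [countBefore, this, Finset.card_union_of_disjoint]
  · split_ifs <;> rfl
  · split_ifs
    · simp
    · simp

/-- The flow that serves the positions according to `cs` and uses the first edges of the chains. -/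
noncomputable def classFlow (I : Instance m n p) (cs : Fin n → Option (Fin p)) :
    Edge m n p → ℝ
  | .toSink _ => 1
  | .exit c k => if cs k = c then 1 else 0
  | .entry c i => if I.rank c i < countBefore cs c n then 1 else 0
  | .chain c k i => if I.rank c i < count cs c k then 1 else 0

theorem sum_chain_classFlow {cs : Fin n → Option (Fin p)}
    (hu : ∀ c k, count cs c k ≤ I.upper k c) (c : Option (Fin p)) (k : Fin n) (g : Fin m → ℝ) :
    ∑ i ∈ I.firstItems c (I.upper k c), g i * I.classFlow cs (.chain c k i) =
      ∑ i ∈ I.firstItems c (count cs c k), g i := by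
  simp only [classFlow, mul_ite, mul_one, mul_zero, ← Finset.sum_filter]
  refine Finset.sum_congr ?_ fun _ _ => rfl
  ext i
  have := hu c k
  simp only [Finset.mem_filter, mem_firstItems]
  constructor
  · exact fun h => ⟨h.1.1, h.2⟩
  · exact fun h => ⟨⟨h.1, by omega⟩, h.2⟩

theorem flowCost_classFlow {cs : Fin n → Option (Fin p)}
    (hu : ∀ c k, count cs c k ≤ I.upper k c) (M : ℝ) :
    (I.network M).flowCost (I.classFlow cs) = I.classCost M cs := by
  rw [flowCost_eq, classCost]
  simp only [sum_chain_classFlow hu]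

theorem countBefore_card (hc : ∀ c k, count (n := n) cs c k ≤ (I.classItems c).card)
    (c : Option (Fin p)) : countBefore cs c n ≤ (I.classItems c).card := by
  rcases n with _ | n
  · simp [countBefore]
  · have := hc c (Fin.last n)
    rwa [← countBefore_succ, Fin.val_last] at this

/-- The bounds `hu` and `hc` say that enough chain and entry edges exist for the required numbers of
units. -/
theorem isFlow_classFlow {cs : Fin n → Option (Fin p)}
    (hu : ∀ c k, count cs c k ≤ I.upper k c)
    (hc : ∀ c k, count cs c k ≤ (I.classItems c).card) (M : ℝ) :
    (I.network M).IsFlow (I.classFlow cs) n := by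
  classical
  have hchain : ∀ c k, ∑ i ∈ I.firstItems c (I.upper k c), I.classFlow cs (.chain c k i) =
      countBefore cs c (k + 1) := by
    intro c k
    have := sum_chain_classFlow hu c k fun _ => 1
    simp only [one_mul] at this
    rw [this, Finset.sum_const, card_firstItems, min_eq_left (hc c k), countBefore_succ]
    simp
  have hentry : ∀ c, ∑ i ∈ I.classItems c, I.classFlow cs (.entry c i) = countBefore cs c n := by
    intro c
    have : ∑ i ∈ I.classItems c, I.classFlow cs (.entry c i) =
        (I.firstItems c (countBefore cs c n)).card := by
      simp [classFlow, firstItems]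
    rw [this, card_firstItems, min_eq_left (countBefore_card hc c)]
  refine ⟨fun e he => ?_, fun v hs ht => ?_, ?_⟩
  · cases e <;> simp only [classFlow, network] <;> (try split_ifs) <;> norm_num
  · rw [Network.excess_eq_sum, sum_edges]
    cases v with
    | s => exact absurd rfl hs
    | t => exact absurd rfl ht
    | γ k =>
      simp only [network, reduceCtorEq, if_false, sub_zero, zero_sub, Vertex.γ.injEq, sub_self,
        zero_mul, Finset.sum_const_zero, add_zero, classFlow, mul_one]
      rw [Finset.sum_comm]
      simp
    | ρ c j =>
      simp only [network, reduceCtorEq, if_false, sub_self, zero_mul, Finset.sum_const_zero,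
        zero_add, sub_zero, zero_sub, Vertex.ρ.injEq, ite_and, sub_mul, neg_mul]
      simp only [← Finset.mul_sum, Finset.sum_neg_distrib, Finset.sum_sub_distrib, hchain, hentry]
      simp only [ite_mul, one_mul, zero_mul, Finset.sum_ite_irrel, Finset.sum_const_zero,
        Finset.sum_ite_eq', Finset.mem_univ, if_true, classFlow]
      -- Below the top of the chain, `countBefore` at k + 1 flows in, one unit may exit at `k`, and
      -- `countBefore` at `k` flows on. At ρ_{c,n} the inflow comes from the entry edges.
      refine Fin.lastCases ?_ (fun k => ?_) j
      · rcases n with _ | n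
        · simp [countBefore]
        · have a1 : ∀ k : Fin (n + 1), k.castSucc ≠ Fin.last (n + 1) :=
            fun k => (Fin.castSucc_lt_last k).ne
          have a2 : ∀ k : Fin (n + 1), k.succ = Fin.last (n + 1) ↔ k = Fin.last n := by
            intro k
            rw [← Fin.succ_last, Fin.succ_inj]
          simp [a1, a2]
      · have a1 : Fin.last n ≠ k.castSucc := (Fin.castSucc_lt_last k).ne'
        have a2 : (∑ k' : Fin n, if k'.succ = k.castSucc then (countBefore cs c (k' + 1) : ℝ)
            else 0) = countBefore cs c k := by
          rcases k with ⟨k, hk⟩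
          rcases k with _ | k
          · simp [Fin.ext_iff, countBefore_zero]
          · rw [Finset.sum_eq_single (⟨k, by omega⟩ : Fin n)]
            · simp
            · intro b _ hb
              rw [if_neg]
              intro h
              apply hb
              simp only [Fin.ext_iff, Fin.val_succ, Fin.val_castSucc] at h ⊢
              omega
            · simp
        simp only [a1, if_false, a2, Fin.castSucc_inj, Finset.sum_ite_eq', Finset.mem_univ,
          if_true]
        rw [countBefore_succ_eq cs c k]
        push_cast
        ring
  · have h1 := (I.network M).excess_eq_sum (I.classFlow cs) (I.network M).source
    rw [sum_edges] at h1
    rw [h1]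
    simp only [network, reduceCtorEq, if_false, sub_zero, sub_self, zero_mul,
      Finset.sum_const_zero, zero_add, add_zero, if_true, one_mul, hentry]
    rw [← Nat.cast_sum]
    congr 1
    have h2 : ∀ c, countBefore cs c n = (Finset.univ.filter fun k => cs k = c).card := by
      intro c
      simp [countBefore]
    simp only [h2]
    rw [← Finset.card_eq_sum_card_fiberwise (f := cs) (s := Finset.univ) (t := Finset.univ)
      (by simp)]
    simp

/-! ### The reduction -/

theorem Feasible.lower_le_count (hΔ : I.Delta = 1) {π : Fin n ↪ Fin m} (h : I.Feasible π)
    (k : Fin n) (ℓ : Fin p) : I.L k ℓ ≤ count (fun j => I.classOf (π j)) (some ℓ) k :=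
  topCount_eq_count hΔ π ℓ k ▸ (h k ℓ).1

theorem Feasible.count_le_upper (hΔ : I.Delta = 1) {π : Fin n ↪ Fin m} (h : I.Feasible π)
    (c : Option (Fin p)) (k : Fin n) : count (fun j => I.classOf (π j)) c k ≤ I.upper k c := by
  cases c with
  | none => exact (Finset.card_le_univ _).trans_eq (Fintype.card_fin n)
  | some ℓ => exact topCount_eq_count hΔ π ℓ k ▸ (h k ℓ).2

theorem exists_isFlow_of_feasible (hΔ : I.Delta = 1) {π : Fin n ↪ Fin m} (h : I.Feasible π)
    (M : ℝ) : (I.network M).IsFlow (I.classFlow fun j => I.classOf (π j)) n := by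
  obtain ⟨σ, hσ⟩ := exists_isSorted_classOf hΔ π
  exact isFlow_classFlow (h.count_le_upper hΔ) (hσ.count_le_card hΔ) M

theorem exists_readsOff_of_isFlow (hΔ : I.Delta = 1) {M : ℝ} {f : Edge m n p → ℝ}
    (hf : (I.network M).IsFlow f n) (hi : (I.network M).Integral f) :
    ∃ cs π, (∀ c k, f (.exit c k) = if cs k = c then 1 else 0) ∧ I.IsSorted cs π ∧
      I.ReadsOff f π ∧ ∀ c k, count cs c k ≤ I.upper k c := by
  obtain ⟨cs, hcs⟩ := exists_classAssignment hf hi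
  obtain ⟨π, hπ⟩ := exists_isSorted (I := I) hΔ (cs := cs) fun c k =>
    card_usedItems hf hi hcs c k ▸ Finset.card_le_card (usedItems_subset f c k)
  refine ⟨cs, π, hcs, hπ, fun k => ⟨cs k, by simp [hcs], (hπ k).1, ?_⟩,
    fun c k => card_usedItems hf hi hcs c k ▸ card_usedItems_le f c k⟩
  rw [sum_exit_eq_count hcs, ← (hπ k).2]
  push_cast
  rfl

theorem feasible_of_meetsLowerBounds (hΔ : I.Delta = 1) {M : ℝ} {f : Edge m n p → ℝ}
    (hf : (I.network M).IsFlow f n) (hi : (I.network M).Integral f)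
    (hl : I.MeetsLowerBounds f) : ∃ π, I.Feasible π := by
  obtain ⟨cs, π, hcs, hπ, -, hu⟩ := exists_readsOff_of_isFlow hΔ hf hi
  refine ⟨π, fun k ℓ => ?_⟩
  rw [hπ.topCount_eq hΔ]
  refine ⟨?_, hu (some ℓ) k⟩
  have := hl k ℓ
  rw [chainFlow_eq_sum_exit hf, sum_exit_eq_count hcs] at this
  exact_mod_cast this

/-- The flow costs -value - M * S, where `S` counts the units covered by lower bounds, and any
feasible ranking gives a flow with the full count. The size of `M` forces `S` to be full; after that
only the values are compared. -/
theorem optimal_of_isMinCostFlow (hΔ : I.Delta = 1) (hM : I.MonotoneMonge) {M : ℝ}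
    (hM0 : 2 * ∑ i, ∑ j, |I.W i j| < M) (hfeas : ∃ π, I.Feasible π) {f : Edge m n p → ℝ}
    (hf : (I.network M).IsMinCostFlow f n) (hi : (I.network M).Integral f) :
    (∃ π, I.ReadsOff f π ∧ I.Optimal π ∧
      I.value π = -(I.network M).flowCost f - M * ∑ k, ∑ ℓ, (I.L k ℓ : ℝ)) ∧
    I.MeetsLowerBounds f := by
  have hW0 : 0 ≤ ∑ i, ∑ j, |I.W i j| :=
    Finset.sum_nonneg fun i _ => Finset.sum_nonneg fun j _ => abs_nonneg _
  obtain ⟨cs, π, hcs, hπ, hread, hu⟩ := exists_readsOff_of_isFlow hΔ hf.1 hi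
  have h1 := classCost_le_flowCost hM (by linarith) hf.1 hi hcs
  have h2 := hf.2 _ (isFlow_classFlow hu (hπ.count_le_card hΔ) M)
  rw [flowCost_classFlow hu] at h2
  have hcost := le_antisymm h2 h1
  rw [hπ.classCost_eq hΔ] at hcost
  set S : ℕ := ∑ k, ∑ ℓ, min (count cs (some ℓ) k) (I.L k ℓ) with hS
  have hother : ∀ π', I.Feasible π' →
      (I.network M).flowCost f ≤ -I.value π' - M * ((∑ k, ∑ ℓ, I.L k ℓ : ℕ) : ℝ) := by
    intro π' h'
    obtain ⟨σ, hσ⟩ := exists_isSorted_classOf hΔ π'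
    have e1 := hf.2 _ (exists_isFlow_of_feasible hΔ h' M)
    rw [flowCost_classFlow (h'.count_le_upper hΔ), hσ.classCost_eq hΔ] at e1
    have e2 := hσ.value_le hΔ hM
    simp only [min_eq_right (h'.lower_le_count hΔ _ _)] at e1
    linarith
  have hSle : S ≤ ∑ k, ∑ ℓ, I.L k ℓ :=
    Finset.sum_le_sum fun k _ => Finset.sum_le_sum fun ℓ _ => min_le_right _ _
  -- If one unit were missing, `M` would be at most a difference of two values, which is at most
  -- 2∑|W|.
  have hSeq : S = ∑ k, ∑ ℓ, I.L k ℓ := by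
    refine le_antisymm hSle (not_lt.1 fun hlt => ?_)
    obtain ⟨π', h'⟩ := hfeas
    have e1 := hother π' h'
    have e2 := (abs_le.1 (I.abs_value_le π)).2
    have e3 := (abs_le.1 (I.abs_value_le π')).1
    have e4 : (S : ℝ) + 1 ≤ ((∑ k, ∑ ℓ, I.L k ℓ : ℕ) : ℝ) := by exact_mod_cast hlt
    nlinarith
  have hL : ∀ k ℓ, I.L k ℓ ≤ count cs (some ℓ) k := by
    have e1 : ∀ k ∈ Finset.univ, ∑ ℓ, min (count cs (some ℓ) k) (I.L k ℓ) = ∑ ℓ, I.L k ℓ :=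
      (Finset.sum_eq_sum_iff_of_le fun k _ => Finset.sum_le_sum fun ℓ _ => min_le_right _ _).1 hSeq
    intro k ℓ
    have e2 := (Finset.sum_eq_sum_iff_of_le fun ℓ _ => min_le_right _ _).1
      (e1 k (Finset.mem_univ k)) ℓ (Finset.mem_univ ℓ)
    exact min_eq_right_iff.1 e2
  rw [hSeq] at hcost
  refine ⟨⟨π, hread, ⟨fun k ℓ => ?_, fun π' h' => ?_⟩, ?_⟩, fun k ℓ => ?_⟩
  · rw [hπ.topCount_eq hΔ]
    exact ⟨hL k ℓ, hu (some ℓ) k⟩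
  · have := hother π' h'
    linarith
  · push_cast at hcost
    linarith
  · rw [chainFlow_eq_sum_exit hf.1, sum_exit_eq_count hcs]
    exact_mod_cast hL k ℓ

/-- Successive shortest paths itself supplies the integral optimum. -/
theorem exists_isMinCostFlow_of_feasible (hΔ : I.Delta = 1) {π : Fin n ↪ Fin m}
    (h : I.Feasible π) (M : ℝ) :
    ∃ f, (I.network M).IsMinCostFlow f n ∧ (I.network M).Integral f := by
  have : Finite (Edge m n p) := inferInstance
  obtain ⟨f, hf⟩ := Network.exists_ssp (source_ne_sink M) (exists_isPotential_zero M)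
    ⟨_, exists_isFlow_of_feasible hΔ h M⟩
  exact ⟨f, hf.isMinCostFlow (source_ne_sink M) (exists_isPotential_zero M)⟩

end Instance

/-! ### Reasoning about programs -/

namespace Prog

/-- The natural-number registers that a program may change. -/
def nregs : Prog → List ℕ
  | setN x _ => [x]
  | seq s₁ s₂ => s₁.nregs ++ s₂.nregs
  | cond _ s₁ s₂ => s₁.nregs ++ s₂.nregs
  | loop _ s => s.nregs
  | _ => []

/-- The real registers that a program may change. -/
def rregs : Prog → List ℕ
  | setR x _ => [x]
  | seq s₁ s₂ => s₁.rregs ++ s₂.rregs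
  | cond _ s₁ s₂ => s₁.rregs ++ s₂.rregs
  | loop _ s => s.rregs
  | _ => []

/-- The natural-number arrays that a program may change. -/
def narrs : Prog → List ℕ
  | putN a _ _ => [a]
  | seq s₁ s₂ => s₁.narrs ++ s₂.narrs
  | cond _ s₁ s₂ => s₁.narrs ++ s₂.narrs
  | loop _ s => s.narrs
  | _ => []

/-- The real arrays that a program may change. -/
def rarrs : Prog → List ℕ
  | putR a _ _ => [a]
  | seq s₁ s₂ => s₁.rarrs ++ s₂.rarrs
  | cond _ s₁ s₂ => s₁.rarrs ++ s₂.rarrs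
  | loop _ s => s.rarrs
  | _ => []

/-- The two states agree on all memory that the program does not change. -/
structure Frame (s : Prog) (σ τ : State) : Prop where
  nreg : ∀ x, x ∉ s.nregs → τ.nreg x = σ.nreg x
  rreg : ∀ x, x ∉ s.rregs → τ.rreg x = σ.rreg x
  narr : ∀ a, a ∉ s.narrs → τ.narr a = σ.narr a
  rarr : ∀ a, a ∉ s.rarrs → τ.rarr a = σ.rarr a

theorem Frame.refl (s : Prog) (σ : State) : s.Frame σ σ :=
  ⟨fun _ _ => rfl, fun _ _ => rfl, fun _ _ => rfl, fun _ _ => rfl⟩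

theorem Frame.trans {s s₁ s₂ : Prog} {σ τ υ : State} (h₁ : s₁.Frame σ τ) (h₂ : s₂.Frame τ υ)
    (hs : ∀ x, (x ∈ s₁.nregs ++ s₂.nregs → x ∈ s.nregs) ∧
      (x ∈ s₁.rregs ++ s₂.rregs → x ∈ s.rregs) ∧ (x ∈ s₁.narrs ++ s₂.narrs → x ∈ s.narrs) ∧
      (x ∈ s₁.rarrs ++ s₂.rarrs → x ∈ s.rarrs)) : s.Frame σ υ := by
  simp only [List.mem_append] at hs
  refine ⟨fun x hx => ?_, fun x hx => ?_, fun x hx => ?_, fun x hx => ?_⟩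
  · rw [h₂.nreg x fun h => hx ((hs x).1 (.inr h)), h₁.nreg x fun h => hx ((hs x).1 (.inl h))]
  · rw [h₂.rreg x fun h => hx ((hs x).2.1 (.inr h)), h₁.rreg x fun h => hx ((hs x).2.1 (.inl h))]
  · rw [h₂.narr x fun h => hx ((hs x).2.2.1 (.inr h)),
      h₁.narr x fun h => hx ((hs x).2.2.1 (.inl h))]
  · rw [h₂.rarr x fun h => hx ((hs x).2.2.2 (.inr h)),
      h₁.rarr x fun h => hx ((hs x).2.2.2 (.inl h))]

theorem Frame.weaken {s s₁ : Prog} {σ τ : State} (h₁ : s₁.Frame σ τ)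
    (hs : ∀ x, (x ∈ s₁.nregs → x ∈ s.nregs) ∧ (x ∈ s₁.rregs → x ∈ s.rregs) ∧
      (x ∈ s₁.narrs → x ∈ s.narrs) ∧ (x ∈ s₁.rarrs → x ∈ s.rarrs)) : s.Frame σ τ :=
  ⟨fun x hx => h₁.nreg x fun h => hx ((hs x).1 h), fun x hx => h₁.rreg x fun h => hx ((hs x).2.1 h),
    fun x hx => h₁.narr x fun h => hx ((hs x).2.2.1 h),
    fun x hx => h₁.rarr x fun h => hx ((hs x).2.2.2 h)⟩

/-- The memory that a program may change is read from its text, so that later preservation claims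
are settled by `decide`. -/
theorem frame_of_run {s : Prog} {σ τ : State} {t : ℕ} (h : Run s σ τ t) : s.Frame σ τ := by
  induction h with
  | skip => exact Frame.refl _ _
  | setN σ x e =>
    refine ⟨fun y hy => ?_, fun _ _ => rfl, fun _ _ => rfl, fun _ _ => rfl⟩
    exact Function.update_of_ne (by simpa [nregs] using hy) _ _
  | setR σ x e =>
    refine ⟨fun _ _ => rfl, fun y hy => ?_, fun _ _ => rfl, fun _ _ => rfl⟩
    exact Function.update_of_ne (by simpa [rregs] using hy) _ _
  | putN σ a i e =>
    refine ⟨fun _ _ => rfl, fun _ _ => rfl, fun y hy => ?_, fun _ _ => rfl⟩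
    exact Function.update_of_ne (by simpa [narrs] using hy) _ _
  | putR σ a i e =>
    refine ⟨fun _ _ => rfl, fun _ _ => rfl, fun _ _ => rfl, fun y hy => ?_⟩
    exact Function.update_of_ne (by simpa [rarrs] using hy) _ _
  | seq _ _ ih₁ ih₂ => exact ih₁.trans ih₂ fun x => ⟨id, id, id, id⟩
  | condTrue _ _ ih =>
    exact ih.weaken fun x => by simp +contextual [nregs, rregs, narrs, rarrs]
  | condFalse _ _ ih =>
    exact ih.weaken fun x => by simp +contextual [nregs, rregs, narrs, rarrs]
  | loopTrue _ _ _ ih₁ ih₂ =>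
    exact ih₁.trans ih₂ fun x => by simp [nregs, rregs, narrs, rarrs]
  | loopFalse => exact Frame.refl _ _

/-- Started in `σ`, the program halts after at most `T` steps in a state satisfying `Q`. -/
def Ends (s : Prog) (σ : State) (T : ℕ) (Q : State → Prop) : Prop :=
  ∃ τ t, Run s σ τ t ∧ t ≤ T ∧ Q τ

theorem Ends.mono {s : Prog} {σ : State} {T T' : ℕ} {Q Q' : State → Prop} (h : s.Ends σ T Q)
    (hT : T ≤ T') (hQ : ∀ τ, s.Frame σ τ → Q τ → Q' τ) : s.Ends σ T' Q' := by
  obtain ⟨τ, t, h1, h2, h3⟩ := h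
  exact ⟨τ, t, h1, h2.trans hT, hQ τ (frame_of_run h1) h3⟩

theorem Ends.seq {s₁ s₂ : Prog} {σ : State} {T₁ T₂ : ℕ} {R Q : State → Prop}
    (h₁ : s₁.Ends σ T₁ R) (h₂ : ∀ τ, s₁.Frame σ τ → R τ → s₂.Ends τ T₂ Q) :
    (Prog.seq s₁ s₂).Ends σ (T₁ + T₂) Q := by
  obtain ⟨τ, t, r, ht, hR⟩ := h₁
  obtain ⟨υ, t', r', ht', hQ⟩ := h₂ τ (frame_of_run r) hR
  exact ⟨υ, t + t', r.seq r', by omega, hQ⟩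

theorem Ends.cond {b : Cond} {s₁ s₂ : Prog} {σ : State} {T : ℕ} {Q : State → Prop}
    (h₁ : b.Holds σ → s₁.Ends σ T Q) (h₂ : ¬ b.Holds σ → s₂.Ends σ T Q) :
    (Prog.cond b s₁ s₂).Ends σ (b.size + 1 + T) Q := by
  by_cases h : b.Holds σ
  · obtain ⟨τ, t, r, ht, hQ⟩ := h₁ h
    exact ⟨τ, _, .condTrue h r, by omega, hQ⟩
  · obtain ⟨τ, t, r, ht, hQ⟩ := h₂ h
    exact ⟨τ, _, .condFalse h r, by omega, hQ⟩

/-- The program has no loops. -/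
def loopFree : Prog → Bool
  | seq s₁ s₂ => s₁.loopFree && s₂.loopFree
  | cond _ s₁ s₂ => s₁.loopFree && s₂.loopFree
  | loop _ _ => false
  | _ => true

open Classical in
/-- The effect of a program without loops. -/
noncomputable def exec : Prog → State → State
  | skip, σ => σ
  | setN x e, σ => { σ with nreg := Function.update σ.nreg x (e.eval σ) }
  | setR x e, σ => { σ with rreg := Function.update σ.rreg x (e.eval σ) }
  | putN a i e, σ => { σ with narr := Function.update σ.narr a
                                (Function.update (σ.narr a) (i.eval σ) (e.eval σ)) }
  | putR a i e, σ => { σ with rarr := Function.update σ.rarr a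
                                (Function.update (σ.rarr a) (i.eval σ) (e.eval σ)) }
  | seq s₁ s₂, σ => s₂.exec (s₁.exec σ)
  | cond b s₁ s₂, σ => if b.Holds σ then s₁.exec σ else s₂.exec σ
  | loop _ _, σ => σ

/-- A bound on the running time of a program without loops. -/
def bound : Prog → ℕ
  | skip => 1
  | setN _ e => e.size + 1
  | setR _ e => e.size + 1
  | putN _ i e => i.size + e.size + 1
  | putR _ i e => i.size + e.size + 1
  | seq s₁ s₂ => s₁.bound + s₂.bound
  | cond b s₁ s₂ => b.size + 1 + (s₁.bound + s₂.bound)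
  | loop _ _ => 0

theorem ends_exec {s : Prog} (hs : s.loopFree = true) (σ : State) :
    s.Ends σ s.bound (· = s.exec σ) := by
  induction s generalizing σ with
  | skip => exact ⟨_, _, .skip σ, le_rfl, rfl⟩
  | setN x e => exact ⟨_, _, .setN σ x e, le_rfl, rfl⟩
  | setR x e => exact ⟨_, _, .setR σ x e, le_rfl, rfl⟩
  | putN a i e => exact ⟨_, _, .putN σ a i e, le_rfl, rfl⟩
  | putR a i e => exact ⟨_, _, .putR σ a i e, le_rfl, rfl⟩
  | seq s₁ s₂ ih₁ ih₂ =>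
    simp only [loopFree, Bool.and_eq_true] at hs
    refine (ih₁ hs.1 σ).seq fun τ _ hτ => ?_
    subst hτ
    exact ih₂ hs.2 _
  | cond b s₁ s₂ ih₁ ih₂ =>
    simp only [loopFree, Bool.and_eq_true] at hs
    refine Ends.cond (fun h => ?_) fun h => ?_
    · exact (ih₁ hs.1 σ).mono (Nat.le_add_right _ _) fun τ _ hτ => by simp [exec, h, hτ]
    · exact (ih₂ hs.2 σ).mono (Nat.le_add_left _ _) fun τ _ hτ => by simp [exec, h, hτ]
  | loop b s ih => simp [loopFree] at hs

theorem ends_of_exec {s : Prog} {σ : State} {T : ℕ} {Q : State → Prop} (hs : s.loopFree = true)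
    (hT : s.bound ≤ T) (hQ : Q (s.exec σ)) : s.Ends σ T Q :=
  (ends_exec hs σ).mono hT fun _ _ hτ => hτ ▸ hQ

theorem Ends.exec_seq {s₁ s₂ : Prog} {σ : State} {T : ℕ} {Q : State → Prop}
    (hs : s₁.loopFree = true) (h : s₂.Ends (s₁.exec σ) T Q) :
    (Prog.seq s₁ s₂).Ends σ (s₁.bound + T) Q :=
  (ends_exec hs σ).seq fun _ _ hτ => hτ ▸ h

/-- A loop whose invariant carries a counter. -/
theorem Ends.loop {b : Cond} {s : Prog} {B N : ℕ} (Inv : ℕ → State → Prop) {σ : State}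
    (h0 : Inv 0 σ)
    (hstep : ∀ j τ, (Prog.loop b s).Frame σ τ → Inv j τ → b.Holds τ →
      j < N ∧ s.Ends τ B (Inv (j + 1))) :
    (Prog.loop b s).Ends σ (N * (b.size + 1 + B) + (b.size + 1))
      fun τ => ∃ j ≤ N, Inv j τ ∧ ¬ b.Holds τ := by
  have key : ∀ d j τ, N - j = d → j ≤ N → (Prog.loop b s).Frame σ τ → Inv j τ →
      (Prog.loop b s).Ends τ (d * (b.size + 1 + B) + (b.size + 1))
        fun τ => ∃ j ≤ N, Inv j τ ∧ ¬ b.Holds τ := by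
    intro d
    induction d with
    | zero =>
      intro j τ hd hj hF hI
      have hb : ¬ b.Holds τ := fun hb => by
        have := (hstep j τ hF hI hb).1
        omega
      exact ⟨τ, _, .loopFalse hb, by omega, j, hj, hI, hb⟩
    | succ d ih =>
      intro j τ hd hj hF hI
      by_cases hb : b.Holds τ
      · obtain ⟨-, υ, t, r, ht, hI'⟩ := hstep j τ hF hI hb
        have hF' : (Prog.loop b s).Frame σ υ :=
          hF.trans (frame_of_run r) fun x => by simp [nregs, rregs, narrs, rarrs]
        obtain ⟨υ', t', r', ht', hQ⟩ := ih (j + 1) υ (by omega) (by omega) hF' hI'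
        refine ⟨υ', _, .loopTrue hb r r', ?_, hQ⟩
        rw [Nat.succ_mul]
        omega
      · exact ⟨τ, _, .loopFalse hb, by rw [Nat.succ_mul]; omega, j, hj, hI, hb⟩
  simpa using key N 0 σ (by simp) (Nat.zero_le _) (Frame.refl _ _) h0

/-- The counting loop: the register `x` runs through the numbers below the content of `y`. -/
def forLoop (x y : ℕ) (s : Prog) : Prog :=
  .seq (.setN x (.const 0)) (.loop (.nlt (.reg x) (.reg y))
    (.seq s (.setN x (.add (.reg x) (.const 1)))))

/-- Each round costs 4 for the test, `B` for the body and 4 for the increment; the 6 pays for the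
initialization and the last test. `hInv` asks that the invariant ignore the counter register. Since
every round receives the frame of the whole loop, the invariant need only describe what changes. -/
theorem Ends.forLoop {x y : ℕ} {s : Prog} {B : ℕ} (Inv : ℕ → State → Prop) {σ : State}
    (hxy : y ≠ x) (hx : x ∉ s.nregs) (hy : y ∉ s.nregs)
    (hInv : ∀ j τ c, Inv j τ → Inv j { τ with nreg := Function.update τ.nreg x c })
    (h0 : Inv 0 σ)
    (hstep : ∀ j τ, j < σ.nreg y → τ.nreg x = j → (Prog.forLoop x y s).Frame σ τ → Inv j τ →
      s.Ends τ B (Inv (j + 1))) :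
    (Prog.forLoop x y s).Ends σ (σ.nreg y * (B + 8) + 6) (Inv (σ.nreg y)) := by
  have hT : σ.nreg y * (B + 8) + 6 =
      (Prog.setN x (.const 0)).bound + (σ.nreg y * ((Cond.nlt (.reg x) (.reg y)).size + 1 +
        (B + 4)) + ((Cond.nlt (.reg x) (.reg y)).size + 1)) := by
    simp only [Cond.size, NExpr.size, bound]
    ring
  rw [hT]
  refine Ends.exec_seq rfl (Ends.mono (Ends.loop (N := σ.nreg y) (fun j τ => Inv j τ ∧ τ.nreg x = j ∧
    j ≤ σ.nreg y) (σ := exec (.setN x (.const 0)) σ) (B := B + 4) ?_ ?_) le_rfl ?_)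
  · exact ⟨hInv _ _ _ h0, by simp [exec, NExpr.eval], Nat.zero_le _⟩
  · rintro j τ hF ⟨hI, hj, hjN⟩ hb
    have hF' : (Prog.forLoop x y s).Frame σ τ :=
      (frame_of_run (Run.setN σ x (.const 0))).trans hF fun z => by
        simp [Prog.forLoop, nregs, rregs, narrs, rarrs]
    have hyN : τ.nreg y = σ.nreg y :=
      hF'.nreg y (by simp [Prog.forLoop, nregs, hxy, hy])
    simp only [Cond.Holds, NExpr.eval, hj, hyN] at hb
    refine ⟨hb, (hstep j τ hb hj hF' hI).seq (T₂ := 4) fun υ hFυ hυ => ?_⟩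
    refine ends_of_exec rfl (by simp [bound, NExpr.size]) ⟨hInv _ _ _ hυ, ?_, by omega⟩
    simp [exec, NExpr.eval, hFυ.nreg x hx, hj]
  · rintro τ hF ⟨j, hj, ⟨hI, hjx, hjN⟩, hb⟩
    have hyN : τ.nreg y = σ.nreg y := by
      rw [hF.nreg y (by simp [nregs, hxy, hy])]
      simp [exec, hxy]
    simp only [Cond.Holds, NExpr.eval, hjx, hyN, not_lt] at hb
    exact le_antisymm hj hb ▸ hI

end Prog

/-! ### The Hungarian method with column prices -/

/-- `mt` matches the first `r` rows of the cost matrix `a` to columns below `m` (`mt i = k + 1` if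
column `i` is matched to row `k`, and `mt i = 0` if it is free), and with the prices `v` every
matched row has a cheapest column. -/
structure PricedMatching (m r : ℕ) (a : ℕ → ℕ → ℝ) (mt : ℕ → ℕ) (v : ℕ → ℝ) : Prop where
  le : ∀ i < m, mt i ≤ r
  inj : ∀ i < m, ∀ j < m, mt i = mt j → mt i ≠ 0 → i = j
  surj : ∀ k < r, ∃ i < m, mt i = k + 1
  nonpos : ∀ i < m, v i ≤ 0
  free : ∀ i < m, mt i = 0 → v i = 0
  best : ∀ i < m, mt i ≠ 0 → ∀ j < m, a (mt i - 1) i - v i ≤ a (mt i - 1) j - v j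

namespace PricedMatching

variable {m r : ℕ} {a : ℕ → ℕ → ℝ} {mt : ℕ → ℕ} {v : ℕ → ℝ}

theorem zero (m : ℕ) (a : ℕ → ℕ → ℝ) : PricedMatching m 0 a (fun _ => 0) (fun _ => 0) :=
  ⟨by simp, by simp, by simp, by simp, by simp, by simp⟩

/-- The matching has minimum cost. -/
theorem sum_le {n m : ℕ} {a : ℕ → ℕ → ℝ} {mt : ℕ → ℕ} {v : ℕ → ℝ}
    (h : PricedMatching m n a mt v) {π : Fin n ↪ Fin m} (hπ : ∀ k, mt (π k) = k + 1)
    (σ : Fin n ↪ Fin m) : ∑ k : Fin n, a k (π k) ≤ ∑ k : Fin n, a k (σ k) := by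
  have h1 : ∑ k : Fin n, (a k (π k) - v (π k)) ≤ ∑ k : Fin n, (a k (σ k) - v (σ k)) := by
    refine Finset.sum_le_sum fun k _ => ?_
    have := h.best (π k) (π k).2 (by simp [hπ]) (σ k) (σ k).2
    simpa [hπ] using this
  -- Unmatched columns have price zero, so the matched ones carry the whole price sum; any other
  -- assignment omits only nonpositive prices.
  have h2 : ∑ k : Fin n, v (π k) = ∑ i : Fin m, v i := by
    rw [← Finset.sum_map Finset.univ π fun i : Fin m => v i]
    refine Finset.sum_subset (Finset.subset_univ _) fun i _ hi => h.free i i.2 ?_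
    by_contra hne
    have hle := h.le i i.2
    apply hi
    refine Finset.mem_map.2 ⟨⟨mt i - 1, by omega⟩, Finset.mem_univ _, ?_⟩
    have e := hπ ⟨mt i - 1, by omega⟩
    refine Fin.ext (h.inj _ (Fin.is_lt _) _ i.2 ?_ ?_)
    · rw [e]; simp only; omega
    · rw [e]; omega
  have h3 : ∑ i : Fin m, v i ≤ ∑ k : Fin n, v (σ k) := by
    rw [← Finset.sum_map Finset.univ σ fun i : Fin m => v i]
    have := Finset.sum_le_sum_of_subset_of_nonneg (f := fun i : Fin m => -v i)
      (Finset.subset_univ (Finset.univ.map σ)) fun i _ _ => neg_nonneg.2 (h.nonpos i i.2)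
    simpa only [Finset.sum_neg_distrib, neg_le_neg_iff] using this
  simp only [Finset.sum_sub_distrib] at h1
  linarith

/-- The state of the shortest path computation from row `r` after `s` columns are settled. -/
structure Search (m r : ℕ) (a : ℕ → ℕ → ℝ) (mt : ℕ → ℕ) (v : ℕ → ℝ) (s : ℕ) (used way : ℕ → ℕ)
    (dist : ℕ → ℝ) (ord : ℕ → ℕ) : Prop where
  matched : ∀ i < m, used i ≠ 0 → mt i ≠ 0
  card : ((Finset.range m).filter fun i => used i ≠ 0).card = s
  ord_lt : ∀ i < m, used i ≠ 0 → ord i < s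
  root : ∀ i < m, way i = 0 → dist i = a r i - v i
  tree : ∀ i < m, ∀ q, way i = q + 1 → q < m ∧ used q ≠ 0 ∧ (used i ≠ 0 → ord q < ord i) ∧
    dist i = dist q + (a (mt q - 1) i - v i) - (a (mt q - 1) q - v q)
  le_root : ∀ i < m, dist i ≤ a r i - v i
  le : ∀ i < m, ∀ q < m, used q ≠ 0 →
    dist i ≤ dist q + (a (mt q - 1) i - v i) - (a (mt q - 1) q - v q)
  mono : ∀ q < m, used q ≠ 0 → ∀ i < m, used i = 0 → dist q ≤ dist i

namespace Search

variable {s : ℕ} {used way : ℕ → ℕ} {dist : ℕ → ℝ} {ord : ℕ → ℕ}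

theorem init {dist : ℕ → ℝ} {used way : ℕ → ℕ} (hd : ∀ i < m, dist i = a r i - v i)
    (hu : ∀ i < m, used i = 0) (hw : ∀ i < m, way i = 0) (ord : ℕ → ℕ) :
    Search m r a mt v 0 used way dist ord where
  matched i hi h := absurd (hu i hi) h
  card := by
    rw [Finset.card_eq_zero, Finset.filter_eq_empty_iff]
    exact fun i hi => not_not.2 (hu i (Finset.mem_range.1 hi))
  ord_lt i hi h := absurd (hu i hi) h
  root i hi _ := hd i hi
  tree i hi q h := by rw [hw i hi] at h; omega
  le_root i hi := (hd i hi).le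
  le _ _ q hq h := absurd (hu q hq) h
  mono q hq h := absurd (hu q hq) h

/-- Settled columns are matched to distinct rows among the first `r`. This bounds the number of
rounds of a search. -/
theorem settled_le (hP : PricedMatching m r a mt v) (h : Search m r a mt v s used way dist ord) :
    s ≤ r := by
  rw [← h.card, ← Finset.card_range r]
  refine Finset.card_le_card_of_injOn (fun i => mt i - 1) (fun i hi => ?_) fun i hi j hj e => ?_
  · simp only [Finset.coe_filter, Finset.mem_range, Set.mem_ofPred_eq] at hi
    have h1 := h.matched i hi.1 hi.2
    have h2 := hP.le i hi.1
    simp only [Finset.coe_range, Set.mem_Iio]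
    omega
  · simp only [Finset.coe_filter, Finset.mem_range, Set.mem_ofPred_eq] at hi hj
    have h1 := h.matched i hi.1 hi.2
    have h2 := h.matched j hj.1 hj.2
    simp only at e
    exact hP.inj i hi.1 j hj.1 (by omega) h1

theorem exists_unused (hP : PricedMatching m r a mt v) (hr : r < m)
    (h : Search m r a mt v s used way dist ord) : ∃ i < m, used i = 0 := by
  by_contra hno
  push Not at hno
  have h1 := h.settled_le hP
  have h2 := h.card
  rw [Finset.filter_true_of_mem (by simpa using hno), Finset.card_range] at h2
  omega

/-- A Dijkstra step. Going from column `j` through its matched row to column `i` has as length the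
difference of their reduced costs in that row, which is nonnegative because `j` is cheapest there.
So no later label drops below that of `j`. The hypothesis `hnew` is the outcome of relaxing. -/
theorem step (hP : PricedMatching m r a mt v) (h : Search m r a mt v s used way dist ord)
    {j : ℕ} (hj : j < m) (huj : used j = 0) (hmin : ∀ i < m, used i = 0 → dist j ≤ dist i)
    (hmj : mt j ≠ 0) {way' : ℕ → ℕ} {dist' : ℕ → ℝ}
    (hnew : ∀ i < m,
      (way' i = way i ∧ dist' i = dist i ∧ ((used i ≠ 0 ∨ i = j) ∨
        dist i ≤ dist j + (a (mt j - 1) i - v i) - (a (mt j - 1) j - v j))) ∨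
      (way' i = j + 1 ∧ dist' i = dist j + (a (mt j - 1) i - v i) - (a (mt j - 1) j - v j) ∧
        used i = 0 ∧ i ≠ j ∧ dist' i ≤ dist i)) :
    Search m r a mt v (s + 1) (Function.update used j 1) way' dist' (Function.update ord j s) := by
  have hred : ∀ i < m, 0 ≤ (a (mt j - 1) i - v i) - (a (mt j - 1) j - v j) := fun i hi => by
    have := hP.best j hj hmj i hi
    linarith
  have hu : ∀ i, Function.update used j 1 i ≠ 0 ↔ used i ≠ 0 ∨ i = j := fun i => by
    by_cases hij : i = j <;> simp [hij]
  have hsame : ∀ i < m, Function.update used j 1 i ≠ 0 → dist' i = dist i := by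
    intro i hi hui
    rcases hnew i hi with h1 | h1
    · exact h1.2.1
    · rcases (hu i).1 hui with h2 | h2
      · exact absurd h1.2.2.1 h2
      · exact absurd h2 h1.2.2.2.1
  have hle : ∀ i < m, dist' i ≤ dist i := fun i hi => by
    rcases hnew i hi with h1 | h1
    · exact h1.2.1.le
    · exact h1.2.2.2.2
  constructor
  · intro i hi hui
    rcases (hu i).1 hui with h1 | rfl
    · exact h.matched i hi h1
    · exact hmj
  · have : ((Finset.range m).filter fun i => Function.update used j 1 i ≠ 0) =
        insert j ((Finset.range m).filter fun i => used i ≠ 0) := by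
      ext i
      simp only [Finset.mem_filter, Finset.mem_range, hu, Finset.mem_insert]
      constructor
      · tauto
      · rintro (rfl | h1)
        · exact ⟨hj, Or.inr rfl⟩
        · exact ⟨h1.1, Or.inl h1.2⟩
    rw [this, Finset.card_insert_of_notMem (by simp [huj]), h.card]
  · intro i hi hui
    by_cases hij : i = j
    · simp [hij]
    · rw [Function.update_of_ne hij]
      have := h.ord_lt i hi (((hu i).1 hui).resolve_right hij)
      omega
  · intro i hi hw
    rcases hnew i hi with h1 | h1
    · rw [h1.2.1]
      exact h.root i hi (by rw [← h1.1, hw])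
    · rw [h1.1] at hw
      omega
  · intro i hi q hw
    rcases hnew i hi with h1 | h1
    · rw [h1.1] at hw
      obtain ⟨t1, t2, t3, t4⟩ := h.tree i hi q hw
      have hqj : q ≠ j := fun e => t2 (e ▸ huj)
      have hq' : Function.update used j 1 q ≠ 0 := (hu q).2 (Or.inl t2)
      refine ⟨t1, hq', fun hui => ?_, ?_⟩
      · rw [Function.update_of_ne hqj]
        by_cases hij : i = j
        · rw [hij, Function.update_self]
          exact h.ord_lt q t1 t2
        · rw [Function.update_of_ne hij]
          exact t3 (((hu i).1 hui).resolve_right hij)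
      · rw [h1.2.1, hsame q t1 hq', t4]
    · rw [h1.1, Nat.succ_inj] at hw
      subst hw
      have hj' : Function.update used j 1 j ≠ 0 := (hu j).2 (Or.inr rfl)
      refine ⟨hj, hj', fun hui => ?_, ?_⟩
      · rcases (hu i).1 hui with h2 | h2
        · exact absurd h1.2.2.1 h2
        · exact absurd h2 h1.2.2.2.1
      · rw [h1.2.1, hsame j hj hj']
  · exact fun i hi => (hle i hi).trans (h.le_root i hi)
  · intro i hi q hq huq
    rw [hsame q hq huq]
    rcases (hu q).1 huq with h2 | rfl
    · exact (hle i hi).trans (h.le i hi q hq h2)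
    · rcases hnew i hi with h1 | h1
      · rw [h1.2.1]
        -- An unchanged column is settled, hence no farther than the new one, or is the new one, or
        -- already has a label that is at least as good.
        rcases h1.2.2 with (h3 | rfl) | h3
        · have := h.mono i hi h3 q hq huj
          have := hred i hi
          linarith
        · linarith
        · exact h3
      · exact h1.2.1.le
  · intro q hq huq i hi hui
    have hi' : used i = 0 ∧ i ≠ j := by
      have : ¬ (used i ≠ 0 ∨ i = j) := fun hc => (hu i).2 hc hui
      push Not at this
      exact this
    rw [hsame q hq huq]
    have hqj : dist q ≤ dist j := by
      rcases (hu q).1 huq with h2 | rfl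
      · exact h.mono q hq h2 j hj huj
      · exact le_rfl
    refine hqj.trans ?_
    rcases hnew i hi with h1 | h1
    · rw [h1.2.1]
      exact hmin i hi hi'.1
    · have := hred i hi
      rw [h1.2.1]
      linarith

end Search

/-- The state of the augmentation: `h` is the column that is matched next. -/
structure Hole (m r : ℕ) (a : ℕ → ℕ → ℝ) (mt₀ : ℕ → ℕ) (used ord : ℕ → ℕ) (j : ℕ) (v : ℕ → ℝ)
    (mt : ℕ → ℕ) (h : ℕ) : Prop where
  lt : h < m
  used_or : h = j ∨ used h ≠ 0
  same : ∀ i < m, used i ≠ 0 → (h = j ∨ ord i < ord h) → mt i = mt₀ i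
  le : ∀ i < m, i ≠ h → mt i ≤ r
  inj : ∀ i < m, ∀ k < m, i ≠ h → k ≠ h → mt i = mt k → mt i ≠ 0 → i = k
  surj : ∀ k < r, ∃ i < m, i ≠ h ∧ mt i = k + 1
  free : ∀ i < m, i ≠ h → mt i = 0 → v i = 0
  best : ∀ i < m, i ≠ h → mt i ≠ 0 → ∀ k < m, a (mt i - 1) i - v i ≤ a (mt i - 1) k - v k

section Finish

variable {s : ℕ} {used way : ℕ → ℕ} {dist : ℕ → ℝ} {ord : ℕ → ℕ} {j : ℕ} {v' : ℕ → ℝ}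

/-- The situation after the price update. -/
structure Priced (m r : ℕ) (a : ℕ → ℕ → ℝ) (mt : ℕ → ℕ) (s : ℕ) (used way ord : ℕ → ℕ) (j : ℕ)
    (v' : ℕ → ℝ) : Prop where
  lt : j < m
  unused : used j = 0
  nonpos : ∀ i < m, v' i ≤ 0
  hole : Hole m r a mt used ord j v' mt j
  matched : ∀ i < m, used i ≠ 0 → mt i ≠ 0
  ord_lt : ∀ i < m, used i ≠ 0 → ord i < s
  root : ∀ i < m, (i = j ∨ used i ≠ 0) → way i = 0 → ∀ k < m, a r i - v' i ≤ a r k - v' k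
  tree : ∀ i < m, (i = j ∨ used i ≠ 0) → ∀ q, way i = q + 1 → q < m ∧ used q ≠ 0 ∧
    (used i ≠ 0 → ord q < ord i) ∧ a (mt q - 1) i - v' i = a (mt q - 1) q - v' q

/-- Settled columns become cheaper by `dist j - dist i`, which is nonnegative; they are matched, so
free columns keep price zero. Afterwards row `r` has reduced cost at least `dist j` everywhere, with
equality at the root columns on the tree, and all tree arcs are tight. -/
theorem Search.priced (hP : PricedMatching m r a mt v)
    (h : Search m r a mt v s used way dist ord) (hj : j < m) (huj : used j = 0)
    (hmin : ∀ i < m, used i = 0 → dist j ≤ dist i) (hmj : mt j = 0)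
    (hv' : ∀ i < m, v' i = if used i ≠ 0 then v i + dist i - dist j else v i) :
    Priced m r a mt s used way ord j v' := by
  have hle : ∀ i < m, used i ≠ 0 → dist i ≤ dist j := fun i hi hui => h.mono i hi hui j hj huj
  have hvle : ∀ i < m, v' i ≤ v i := fun i hi => by
    rw [hv' i hi]
    split_ifs with hui
    · have := hle i hi hui
      linarith
    · exact le_rfl
  have hfree : ∀ i < m, mt i = 0 → v' i = 0 := fun i hi hm => by
    rw [hv' i hi, if_neg fun hui => h.matched i hi hui hm, hP.free i hi hm]
  have hbest : ∀ i < m, mt i ≠ 0 → ∀ k < m,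
      a (mt i - 1) i - v' i ≤ a (mt i - 1) k - v' k := by
    intro i hi hm k hk
    by_cases hui : used i ≠ 0
    · have h1 := h.le k hk i hi hui
      rw [hv' i hi, if_pos hui, hv' k hk]
      split_ifs with huk
      · linarith
      · have := hmin k hk (not_not.1 huk)
        linarith
    · rw [hv' i hi, if_neg hui]
      have h1 := hP.best i hi hm k hk
      have h2 := hvle k hk
      linarith
  refine ⟨hj, huj, fun i hi => (hvle i hi).trans (hP.nonpos i hi), ⟨hj, Or.inl rfl,
    fun _ _ _ _ => rfl, fun i hi _ => hP.le i hi, fun i hi k hk _ _ => hP.inj i hi k hk, ?_,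
    fun i hi _ => hfree i hi, fun i hi _ => hbest i hi⟩, h.matched, h.ord_lt, ?_, ?_⟩
  · intro k hk
    obtain ⟨i, hi, e⟩ := hP.surj k hk
    exact ⟨i, hi, fun e' => by rw [e', hmj] at e; omega, e⟩
  · intro i hi hij hw k hk
    have e1 : a r i - v' i = dist j := by
      have := h.root i hi hw
      rw [hv' i hi]
      rcases hij with rfl | hui
      · rw [if_neg (not_not.2 huj), this]
      · rw [if_pos hui]
        linarith
    rw [e1, hv' k hk]
    have h1 := h.le_root k hk
    split_ifs with huk
    · linarith
    · exact (hmin k hk (not_not.1 huk)).trans h1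
  · intro i hi hij q hw
    obtain ⟨t1, t2, t3, t4⟩ := h.tree i hi q hw
    refine ⟨t1, t2, t3, ?_⟩
    rw [hv' i hi, hv' q t1, if_pos t2]
    rcases hij with rfl | hui
    · rw [if_neg (not_not.2 huj)]
      linarith
    · rw [if_pos hui]
      linarith

/-- The hole column takes over the row of its predecessor `q`; by tightness that row is still in a
cheapest column. The settling order decreases along the path, so `q` still has its original row. -/
theorem Priced.hole_step (hQ : Priced m r a mt s used way ord j v') {mt' : ℕ → ℕ} {h q : ℕ}
    (hH : Hole m r a mt used ord j v' mt' h) (hw : way h = q + 1) :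
    Hole m r a mt used ord j v' (Function.update mt' h (mt' q)) q ∧ q < m ∧ used q ≠ 0 ∧ q ≠ j ∧
      (h = j ∨ ord q < ord h) := by
  obtain ⟨t1, t2, t3, t4⟩ := hQ.tree h hH.lt hH.used_or q hw
  have hqj : q ≠ j := fun e => t2 (e ▸ hQ.unused)
  have hord : h = j ∨ ord q < ord h := hH.used_or.imp_right t3
  have hqh : q ≠ h := by
    rintro rfl
    rcases hord with h1 | h1
    · exact hqj h1
    · exact lt_irrefl _ h1
  have hsame := hH.same q t1 t2 hord
  have hne : mt' q ≠ 0 := hsame ▸ hQ.matched q t1 t2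
  have hu : ∀ i, i ≠ h → Function.update mt' h (mt' q) i = mt' i :=
    fun i hi => Function.update_of_ne hi _ _
  have hs : Function.update mt' h (mt' q) h = mt' q := Function.update_self _ _ _
  refine ⟨⟨t1, Or.inr t2, ?_, ?_, ?_, ?_, ?_, ?_⟩, t1, t2, hqj, hord⟩
  · intro i hi hui hoi
    have hoq : ord i < ord q := hoi.resolve_left hqj
    have hih : i ≠ h := by
      rintro rfl
      rcases hord with h1 | h1
      · exact hui (h1 ▸ hQ.unused)
      · omega
    rw [hu i hih]
    exact hH.same i hi hui (hord.imp_right fun h1 => hoq.trans h1)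
  · intro i hi hiq
    by_cases hih : i = h
    · rw [hih, hs]
      exact hH.le q t1 hqh
    · rw [hu i hih]
      exact hH.le i hi hih
  · intro i hi k hk hiq hkq e hne'
    by_cases hih : i = h <;> by_cases hkh : k = h
    · rw [hih, hkh]
    · rw [hih, hs, hu k hkh] at e
      exact absurd (hH.inj q t1 k hk hqh hkh e hne) hkq.symm
    · rw [hkh, hs, hu i hih] at e
      exact absurd (hH.inj q t1 i hi hqh hih e.symm hne) hiq.symm
    · rw [hu i hih, hu k hkh] at e
      rw [hu i hih] at hne'
      exact hH.inj i hi k hk hih hkh e hne'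
  · intro k hk
    obtain ⟨i, hi, hih, e⟩ := hH.surj k hk
    by_cases hiq : i = q
    · exact ⟨h, hH.lt, hqh.symm, by rw [hs, ← hiq, e]⟩
    · exact ⟨i, hi, hiq, by rw [hu i hih, e]⟩
  · intro i hi hiq e
    by_cases hih : i = h
    · rw [hih, hs] at e
      exact absurd e hne
    · exact hH.free i hi hih (by rwa [hu i hih] at e)
  · intro i hi hiq e k hk
    by_cases hih : i = h
    · rw [hih, hs]
      have h1 := hH.best q t1 hqh hne k hk
      rw [hsame] at h1 ⊢
      linarith
    · rw [hu i hih] at e ⊢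
      exact hH.best i hi hih e k hk

/-- The path has reached a root, a cheapest column for the new row `r`, which fills the hole. -/
theorem Priced.finish (hQ : Priced m r a mt s used way ord j v') {mt' : ℕ → ℕ} {h : ℕ}
    (hH : Hole m r a mt used ord j v' mt' h) (hw : way h = 0) :
    PricedMatching m (r + 1) a (Function.update mt' h (r + 1)) v' := by
  have hu : ∀ i, i ≠ h → Function.update mt' h (r + 1) i = mt' i :=
    fun i hi => Function.update_of_ne hi _ _
  have hs : Function.update mt' h (r + 1) h = r + 1 := Function.update_self _ _ _
  constructor
  · intro i hi
    by_cases hih : i = h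
    · rw [hih, hs]
    · rw [hu i hih]
      exact (hH.le i hi hih).trans (Nat.le_succ r)
  · intro i hi k hk e hne
    by_cases hih : i = h <;> by_cases hkh : k = h
    · rw [hih, hkh]
    · rw [hih, hs, hu k hkh] at e
      have := hH.le k hk hkh
      omega
    · rw [hkh, hs, hu i hih] at e
      have := hH.le i hi hih
      omega
    · rw [hu i hih, hu k hkh] at e
      rw [hu i hih] at hne
      exact hH.inj i hi k hk hih hkh e hne
  · intro k hk
    rcases Nat.lt_succ_iff_lt_or_eq.1 hk with h1 | rfl
    · obtain ⟨i, hi, hih, e⟩ := hH.surj k h1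
      exact ⟨i, hi, by rw [hu i hih, e]⟩
    · exact ⟨h, hH.lt, hs⟩
  · exact hQ.nonpos
  · intro i hi e
    by_cases hih : i = h
    · rw [hih, hs] at e
      omega
    · exact hH.free i hi hih (by rwa [hu i hih] at e)
  · intro i hi e k hk
    by_cases hih : i = h
    · rw [hih, hs, Nat.add_sub_cancel]
      exact hQ.root h hH.lt hH.used_or hw k hk
    · rw [hu i hih] at e ⊢
      exact hH.best i hi hih e k hk

end Finish

end PricedMatching

namespace Instance

variable {m n p : ℕ} {I : Instance m n p}

/-! ### Feasible rankings as assignments of minimum cost -/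

/-- The penalty for having item `i` of the class `c` at a position down to `k`. -/
noncomputable def penalty (I : Instance m n p) (B : ℝ) (c : Option (Fin p)) (k : Fin n)
    (i : Fin m) : ℝ :=
  match c with
  | none => 0
  | some ℓ => (if I.rank (some ℓ) i < I.U k ℓ then 0 else B) -
      if I.rank (some ℓ) i < I.L k ℓ then B else 0

/-- The cost of placing item `i` at position `j`. -/
noncomputable def assignCost (I : Instance m n p) (B : ℝ) (j : Fin n) (i : Fin m) : ℝ :=
  (∑ k with j ≤ k, I.penalty B (I.classOf i) k i) - I.W i j

/-- The number of violations of the bounds by a ranking, counted by ranks. -/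
def violations (I : Instance m n p) (π : Fin n ↪ Fin m) : ℕ :=
  ∑ k, ∑ ℓ, (((I.topItems π (some ℓ) k).filter fun i => ¬ I.rank (some ℓ) i < I.U k ℓ).card +
    (I.L k ℓ - ((I.topItems π (some ℓ) k).filter fun i => I.rank (some ℓ) i < I.L k ℓ).card))

theorem card_filter_topItems_le (π : Fin n ↪ Fin m) (c : Option (Fin p)) (k : Fin n) (x : ℕ) :
    ((I.topItems π c k).filter fun i => I.rank c i < x).card ≤ x := by
  refine (Finset.card_le_card fun i hi => ?_).trans (card_firstItems_le (I := I) c x)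
  rw [Finset.mem_filter] at hi
  exact mem_firstItems.2 ⟨topItems_subset _ _ _ hi.1, hi.2⟩

/-- The exchange lemma turns the penalties into counts per position and property. The number of
rewarded top items is `L` minus the shortfall, whence the constant term ∑ L. -/
theorem sum_assignCost (hΔ : I.Delta = 1) (B : ℝ) (π : Fin n ↪ Fin m) :
    ∑ j, I.assignCost B j (π j) =
      -I.value π + B * (I.violations π - ((∑ k, ∑ ℓ, I.L k ℓ : ℕ) : ℝ)) := by
  simp only [assignCost, Finset.sum_sub_distrib]
  rw [← sum_sum_topItems hΔ π fun c k i => I.penalty B c k i, value, violations]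
  rw [neg_add_eq_sub]
  congr 1
  push_cast
  rw [← Finset.sum_sub_distrib, Finset.mul_sum]
  refine Finset.sum_congr rfl fun k _ => ?_
  rw [← Finset.sum_sub_distrib, Finset.mul_sum, Fintype.sum_option]
  simp only [penalty, Finset.sum_const_zero, zero_add]
  refine Finset.sum_congr rfl fun ℓ _ => ?_
  rw [Finset.sum_sub_distrib, Nat.cast_sub (card_filter_topItems_le _ _ _ _), ← Finset.sum_filter]
  have : ∑ i ∈ I.topItems π (some ℓ) k, (if I.rank (some ℓ) i < I.U k ℓ then 0 else B) =
      ((I.topItems π (some ℓ) k).filter fun i => ¬ I.rank (some ℓ) i < I.U k ℓ).card * B := by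
    rw [← nsmul_eq_mul, ← Finset.sum_const, Finset.sum_filter]
    exact Finset.sum_congr rfl fun i _ => by split_ifs <;> simp_all
  rw [this, Finset.sum_const, nsmul_eq_mul]
  ring

/-- No sorting is needed: at most `x` items of a class have rank below `x`, which bounds the count
by `U`, and the rewarded items alone already reach `L`. -/
theorem feasible_of_violations_eq_zero {π : Fin n ↪ Fin m} (h : I.violations π = 0) :
    I.Feasible π := by
  intro k ℓ
  simp only [violations, Finset.sum_eq_zero_iff, Finset.mem_univ, forall_const, Nat.add_eq_zero_iff,
    Finset.card_eq_zero, Finset.filter_eq_empty_iff, not_not] at h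
  obtain ⟨h1, h2⟩ := h k ℓ
  rw [← card_topItems]
  constructor
  · have := Finset.card_filter_le (I.topItems π (some ℓ) k) fun i => I.rank (some ℓ) i < I.L k ℓ
    omega
  · rw [← Finset.filter_true_of_mem h1]
    exact card_filter_topItems_le _ _ _ _

/-- For a sorted ranking the top ranks are exactly those below the count, so counting by ranks
agrees with counting items. -/
theorem IsSorted.violations_eq_zero (hΔ : I.Delta = 1) {cs : Fin n → Option (Fin p)}
    {σ : Fin n ↪ Fin m} (hσ : I.IsSorted cs σ) (h : I.Feasible σ) : I.violations σ = 0 := by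
  refine Finset.sum_eq_zero fun k _ => Finset.sum_eq_zero fun ℓ _ => ?_
  have hf := h k ℓ
  rw [hσ.topCount_eq hΔ] at hf
  rw [hσ.topItems_eq hΔ, Nat.add_eq_zero_iff]
  constructor
  · rw [Finset.card_eq_zero, Finset.filter_eq_empty_iff]
    intro i hi
    rw [not_not]
    exact (mem_firstItems.1 hi).2.trans_le hf.2
  · have : (I.firstItems (some ℓ) (count cs (some ℓ) k)).filter
        (fun i => I.rank (some ℓ) i < I.L k ℓ) = I.firstItems (some ℓ) (I.L k ℓ) := by
      ext i
      simp only [Finset.mem_filter, mem_firstItems]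
      constructor
      · exact fun hi => ⟨hi.1.1, hi.2⟩
      · exact fun hi => ⟨⟨hi.1, hi.2.trans_le hf.1⟩, hi.2⟩
    have hc := hσ.count_le_card hΔ (some ℓ) k
    rw [this, card_firstItems, min_eq_left (hf.1.trans hc), Nat.sub_self]

theorem exists_sorted_assignCost_le (hΔ : I.Delta = 1) (hM : I.MonotoneMonge) (B : ℝ)
    {π : Fin n ↪ Fin m} (h : I.Feasible π) : ∃ σ : Fin n ↪ Fin m,
      ∑ j, I.assignCost B j (σ j) ≤ -I.value π - B * ((∑ k, ∑ ℓ, I.L k ℓ : ℕ) : ℝ) := by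
  obtain ⟨σ, hσ⟩ := exists_isSorted_classOf hΔ π
  refine ⟨σ, ?_⟩
  have h1 := hσ.value_le hΔ hM
  rw [sum_assignCost hΔ, hσ.violations_eq_zero hΔ ((hσ.feasible_iff hΔ).2 h), Nat.cast_zero]
  linarith

/-- An assignment of minimum cost is an optimal ranking if it is feasible. -/
theorem optimal_of_minCost (hΔ : I.Delta = 1) (hM : I.MonotoneMonge) {B : ℝ} (hB : 0 ≤ B)
    {π : Fin n ↪ Fin m} (hmin : ∀ σ : Fin n ↪ Fin m,
      ∑ j, I.assignCost B j (π j) ≤ ∑ j, I.assignCost B j (σ j)) (h : I.Feasible π) :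
    I.Optimal π := by
  refine ⟨h, fun π' h' => ?_⟩
  obtain ⟨σ, hσ⟩ := exists_sorted_assignCost_le hΔ hM B h'
  have h1 := (hmin σ).trans hσ
  rw [sum_assignCost hΔ] at h1
  have h2 : 0 ≤ B * (I.violations π : ℝ) := mul_nonneg hB (Nat.cast_nonneg _)
  linarith

/-- An assignment of minimum cost is feasible if there is a feasible ranking. -/
theorem feasible_of_minCost (hΔ : I.Delta = 1) (hM : I.MonotoneMonge) {B : ℝ}
    (hB : 2 * ∑ i, ∑ j, |I.W i j| < B) {π : Fin n ↪ Fin m}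
    (hmin : ∀ σ : Fin n ↪ Fin m, ∑ j, I.assignCost B j (π j) ≤ ∑ j, I.assignCost B j (σ j))
    (h : ∃ π, I.Feasible π) : I.Feasible π := by
  obtain ⟨π', h'⟩ := h
  refine feasible_of_violations_eq_zero ?_
  by_contra hne
  obtain ⟨σ, hσ⟩ := exists_sorted_assignCost_le hΔ hM B h'
  have h1 := (hmin σ).trans hσ
  rw [sum_assignCost hΔ] at h1
  -- Violations are integral: a nonzero number costs a full `B`, more than any gain in value.
  have h2 : (1 : ℝ) ≤ I.violations π := by exact_mod_cast Nat.one_le_iff_ne_zero.2 hne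
  have h3 := (abs_le.1 (I.abs_value_le π)).2
  have h4 := (abs_le.1 (I.abs_value_le π')).1
  have h5 : 0 ≤ ∑ i, ∑ j, |I.W i j| :=
    Finset.sum_nonneg fun i _ => Finset.sum_nonneg fun j _ => abs_nonneg _
  nlinarith

end Instance

namespace Prog

/-! ### The Hungarian method as a program

The registers `0` and `1` hold the numbers of columns and rows. The real array `1` holds the cost
matrix, and the array `6` the offsets of the columns in it. The array `7` holds the matching, the
real array `3` the prices, and the array `8`, `9` and the real array `4` the predecessors, the
marks and the distances of the shortest path computation from the row in register `12`. -/

/-- The reduced cost of column `i` in row `k`. -/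
def reducedCost (k i : NExpr) : RExpr :=
  .sub (.get 1 (.add (.get 6 i) k)) (.get 3 i)

/-- Initialize the distances. -/
def initSearch : Prog :=
  forLoop 4 0 (.seq (.putR 4 (.reg 4) (reducedCost (.reg 12) (.reg 4)))
    (.seq (.putN 8 (.reg 4) (.const 0)) (.putN 9 (.reg 4) (.const 0))))

/-- Store in register `14` the successor of an unmarked column at minimum distance. -/
def selectMin : Prog :=
  .seq (.setN 14 (.const 0))
    (forLoop 4 0 (.cond (.nlt (.const 0) (.get 9 (.reg 4))) .skip
      (.cond (.conj (.nlt (.const 0) (.reg 14))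
        (.neg (.rlt (.get 4 (.reg 4)) (.get 4 (.sub (.reg 14) (.const 1)))))) .skip
        (.setN 14 (.add (.reg 4) (.const 1))))))

/-- Update the distance of the column in register `4` over the row in register `16`. -/
def relaxColumn : Prog :=
  .cond (.nlt (.const 0) (.get 9 (.reg 4))) .skip
    (.seq (.setR 3 (.add (.reg 2) (reducedCost (.reg 16) (.reg 4))))
      (.cond (.rlt (.reg 3) (.get 4 (.reg 4)))
        (.seq (.putR 4 (.reg 4) (.reg 3)) (.putN 8 (.reg 4) (.add (.reg 15) (.const 1)))) .skip))

/-- Mark the column in register `15`. -/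
def settle : Prog :=
  .seq (.putN 9 (.reg 15) (.const 1))
    (.seq (.setN 16 (.sub (.get 7 (.reg 15)) (.const 1)))
      (.setR 2 (.sub (.get 4 (.reg 15)) (reducedCost (.reg 16) (.reg 15)))))

/-- Mark the column in register `15` and update the distances over the row matched to it. -/
def relax : Prog := .seq settle (forLoop 4 0 relaxColumn)

/-- Find a free column at minimum distance. -/
def search : Prog :=
  .seq (.setN 13 (.const 0))
    (.loop (.nlt (.reg 13) (.const 1))
      (.seq selectMin
        (.seq (.setN 15 (.sub (.reg 14) (.const 1)))
          (.cond (.nlt (.const 0) (.get 7 (.reg 15))) relax (.setN 13 (.const 1))))))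

/-- Update the prices. -/
def updatePrices : Prog :=
  .seq (.setR 2 (.get 4 (.reg 15)))
    (forLoop 4 0 (.cond (.nlt (.const 0) (.get 9 (.reg 4)))
      (.putR 3 (.reg 4) (.sub (.add (.get 3 (.reg 4)) (.get 4 (.reg 4))) (.reg 2))) .skip))

/-- Augment the matching along the path to the column in register `15`. -/
def augment : Prog :=
  .seq (.loop (.nlt (.const 0) (.get 8 (.reg 15)))
      (.seq (.setN 16 (.sub (.get 8 (.reg 15)) (.const 1)))
        (.seq (.putN 7 (.reg 15) (.get 7 (.reg 16))) (.setN 15 (.reg 16)))))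
    (.putN 7 (.reg 15) (.add (.reg 12) (.const 1)))

/-- Match one more row. -/
def matchRow : Prog :=
  .seq initSearch (.seq search (.seq updatePrices augment))

/-- Match all rows. -/
def hungarian : Prog := forLoop 12 1 matchRow

theorem initSearch_ends (σ : State) :
    initSearch.Ends σ (σ.nreg 0 * 30 + 6) fun τ => ∀ i < σ.nreg 0,
      τ.rarr 4 i = σ.rarr 1 (σ.narr 6 i + σ.nreg 12) - σ.rarr 3 i ∧ τ.narr 8 i = 0 ∧
        τ.narr 9 i = 0 := by
  refine Ends.mono (Ends.forLoop (B := 22) (fun j τ => ∀ i < j,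
      τ.rarr 4 i = σ.rarr 1 (σ.narr 6 i + σ.nreg 12) - σ.rarr 3 i ∧ τ.narr 8 i = 0 ∧
        τ.narr 9 i = 0) (by decide) (by decide) (by decide) (fun _ _ _ h => h) (by simp) ?_)
    le_rfl fun _ _ h => h
  intro j τ hj hx hF hI
  refine ends_of_exec rfl (by decide) fun i hi => ?_
  have e1 : τ.rarr 1 = σ.rarr 1 := hF.rarr 1 (by decide)
  have e2 : τ.rarr 3 = σ.rarr 3 := hF.rarr 3 (by decide)
  have e3 : τ.narr 6 = σ.narr 6 := hF.narr 6 (by decide)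
  have e4 : τ.nreg 12 = σ.nreg 12 := hF.nreg 12 (by decide)
  rcases Nat.lt_succ_iff_lt_or_eq.1 hi with h | rfl
  · have h1 := hI i h
    have hne : i ≠ j := h.ne
    simp [exec, NExpr.eval, RExpr.eval, reducedCost, hx, hne, h1]
  · simp [exec, NExpr.eval, RExpr.eval, reducedCost, hx, e1, e2, e3, e4]

theorem selectMin_ends {σ : State} (h : ∃ i < σ.nreg 0, σ.narr 9 i = 0) :
    selectMin.Ends σ (σ.nreg 0 * 40 + 8) fun τ => ∃ j < σ.nreg 0, τ.nreg 14 = j + 1 ∧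
      σ.narr 9 j = 0 ∧ ∀ i < σ.nreg 0, σ.narr 9 i = 0 → σ.rarr 4 j ≤ σ.rarr 4 i := by
  refine Ends.mono (Ends.exec_seq rfl (Ends.forLoop (B := 32) (fun j τ =>
      (τ.nreg 14 = 0 ∧ ∀ i < j, σ.narr 9 i ≠ 0) ∨ ∃ q < j, τ.nreg 14 = q + 1 ∧ σ.narr 9 q = 0 ∧
        ∀ i < j, σ.narr 9 i = 0 → σ.rarr 4 q ≤ σ.rarr 4 i)
      (by decide) (by decide) (by decide) (fun _ _ _ h => by simpa using h) ?_ ?_)) ?_ ?_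
  · left
    simp [exec, NExpr.eval]
  · intro j τ hj hx hF hI
    have e1 : τ.rarr 4 = σ.rarr 4 := hF.rarr 4 (by decide)
    have e2 : τ.narr 9 = σ.narr 9 := hF.narr 9 (by decide)
    refine ends_of_exec rfl (by decide) ?_
    simp only [exec, Cond.Holds, NExpr.eval, RExpr.eval, hx, e1, e2]
    by_cases hu : 0 < σ.narr 9 j
    · rw [if_pos hu]
      rcases hI with ⟨h1, h2⟩ | ⟨q, hq, h1, h2, h3⟩
      · refine Or.inl ⟨h1, fun i hi => ?_⟩
        rcases Nat.lt_succ_iff_lt_or_eq.1 hi with h | rfl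
        · exact h2 i h
        · omega
      · refine Or.inr ⟨q, by omega, h1, h2, fun i hi hui => ?_⟩
        rcases Nat.lt_succ_iff_lt_or_eq.1 hi with h | rfl
        · exact h3 i h hui
        · omega
    · rw [if_neg hu]
      have hu0 : σ.narr 9 j = 0 := by omega
      split_ifs with hc
      · rcases hI with ⟨h1, h2⟩ | ⟨q, hq, h1, h2, h3⟩
        · omega
        · refine Or.inr ⟨q, by omega, h1, h2, fun i hi hui => ?_⟩
          rcases Nat.lt_succ_iff_lt_or_eq.1 hi with h | rfl
          · exact h3 i h hui
          · have := hc.2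
            rw [h1, Nat.add_sub_cancel] at this
            exact not_lt.1 this
      · refine Or.inr ⟨j, by omega, by simp, hu0, fun i hi hui => ?_⟩
        rcases Nat.lt_succ_iff_lt_or_eq.1 hi with h | rfl
        · rcases hI with ⟨h1, h2⟩ | ⟨q, hq, h1, h2, h3⟩
          · exact absurd hui (h2 i h)
          · rw [h1, Nat.add_sub_cancel] at hc
            have : σ.rarr 4 j < σ.rarr 4 q := by
              by_contra hcc
              exact hc ⟨by omega, hcc⟩
            exact this.le.trans (h3 i h hui)
        · exact le_rfl
  · simp [exec, bound, NExpr.size]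
    omega
  · intro τ _ hQ
    have e0 : (exec (.setN 14 (.const 0)) σ).nreg 0 = σ.nreg 0 := by simp [exec]
    rw [e0] at hQ
    rcases hQ with ⟨-, h2⟩ | h2
    · obtain ⟨i, hi, h0⟩ := h
      exact absurd h0 (h2 i hi)
    · exact h2

/-- Here `d` is the label of the settled column minus its reduced cost, prepared by `settle`, so
that a candidate label costs constant time. -/
theorem relaxRow_ends {σ : State} {j k : ℕ} {d : ℝ} (hj : σ.nreg 15 = j) (hk : σ.nreg 16 = k)
    (hd : σ.rreg 2 = d) :
    (forLoop 4 0 relaxColumn).Ends σ (σ.nreg 0 * 50 + 6) fun τ => ∀ i < σ.nreg 0,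
      (τ.narr 8 i = σ.narr 8 i ∧ τ.rarr 4 i = σ.rarr 4 i ∧
        (σ.narr 9 i ≠ 0 ∨ σ.rarr 4 i ≤ d + (σ.rarr 1 (σ.narr 6 i + k) - σ.rarr 3 i))) ∨
      (τ.narr 8 i = j + 1 ∧ τ.rarr 4 i = d + (σ.rarr 1 (σ.narr 6 i + k) - σ.rarr 3 i) ∧
        σ.narr 9 i = 0 ∧ τ.rarr 4 i ≤ σ.rarr 4 i) := by
  refine Ends.mono (Ends.forLoop (B := 42) (fun q τ => ∀ i,
      (i < q → (τ.narr 8 i = σ.narr 8 i ∧ τ.rarr 4 i = σ.rarr 4 i ∧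
        (σ.narr 9 i ≠ 0 ∨ σ.rarr 4 i ≤ d + (σ.rarr 1 (σ.narr 6 i + k) - σ.rarr 3 i))) ∨
      (τ.narr 8 i = j + 1 ∧ τ.rarr 4 i = d + (σ.rarr 1 (σ.narr 6 i + k) - σ.rarr 3 i) ∧
        σ.narr 9 i = 0 ∧ τ.rarr 4 i ≤ σ.rarr 4 i)) ∧
      (q ≤ i → τ.narr 8 i = σ.narr 8 i ∧ τ.rarr 4 i = σ.rarr 4 i))
      (by decide) (by decide) (by decide) (fun _ _ _ h => h) ?_ ?_) le_rfl
      fun τ _ hQ i hi => (hQ i).1 hi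
  · exact fun i => ⟨fun h => absurd h (Nat.not_lt_zero _), fun _ => ⟨rfl, rfl⟩⟩
  · intro q τ hq hx hF hI
    have b1 : τ.nreg 15 = j := (hF.nreg 15 (by decide)).trans hj
    have b2 : τ.nreg 16 = k := (hF.nreg 16 (by decide)).trans hk
    have b3 := (hF.rreg 2 (by decide)).trans hd
    have b4 := hF.narr 9 (by decide)
    have b5 := hF.rarr 1 (by decide)
    have b6 := hF.rarr 3 (by decide)
    have b7 := hF.narr 6 (by decide)
    have b8 := (hI q).2 le_rfl
    refine ends_of_exec rfl (by decide) fun i => ?_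
    by_cases hiq : i = q
    · subst hiq
      refine ⟨fun _ => ?_, fun h => absurd h (by omega)⟩
      simp only [relaxColumn, exec, Cond.Holds, NExpr.eval, RExpr.eval, reducedCost, hx, b1, b2, b3,
        b4, b5, b6, b7]
      by_cases hu : 0 < σ.narr 9 i
      · rw [if_pos hu]
        exact Or.inl ⟨b8.1, b8.2, Or.inl hu.ne'⟩
      · rw [if_neg hu]
        simp only [Function.update_self, b8.2]
        split_ifs with hc
        · exact Or.inr ⟨by simp, by simp, by omega, by simpa using hc.le⟩
        · exact Or.inl ⟨b8.1, b8.2, Or.inr (not_lt.1 hc)⟩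
    · have c : (exec relaxColumn τ).narr 8 i = τ.narr 8 i ∧
          (exec relaxColumn τ).rarr 4 i = τ.rarr 4 i := by
        simp only [relaxColumn, exec, Cond.Holds, NExpr.eval, RExpr.eval, hx]
        split_ifs <;> simp [hiq]
      rw [c.1, c.2]
      exact ⟨fun h => (hI i).1 (by omega), fun h => (hI i).2 (by omega)⟩

/-- The two alternatives are in the form that `Search.step` takes as `hnew`. -/
theorem relax_ends {σ : State} {j : ℕ} (hj : σ.nreg 15 = j) :
    relax.Ends σ (σ.nreg 0 * 50 + 40) fun τ =>
      τ.narr 9 = Function.update (σ.narr 9) j 1 ∧ ∀ i < σ.nreg 0,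
      (τ.narr 8 i = σ.narr 8 i ∧ τ.rarr 4 i = σ.rarr 4 i ∧ ((σ.narr 9 i ≠ 0 ∨ i = j) ∨
        σ.rarr 4 i ≤ σ.rarr 4 j + (σ.rarr 1 (σ.narr 6 i + (σ.narr 7 j - 1)) - σ.rarr 3 i) -
          (σ.rarr 1 (σ.narr 6 j + (σ.narr 7 j - 1)) - σ.rarr 3 j))) ∨
      (τ.narr 8 i = j + 1 ∧ τ.rarr 4 i =
          σ.rarr 4 j + (σ.rarr 1 (σ.narr 6 i + (σ.narr 7 j - 1)) - σ.rarr 3 i) -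
          (σ.rarr 1 (σ.narr 6 j + (σ.narr 7 j - 1)) - σ.rarr 3 j) ∧
        σ.narr 9 i = 0 ∧ i ≠ j ∧ τ.rarr 4 i ≤ σ.rarr 4 i) := by
  set σ₁ := settle.exec σ with hσ₁
  have a1 : σ₁.nreg 0 = σ.nreg 0 := by simp [hσ₁, settle, exec]
  have a2 : σ₁.nreg 15 = j := by simp [hσ₁, settle, exec, hj]
  have a3 : σ₁.nreg 16 = σ.narr 7 j - 1 := by simp [hσ₁, settle, exec, NExpr.eval, hj]
  have a4 : σ₁.rreg 2 = σ.rarr 4 j - (σ.rarr 1 (σ.narr 6 j + (σ.narr 7 j - 1)) - σ.rarr 3 j) := by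
    simp [hσ₁, settle, exec, NExpr.eval, RExpr.eval, reducedCost, hj]
  have a5 : σ₁.narr 9 = Function.update (σ.narr 9) j 1 := by
    simp [hσ₁, settle, exec, NExpr.eval, hj]
  have a6 : σ₁.narr 8 = σ.narr 8 := by simp [hσ₁, settle, exec]
  have a7 : σ₁.rarr = σ.rarr := by simp [hσ₁, settle, exec]
  have a8 : σ₁.narr 6 = σ.narr 6 := by simp [hσ₁, settle, exec]
  refine Ends.mono (Ends.exec_seq rfl ((relaxRow_ends a2 a3 a4).mono le_rfl
    (Q' := fun τ => τ.narr 9 = Function.update (σ.narr 9) j 1 ∧ ∀ i < σ.nreg 0, _) ?_)) ?_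
    fun τ _ hQ => hQ
  · rw [a1, a5, a6, a7, a8]
    intro τ hF hQ
    refine ⟨(hF.narr 9 (by decide)).trans a5, fun i hi => ?_⟩
    have hu : Function.update (σ.narr 9) j 1 i ≠ 0 ↔ σ.narr 9 i ≠ 0 ∨ i = j := by
      by_cases hij : i = j <;> simp [hij]
    rcases hQ i hi with ⟨h1, h2, h3⟩ | ⟨h1, h2, h3, h4⟩
    · refine Or.inl ⟨h1, h2, h3.imp hu.1 fun h => ?_⟩
      linarith
    · have h5 : ¬ (σ.narr 9 i ≠ 0 ∨ i = j) := fun h => hu.2 h h3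
      rw [not_or, not_not] at h5
      refine Or.inr ⟨h1, ?_, h5.1, h5.2, h4⟩
      linarith
  · rw [a1]
    have : settle.bound ≤ 34 := by decide
    omega

/-- The part of the memory that describes the assignment problem. -/
structure Costs (m n : ℕ) (a : ℕ → ℕ → ℝ) (σ : State) : Prop where
  cols : σ.nreg 0 = m
  rows : σ.nreg 1 = n
  cost : ∀ i < m, ∀ k < n, σ.rarr 1 (σ.narr 6 i + k) = a k i

theorem Costs.of_frame {m n : ℕ} {a : ℕ → ℕ → ℝ} {σ τ : State} {s : Prog} (h : Costs m n a σ)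
    (hF : s.Frame σ τ) (hs : 0 ∉ s.nregs ∧ 1 ∉ s.nregs ∧ 1 ∉ s.rarrs ∧ 6 ∉ s.narrs) :
    Costs m n a τ :=
  ⟨(hF.nreg 0 hs.1).trans h.cols, (hF.nreg 1 hs.2.1).trans h.rows, by
    rw [hF.rarr 1 hs.2.2.1, hF.narr 6 hs.2.2.2]
    exact h.cost⟩

open PricedMatching

/-- A free column at minimum distance has been found. -/
def Found (m r : ℕ) (a : ℕ → ℕ → ℝ) (τ : State) (j : ℕ) : Prop :=
  (∃ s ord, Search m r a (τ.narr 7) (τ.rarr 3) s (τ.narr 9) (τ.narr 8) (τ.rarr 4) ord) ∧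
    j < m ∧ τ.nreg 15 = j ∧ τ.narr 9 j = 0 ∧ τ.narr 7 j = 0 ∧
    ∀ i < m, τ.narr 9 i = 0 → τ.rarr 4 j ≤ τ.rarr 4 i

/-- Every round that does not end the search settles one more column, and at most r < n columns can
be settled; a round is linear in `m`. -/
theorem search_ends {m n r : ℕ} {a : ℕ → ℕ → ℝ} {σ : State} {ord : ℕ → ℕ} (hC : Costs m n a σ)
    (hP : PricedMatching m r a (σ.narr 7) (σ.rarr 3)) (hrm : r < m) (hrn : r < n)
    (hS : Search m r a (σ.narr 7) (σ.rarr 3) 0 (σ.narr 9) (σ.narr 8) (σ.rarr 4) ord) :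
    search.Ends σ (n * (m * 90 + 70) + 10) fun τ => ∃ j, Found m r a τ j := by
  refine Ends.mono (Ends.exec_seq rfl (Ends.loop (B := m * 90 + 60) (N := n) (fun s τ =>
    (τ.nreg 13 = 0 ∧ ∃ ord,
      Search m r a (σ.narr 7) (σ.rarr 3) s (τ.narr 9) (τ.narr 8) (τ.rarr 4) ord) ∨
    (τ.nreg 13 = 1 ∧ ∃ j, Found m r a τ j)) ?_ ?_)) ?_ ?_
  · exact Or.inl ⟨by simp [exec, NExpr.eval], ord, hS⟩
  · intro s τ hF hI hb
    simp only [Cond.Holds, NExpr.eval, Nat.lt_one_iff] at hb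
    rcases hI with ⟨-, ord, hI⟩ | ⟨hI, -⟩
    swap
    · omega
    have hF' : search.Frame σ τ :=
      (frame_of_run (Run.setN σ 13 (.const 0))).trans hF fun z => by
        simp [search, nregs, rregs, narrs, rarrs]
    have e7 : τ.narr 7 = σ.narr 7 := hF'.narr 7 (by decide)
    have e3 : τ.rarr 3 = σ.rarr 3 := hF'.rarr 3 (by decide)
    have hC' : Costs m n a τ := hC.of_frame hF' (by decide)
    have hsr := hI.settled_le hP
    refine ⟨by omega, ?_⟩
    obtain ⟨i₀, hi₀, hu₀⟩ := hI.exists_unused hP hrm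
    refine Ends.mono (Ends.seq (selectMin_ends ⟨i₀, by rwa [hC'.cols], hu₀⟩)
      (T₂ := m * 50 + 52) fun υ hFυ hυ => ?_) (by rw [hC'.cols]; omega) fun _ _ h => h
    obtain ⟨j, hj, h14, hju, hjmin⟩ := hυ
    rw [hC'.cols] at hj hjmin
    have f9 : υ.narr 9 = τ.narr 9 := hFυ.narr 9 (by decide)
    have f8 : υ.narr 8 = τ.narr 8 := hFυ.narr 8 (by decide)
    have f4 : υ.rarr 4 = τ.rarr 4 := hFυ.rarr 4 (by decide)
    have f7 : υ.narr 7 = σ.narr 7 := (hFυ.narr 7 (by decide)).trans e7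
    have f3 : υ.rarr 3 = σ.rarr 3 := (hFυ.rarr 3 (by decide)).trans e3
    have f13 : υ.nreg 13 = 0 := (hFυ.nreg 13 (by decide)).trans hb
    have hCυ : Costs m n a υ := hC'.of_frame hFυ (by decide)
    set υ' := exec (.setN 15 (.sub (.reg 14) (.const 1))) υ with hυ'
    have g15 : υ'.nreg 15 = j := by simp [hυ', exec, NExpr.eval, h14]
    have gn : υ'.narr = υ.narr := rfl
    have gr : υ'.rarr = υ.rarr := rfl
    have g13 : υ'.nreg 13 = 0 := by simp [hυ', exec, f13]
    have g0 : υ'.nreg 0 = m := by simp [hυ', exec, hCυ.cols]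
    refine Ends.mono (Ends.exec_seq (T := m * 50 + 46) rfl (Ends.mono (Ends.cond (T := m * 50 + 40)
      (fun hc => ?_) fun hc => ?_) (by simp [Cond.size, NExpr.size]; omega) fun _ _ h => h))
      (by simp [bound, NExpr.size]; omega) fun _ _ h => h
    · simp only [Cond.Holds, NExpr.eval] at hc
      rw [← hυ', g15, gn, f7] at hc
      refine (relax_ends g15).mono (by rw [g0]) fun ω hFω hω => ?_
      obtain ⟨w9, hω⟩ := hω
      rw [g0, gn, gr, f7, f3, f4, f8, f9] at hω
      rw [gn, f9] at w9
      refine Or.inl ⟨(hFω.nreg 13 (by decide)).trans g13, Function.update ord j s, ?_⟩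
      rw [w9]
      refine hI.step hP hj hju hjmin hc.ne' fun i hi => ?_
      have hk : σ.narr 7 j - 1 < n := by
        have := hP.le j hj
        omega
      have := hω i hi
      rwa [hCυ.cost i hi _ hk, hCυ.cost j hj _ hk] at this
    · simp only [Cond.Holds, NExpr.eval] at hc
      rw [← hυ', g15, gn, f7, not_lt, Nat.le_zero] at hc
      refine ends_of_exec rfl (by simp [bound, NExpr.size]) (Or.inr ⟨by simp [exec, NExpr.eval], j,
        ⟨s, ord, ?_⟩, hj, ?_, ?_, ?_, ?_⟩)
      · change Search m r a (υ.narr 7) (υ.rarr 3) s (υ.narr 9) (υ.narr 8) (υ.rarr 4) ord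
        rwa [f7, f3, f9, f8, f4]
      · exact g15
      · change υ.narr 9 j = 0
        rwa [f9]
      · change υ.narr 7 j = 0
        rwa [f7]
      · change ∀ i < m, υ.narr 9 i = 0 → υ.rarr 4 j ≤ υ.rarr 4 i
        rwa [f9, f4]
  · simp only [bound, NExpr.size, Cond.size]
    ring_nf
    omega
  · rintro τ _ ⟨s, -, hI, hb⟩
    simp only [Cond.Holds, NExpr.eval] at hb
    rcases hI with ⟨h, -⟩ | ⟨-, h⟩
    · omega
    · exact h

theorem updatePrices_ends {σ : State} {j : ℕ} (hj : σ.nreg 15 = j) :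
    updatePrices.Ends σ (σ.nreg 0 * 30 + 10) fun τ => ∀ i < σ.nreg 0, τ.rarr 3 i =
      if σ.narr 9 i ≠ 0 then σ.rarr 3 i + σ.rarr 4 i - σ.rarr 4 j else σ.rarr 3 i := by
  set σ₁ := exec (.setR 2 (.get 4 (.reg 15))) σ with hσ₁
  refine Ends.mono (Ends.exec_seq rfl (Ends.forLoop (B := 20) (fun q τ => ∀ i,
      (i < q → τ.rarr 3 i =
        if σ.narr 9 i ≠ 0 then σ.rarr 3 i + σ.rarr 4 i - σ.rarr 4 j else σ.rarr 3 i) ∧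
      (q ≤ i → τ.rarr 3 i = σ.rarr 3 i))
      (by decide) (by decide) (by decide) (fun _ _ _ h => h) ?_ ?_)) ?_
      fun τ _ hQ i hi => (hQ i).1 hi
  · exact fun i => ⟨fun h => absurd h (Nat.not_lt_zero _), fun _ => rfl⟩
  · intro q τ hq hx hF hI
    have b1 : τ.rreg 2 = σ.rarr 4 j := (hF.rreg 2 (by decide)).trans (by
      simp [exec, RExpr.eval, NExpr.eval, hj])
    have b2 : τ.narr 9 = σ.narr 9 := hF.narr 9 (by decide)
    have b3 : τ.rarr 4 = σ.rarr 4 := hF.rarr 4 (by decide)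
    refine ends_of_exec rfl (by decide) fun i => ?_
    simp only [exec, Cond.Holds, NExpr.eval, RExpr.eval, hx, b1, b2, b3]
    by_cases hiq : i = q
    · subst hiq
      refine ⟨fun _ => ?_, fun h => absurd h (by omega)⟩
      have b4 := (hI i).2 le_rfl
      by_cases hu : 0 < σ.narr 9 i
      · rw [if_pos hu, if_pos hu.ne']
        simp [b4]
      · rw [if_neg hu, if_neg (by omega), b4]
    · have c : (if 0 < σ.narr 9 q then
          { τ with rarr := Function.update τ.rarr 3 (Function.update (τ.rarr 3) q
            (τ.rarr 3 q + σ.rarr 4 q - σ.rarr 4 j)) } else τ).rarr 3 i = τ.rarr 3 i := by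
        split_ifs
        · simp [hiq]
        · rfl
      rw [c]
      exact ⟨fun h => (hI i).1 (by omega), fun h => (hI i).2 (by omega)⟩
  · have : (exec (.setR 2 (.get 4 (.reg 15))) σ).nreg 0 = σ.nreg 0 := rfl
    rw [this]
    simp [bound, RExpr.size, NExpr.size]
    omega

/-- The number of rounds plus the settling order of the hole never exceeds `s`; this bounds the
length of the path. -/
theorem augment_ends {m n r s j : ℕ} {a : ℕ → ℕ → ℝ} {σ : State} {ord : ℕ → ℕ}
    (hj : σ.nreg 15 = j) (hr : σ.nreg 12 = r) (hrn : r < n) (hsr : s ≤ r)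
    (hQ : Priced m r a (σ.narr 7) s (σ.narr 9) (σ.narr 8) ord j (σ.rarr 3)) :
    augment.Ends σ (n * 30 + 20) fun τ => PricedMatching m (r + 1) a (τ.narr 7) (τ.rarr 3) := by
  refine Ends.mono (Ends.seq (Ends.loop (B := 20) (N := n) (fun c τ =>
    Hole m r a (σ.narr 7) (σ.narr 9) ord j (σ.rarr 3) (τ.narr 7) (τ.nreg 15) ∧
      ((c = 0 ∧ τ.nreg 15 = j) ∨ (τ.nreg 15 ≠ j ∧ σ.narr 9 (τ.nreg 15) ≠ 0 ∧
        c + ord (τ.nreg 15) ≤ s))) ?_ ?_) (T₂ := 6) fun τ hF hτ => ?_) ?_ fun _ _ h => h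
  · rw [hj]
    exact ⟨hQ.hole, Or.inl ⟨rfl, rfl⟩⟩
  · rintro c τ hF ⟨hH, hc⟩ hb
    have e8 : τ.narr 8 = σ.narr 8 := hF.narr 8 (by decide)
    simp only [Cond.Holds, NExpr.eval, e8] at hb
    refine ⟨by omega, ends_of_exec rfl (by decide) ?_⟩
    obtain ⟨q, hq⟩ : ∃ q, σ.narr 8 (τ.nreg 15) = q + 1 := ⟨_, (Nat.succ_pred_eq_of_pos hb).symm⟩
    obtain ⟨h1, h2, h3, h4, h5⟩ := hQ.hole_step hH hq
    simp only [exec, NExpr.eval, e8, Function.update_self, hq, Nat.add_sub_cancel]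
    have : (15 : ℕ) ≠ 16 := by decide
    rw [Function.update_of_ne this]
    refine ⟨h1, Or.inr ⟨h4, h3, ?_⟩⟩
    have h6 := hQ.ord_lt q h2 h3
    rcases hc with ⟨rfl, hc⟩ | ⟨hc1, hc2, hc3⟩
    · omega
    · have := h5.resolve_left hc1
      omega
  · obtain ⟨c, -, ⟨hH, -⟩, hb⟩ := hτ
    have e8 : τ.narr 8 = σ.narr 8 := hF.narr 8 (by decide)
    have e3 : τ.rarr 3 = σ.rarr 3 := hF.rarr 3 (by decide)
    have e12 : τ.nreg 12 = r := (hF.nreg 12 (by decide)).trans hr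
    simp only [Cond.Holds, NExpr.eval, e8, not_lt, Nat.le_zero] at hb
    refine ends_of_exec rfl (by decide) ?_
    simp only [exec, NExpr.eval, Function.update_self, e12, e3]
    exact hQ.finish hH hb
  · simp only [Cond.size, NExpr.size]
    omega

theorem matchRow_ends {m n r : ℕ} {a : ℕ → ℕ → ℝ} {σ : State} (hC : Costs m n a σ)
    (hP : PricedMatching m r a (σ.narr 7) (σ.rarr 3)) (hr : σ.nreg 12 = r) (hrm : r < m)
    (hrn : r < n) :
    matchRow.Ends σ (n * (m * 90 + 100) + m * 60 + 50) fun τ =>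
      PricedMatching m (r + 1) a (τ.narr 7) (τ.rarr 3) := by
  refine Ends.mono (Ends.seq (initSearch_ends σ) (T₂ := n * (m * 90 + 70) + 10 +
    (m * 30 + 10 + (n * 30 + 20))) fun τ hF hτ => ?_) ?_ fun _ _ h => h
  · have hCτ : Costs m n a τ := hC.of_frame hF (by decide)
    have e7 : τ.narr 7 = σ.narr 7 := hF.narr 7 (by decide)
    have e3 : τ.rarr 3 = σ.rarr 3 := hF.rarr 3 (by decide)
    have e12 : τ.nreg 12 = r := (hF.nreg 12 (by decide)).trans hr
    rw [hC.cols, hr] at hτ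
    have hPτ : PricedMatching m r a (τ.narr 7) (τ.rarr 3) := by rwa [e7, e3]
    have hS : Search m r a (τ.narr 7) (τ.rarr 3) 0 (τ.narr 9) (τ.narr 8) (τ.rarr 4) fun _ => 0 :=
      Search.init (fun i hi => by rw [(hτ i hi).1, hC.cost i hi r hrn, e3])
        (fun i hi => (hτ i hi).2.2) (fun i hi => (hτ i hi).2.1) _
    refine Ends.seq (search_ends hCτ hPτ hrm hrn hS) fun υ hFυ hυ => ?_
    obtain ⟨j, ⟨s, ord, hSυ⟩, hj, h15, hju, hjm, hmin⟩ := hυ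
    have hCυ : Costs m n a υ := hCτ.of_frame hFυ (by decide)
    have f7 : υ.narr 7 = τ.narr 7 := hFυ.narr 7 (by decide)
    have f3 : υ.rarr 3 = τ.rarr 3 := hFυ.rarr 3 (by decide)
    have f12 : υ.nreg 12 = r := (hFυ.nreg 12 (by decide)).trans e12
    have hPυ : PricedMatching m r a (υ.narr 7) (υ.rarr 3) := by rwa [f7, f3]
    refine Ends.seq ((updatePrices_ends h15).mono (by rw [hCυ.cols]) fun _ _ h => h)
      fun ω hFω hω => ?_
    rw [hCυ.cols] at hω
    have g7 : ω.narr 7 = υ.narr 7 := hFω.narr 7 (by decide)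
    have g8 : ω.narr 8 = υ.narr 8 := hFω.narr 8 (by decide)
    have g9 : ω.narr 9 = υ.narr 9 := hFω.narr 9 (by decide)
    have g12 : ω.nreg 12 = r := (hFω.nreg 12 (by decide)).trans f12
    have g15 : ω.nreg 15 = j := (hFω.nreg 15 (by decide)).trans h15
    refine augment_ends g15 g12 hrn (hSυ.settled_le hPυ) (ord := ord) ?_
    rw [g7, g8, g9]
    exact hSυ.priced hPυ hj hju hmin hjm hω
  · rw [hC.cols]
    ring_nf
    omega

theorem hungarian_ends {m n : ℕ} {a : ℕ → ℕ → ℝ} {σ : State} (hC : Costs m n a σ)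
    (hnm : n ≤ m) (h7 : σ.narr 7 = fun _ => 0) (h3 : σ.rarr 3 = fun _ => 0) :
    hungarian.Ends σ (n * (n * (m * 90 + 100) + m * 60 + 58) + 6) fun τ =>
      PricedMatching m n a (τ.narr 7) (τ.rarr 3) := by
  have := Ends.forLoop (x := 12) (y := 1) (s := matchRow) (B := n * (m * 90 + 100) + m * 60 + 50)
    (σ := σ) (fun r τ => PricedMatching m r a (τ.narr 7) (τ.rarr 3)) (by decide) (by decide)
    (by decide) (fun _ _ _ h => h) (by rw [h7, h3]; exact PricedMatching.zero m a)
    fun r τ hr hx hF hI => by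
      rw [hC.rows] at hr
      exact matchRow_ends (hC.of_frame hF (by decide)) hI hx (by omega) hr
  rw [hC.rows] at this
  exact this

end Prog

namespace Prog

/-! ### Building the cost matrix -/

/-- Store the successor of the property of every item in the array `4`. -/
def readClasses : Prog :=
  forLoop 4 3 (.putN 4 (.get 2 (.reg 4)) (.add (.get 3 (.reg 4)) (.const 1)))

/-- Add twice the absolute value of an entry of the weight matrix. -/
def addEntry : Prog :=
  .seq (.cond (.rlt (.get 0 (.reg 6)) .zero)
      (.setR 0 (.sub (.sub (.reg 0) (.get 0 (.reg 6))) (.get 0 (.reg 6))))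
      (.setR 0 (.add (.add (.reg 0) (.get 0 (.reg 6))) (.get 0 (.reg 6)))))
    (.setN 6 (.add (.reg 6) (.const 1)))

/-- Store a large number in the real register `0`. -/
def largeNumber : Prog :=
  .seq (.seq (.setR 0 .one) (.setN 6 (.const 0))) (forLoop 4 0 (forLoop 5 1 addEntry))

/-- Store the size of the matrices of bounds in register `7`. -/
def boundsSize : Prog :=
  .seq (.setN 7 (.const 0)) (forLoop 5 1 (.setN 7 (.add (.reg 7) (.reg 2))))

/-- Add the penalty for exceeding the upper bound. -/
def addUpper : Prog :=
  .cond (.nlt (.reg 9) (.get 1 (.sub (.reg 11) (.const 1)))) .skip (.setR 1 (.add (.reg 1) (.reg 0)))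

/-- Subtract the reward for serving the lower bound. -/
def subLower : Prog :=
  .cond (.nlt (.reg 9) (.get 0 (.sub (.reg 11) (.const 1)))) (.setR 1 (.sub (.reg 1) (.reg 0))) .skip

/-- Add the penalty at one position. -/
def addPenalty : Prog :=
  .cond (.nlt (.const 0) (.reg 8)) (.seq addUpper subLower) .skip

/-- Compute one entry of the cost matrix. -/
def costEntry : Prog :=
  .seq (.seq (.setN 10 (.sub (.reg 10) (.const 1))) (.setN 11 (.sub (.reg 11) (.reg 2))))
    (.seq addPenalty (.putR 1 (.reg 10) (.sub (.reg 1) (.get 0 (.reg 10)))))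

/-- Prepare the computation of a column of the cost matrix. -/
def startColumn : Prog :=
  .seq (.setN 8 (.get 4 (.reg 4))) (.seq (.setN 9 (.get 5 (.reg 8)))
    (.seq (.putN 5 (.reg 8) (.add (.reg 9) (.const 1))) (.seq (.putN 6 (.reg 4) (.reg 6))
      (.seq (.setR 1 .zero) (.seq (.setN 6 (.add (.reg 6) (.reg 1)))
        (.seq (.setN 10 (.reg 6)) (.setN 11 (.add (.reg 7) (.reg 8)))))))))

/-- Compute the cost matrix. -/
def costMatrix : Prog :=
  .seq (.setN 6 (.const 0)) (forLoop 4 0 (.seq startColumn (forLoop 5 1 costEntry)))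

/-- Because one function `cl` prescribes all written values, the order of the list is irrelevant. -/
theorem readClasses_ends (σ : State) (cl : ℕ → ℕ)
    (h : ∀ x < σ.nreg 3, cl (σ.narr 2 x) = σ.narr 3 x + 1) :
    readClasses.Ends σ (σ.nreg 3 * 20 + 6) fun τ => ∀ i,
      ((∃ x < σ.nreg 3, σ.narr 2 x = i) → τ.narr 4 i = cl i) ∧
      ((∀ x < σ.nreg 3, σ.narr 2 x ≠ i) → τ.narr 4 i = σ.narr 4 i) := by
  refine Ends.mono (Ends.forLoop (B := 12) (fun j τ => ∀ i,
      ((∃ x < j, σ.narr 2 x = i) → τ.narr 4 i = cl i) ∧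
      ((∀ x < j, σ.narr 2 x ≠ i) → τ.narr 4 i = σ.narr 4 i))
      (by decide) (by decide) (by decide) (fun _ _ _ h => h) ?_ ?_) le_rfl fun _ _ h => h
  · exact fun i => ⟨fun ⟨x, hx, _⟩ => absurd hx (Nat.not_lt_zero _), fun _ => rfl⟩
  · intro j τ hj hx hF hI
    have e2 : τ.narr 2 = σ.narr 2 := hF.narr 2 (by decide)
    have e3 : τ.narr 3 = σ.narr 3 := hF.narr 3 (by decide)
    refine ends_of_exec rfl (by decide) fun i => ?_
    simp only [exec, NExpr.eval, hx, e2, e3, Function.update_self]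
    by_cases hi : i = σ.narr 2 j
    · subst hi
      rw [Function.update_self, ← h j hj]
      exact ⟨fun _ => rfl, fun hc => absurd rfl (hc j (Nat.lt_succ_self j))⟩
    · rw [Function.update_of_ne hi]
      refine ⟨fun ⟨x, hxj, hxi⟩ => (hI i).1 ⟨x, ?_, hxi⟩,
        fun hc => (hI i).2 fun x hxj => hc x (by omega)⟩
      rcases Nat.lt_succ_iff_lt_or_eq.1 hxj with h1 | rfl
      · exact h1
      · exact absurd hxi.symm hi

/-- Entries are added twice, as the machine cannot multiply, and register `6` walks through the
row-major cells. The extra 1 makes the inequality required of `B` strict. -/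
theorem largeNumber_ends (σ : State) :
    largeNumber.Ends σ (σ.nreg 0 * (σ.nreg 1 * 60 + 6 + 8) + 12) fun τ =>
      τ.rreg 0 = 1 + 2 * ∑ x ∈ Finset.range (σ.nreg 0 * σ.nreg 1), |σ.rarr 0 x| := by
  set G : ℕ → State → Prop := fun q τ =>
    τ.nreg 6 = q ∧ τ.rreg 0 = 1 + 2 * ∑ x ∈ Finset.range q, |σ.rarr 0 x| with hG
  refine Ends.mono (Ends.exec_seq rfl (Ends.forLoop (B := σ.nreg 1 * 60 + 6)
    (fun i τ => G (i * σ.nreg 1) τ)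
    (by decide) (by decide) (by decide) (fun _ _ _ h => by simpa [hG] using h) ?_ ?_)) ?_ ?_
  · simp [hG, exec, NExpr.eval, RExpr.eval]
  · intro i τ hi hx hF hI
    have e1 : τ.nreg 1 = σ.nreg 1 := hF.nreg 1 (by decide)
    have e0 : τ.rarr 0 = σ.rarr 0 := hF.rarr 0 (by decide)
    refine Ends.mono (Ends.forLoop (B := 52) (fun j υ => G (i * σ.nreg 1 + j) υ)
      (by decide) (by decide) (by decide) (fun _ _ _ h => by simpa [hG] using h) hI ?_) ?_ ?_
    · rintro j υ hj hxυ hFυ ⟨h1, h2⟩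
      have e0' : υ.rarr 0 = σ.rarr 0 := (hFυ.rarr 0 (by decide)).trans e0
      refine ends_of_exec rfl (by decide) ?_
      simp only [addEntry, exec, Cond.Holds, RExpr.eval, NExpr.eval, h1, h2, e0']
      rw [← add_assoc]
      split_ifs with hc
      · refine ⟨by simp [h1], ?_⟩
        simp only [Function.update_self, Finset.sum_range_succ, abs_of_neg hc]
        ring
      · refine ⟨by simp [h1], ?_⟩
        simp only [Function.update_self, Finset.sum_range_succ, abs_of_nonneg (not_lt.1 hc)]
        ring
    · rw [e1]
    · intro υ _ hυ
      rw [e1] at hυ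
      rwa [Nat.succ_mul]
  · have : (exec (.seq (.setR 0 .one) (.setN 6 (.const 0))) σ).nreg 0 = σ.nreg 0 := by simp [exec]
    rw [this]
    simp [bound, RExpr.size, NExpr.size]
    omega
  · intro τ _ hτ
    have : (exec (.seq (.setR 0 .one) (.setN 6 (.const 0))) σ).nreg 0 = σ.nreg 0 := by simp [exec]
    rw [this] at hτ
    exact hτ.2

theorem boundsSize_ends (σ : State) :
    boundsSize.Ends σ (σ.nreg 1 * 20 + 10) fun τ => τ.nreg 7 = σ.nreg 2 * σ.nreg 1 := by
  refine Ends.mono (Ends.exec_seq rfl (Ends.forLoop (B := 12)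
    (fun j τ => τ.nreg 7 = σ.nreg 2 * j) (by decide) (by decide) (by decide)
    (fun _ _ _ h => by simpa using h) (by simp [exec, NExpr.eval]) ?_)) ?_ ?_
  · intro j τ hj hx hF hI
    have e2 : τ.nreg 2 = σ.nreg 2 := (hF.nreg 2 (by decide)).trans (by simp [exec])
    refine ends_of_exec rfl (by decide) ?_
    simp [exec, NExpr.eval, hI, e2, Nat.mul_succ]
  · have : (exec (.setN 7 (.const 0)) σ).nreg 1 = σ.nreg 1 := by simp [exec]
    rw [this]
    simp [bound, NExpr.size]
    omega
  · intro τ _ hτ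
    have : (exec (.setN 7 (.const 0)) σ).nreg 1 = σ.nreg 1 := by simp [exec]
    rwa [this] at hτ

/-- The penalty for an item of class code `c` and rank `r` at a position down to `k`, in terms of
the arrays of bounds. -/
noncomputable def rawPenalty (p : ℕ) (L U : ℕ → ℕ) (B : ℝ) (c r k : ℕ) : ℝ :=
  if 0 < c then
    (if r < U (p * k + (c - 1)) then 0 else B) - (if r < L (p * k + (c - 1)) then B else 0)
  else 0

theorem addPenalty_ends {τ : State} {p c r k : ℕ} {B x : ℝ} (hc : τ.nreg 8 = c)
    (hr : τ.nreg 9 = r) (hq : τ.nreg 11 = p * k + c) (hx : τ.rreg 1 = x) (hB : τ.rreg 0 = B) :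
    addPenalty.Ends τ 29 fun υ =>
      υ.rreg 1 = rawPenalty p (τ.narr 0) (τ.narr 1) B c r k + x := by
  refine Ends.mono (Ends.cond (T := 25) (fun h => ?_) fun h => ?_) le_rfl fun _ _ h => h
  · simp only [Cond.Holds, NExpr.eval, hc] at h
    -- A class code is the property plus one, so the address register points one cell too far.
    have b1 : p * k + c - 1 = p * k + (c - 1) := by omega
    refine Ends.mono (Ends.seq (T₁ := 12) (T₂ := 12) (R := fun υ => υ.rreg 1 =
      x + if r < τ.narr 1 (p * k + (c - 1)) then 0 else B) ?_ fun υ hF hυ => ?_) (by decide)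
      fun _ _ h => h
    · refine ends_of_exec rfl (by decide) ?_
      simp only [addUpper, exec, Cond.Holds, NExpr.eval, RExpr.eval, hr, hq, hx, hB, b1]
      split_ifs
      · rw [hx, add_zero]
      · simp
    · have e9 : υ.nreg 9 = r := (hF.nreg 9 (by decide)).trans hr
      have e11 : υ.nreg 11 = p * k + c := (hF.nreg 11 (by decide)).trans hq
      have e0 : υ.narr 0 = τ.narr 0 := hF.narr 0 (by decide)
      have eB : υ.rreg 0 = B := (hF.rreg 0 (by decide)).trans hB
      refine ends_of_exec rfl (by decide) ?_
      rw [rawPenalty, if_pos h]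
      generalize (if r < τ.narr 1 (p * k + (c - 1)) then 0 else B) = y at hυ ⊢
      simp only [subLower, exec, Cond.Holds, NExpr.eval, RExpr.eval, e9, e11, e0, b1, hυ, eB]
      split_ifs
      · simp only [Function.update_self]
        ring
      · rw [hυ]
        ring
  · simp only [Cond.Holds, NExpr.eval, hc] at h
    refine ends_of_exec rfl (by decide) ?_
    rw [rawPenalty, if_neg h, zero_add]
    exact hx

/-- Positions are visited from the last to the first, so register `1` accumulates the suffix sum of
penalties in constant time per entry; the addresses move by subtraction. The clause on x < z
protects the columns already computed. -/
theorem costColumn_ends {σ : State} {n p c r z : ℕ} {B : ℝ} (hn : σ.nreg 1 = n)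
    (hp : σ.nreg 2 = p) (hc : σ.nreg 8 = c) (hr : σ.nreg 9 = r) (hz : σ.nreg 10 = z + n)
    (hq : σ.nreg 11 = p * n + c) (h1 : σ.rreg 1 = 0) (hB : σ.rreg 0 = B) :
    (forLoop 5 1 costEntry).Ends σ (n * 80 + 6) fun τ =>
      (∀ k < n, τ.rarr 1 (z + k) =
        ∑ k' ∈ Finset.Ico k n, rawPenalty p (σ.narr 0) (σ.narr 1) B c r k' - σ.rarr 0 (z + k)) ∧
      ∀ x < z, τ.rarr 1 x = σ.rarr 1 x := by
  subst hn
  set n := σ.nreg 1 with hn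
  refine Ends.mono (Ends.forLoop (B := 72) (fun t τ =>
    (τ.nreg 10 = z + (n - t) ∧ τ.nreg 11 = p * (n - t) + c ∧
      τ.rreg 1 = ∑ k' ∈ Finset.Ico (n - t) n, rawPenalty p (σ.narr 0) (σ.narr 1) B c r k') ∧
    (∀ k < n, n - t ≤ k → τ.rarr 1 (z + k) =
        ∑ k' ∈ Finset.Ico k n, rawPenalty p (σ.narr 0) (σ.narr 1) B c r k' - σ.rarr 0 (z + k)) ∧
    ∀ x < z, τ.rarr 1 x = σ.rarr 1 x)
    (by decide) (by decide) (by decide) (fun _ _ _ h => by simpa using h) ?_ ?_) le_rfl ?_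
  · refine ⟨⟨by simpa using hz, by simpa using hq, by simpa using h1⟩, ?_, fun _ _ => rfl⟩
    intro k hk hk'
    omega
  · rintro t τ ht hx hF ⟨⟨i1, i2, i3⟩, i4, i5⟩
    have e2 : τ.nreg 2 = p := (hF.nreg 2 (by decide)).trans hp
    have e8 : τ.nreg 8 = c := (hF.nreg 8 (by decide)).trans hc
    have e9 : τ.nreg 9 = r := (hF.nreg 9 (by decide)).trans hr
    have eB : τ.rreg 0 = B := (hF.rreg 0 (by decide)).trans hB
    have eL : τ.narr 0 = σ.narr 0 := hF.narr 0 (by decide)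
    have eU : τ.narr 1 = σ.narr 1 := hF.narr 1 (by decide)
    have eW : τ.rarr 0 = σ.rarr 0 := hF.rarr 0 (by decide)
    obtain ⟨e, he⟩ : ∃ e, n - t = e + 1 := ⟨n - t - 1, by omega⟩
    have he' : n - (t + 1) = e := by omega
    have hen : e < n := by omega
    rw [he] at i1 i2 i3 i4
    rw [he']
    have a1 : z + (e + 1) - 1 = z + e := by omega
    have a2 : p * (e + 1) + c - p = p * e + c := by rw [Nat.mul_succ]; omega
    set acc : ℝ := ∑ k' ∈ Finset.Ico e n, rawPenalty p (σ.narr 0) (σ.narr 1) B c r k' with hacc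
    have hacc' : acc = rawPenalty p (σ.narr 0) (σ.narr 1) B c r e + τ.rreg 1 := by
      rw [hacc, i3, Finset.sum_eq_sum_Ico_succ_bot hen]
    refine Ends.mono (Ends.exec_seq rfl (Ends.seq (T₂ := 8) (addPenalty_ends (p := p) (c := c)
      (r := r) (k := e) (x := τ.rreg 1) (B := B) ?_ ?_ ?_ rfl ?_) fun υ hFυ hυ =>
        ends_of_exec rfl (by decide) ?_)) (by decide) fun _ _ h => h
    · simpa [exec] using e8
    · simpa [exec] using e9
    · simp [exec, NExpr.eval, e2, i2, a2]
    · simpa [exec] using eB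
    have x10 : υ.nreg 10 = z + e := by
      rw [hFυ.nreg 10 (by decide)]
      simp [exec, NExpr.eval, i1]
    have x11 : υ.nreg 11 = p * e + c := by
      rw [hFυ.nreg 11 (by decide)]
      simp [exec, NExpr.eval, e2, i2, a2]
    have xW : υ.rarr 0 = σ.rarr 0 := (hFυ.rarr 0 (by decide)).trans eW
    have xC : υ.rarr 1 = τ.rarr 1 := hFυ.rarr 1 (by decide)
    have x1 : υ.rreg 1 = acc := by
      rw [hυ, hacc']
      simp [exec, eL, eU]
    simp only [exec, NExpr.eval, RExpr.eval, Function.update_self, x10, x11, x1, xW, xC]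
    refine ⟨⟨trivial, trivial, trivial⟩, fun k hk hke => ?_, fun x hx => ?_⟩
    · by_cases hke' : k = e
      · rw [hke', Function.update_self]
      · rw [Function.update_of_ne (by omega)]
        exact i4 k hk (by omega)
    · rw [Function.update_of_ne (by omega)]
      exact i5 x hx
  · rintro τ _ ⟨-, h4, h5⟩
    exact ⟨fun k hk => h4 k hk (by omega), h5⟩

/-- Items are visited in order while the array `5` counts them by class code, so the count found on
arrival is the rank of the item. The array `6` keeps the offsets n * i, which cannot be recomputed
by one multiplication. -/
theorem costMatrix_ends {σ : State} {m n p : ℕ} {B : ℝ} (hm : σ.nreg 0 = m) (hn : σ.nreg 1 = n)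
    (hp : σ.nreg 2 = p) (hq : σ.nreg 7 = p * n) (h5 : σ.narr 5 = fun _ => 0)
    (hB : σ.rreg 0 = B) :
    costMatrix.Ends σ (m * (n * 80 + 50) + 10) fun τ => ∀ i < m, τ.narr 6 i = n * i ∧ ∀ k < n,
      τ.rarr 1 (n * i + k) = ∑ k' ∈ Finset.Ico k n,
        rawPenalty p (σ.narr 0) (σ.narr 1) B (σ.narr 4 i)
          ((Finset.range i).filter fun i' => σ.narr 4 i' = σ.narr 4 i).card k' -
        σ.rarr 0 (n * i + k) := by
  have hm' : (exec (.setN 6 (.const 0)) σ).nreg 0 = m := by simpa [exec] using hm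
  refine Ends.mono (Ends.exec_seq rfl (Ends.forLoop (B := n * 80 + 42) (fun j τ =>
    (τ.nreg 6 = n * j ∧
      ∀ c, τ.narr 5 c = ((Finset.range j).filter fun i' => σ.narr 4 i' = c).card) ∧
    ∀ i < j, τ.narr 6 i = n * i ∧ ∀ k < n,
      τ.rarr 1 (n * i + k) = ∑ k' ∈ Finset.Ico k n,
        rawPenalty p (σ.narr 0) (σ.narr 1) B (σ.narr 4 i)
          ((Finset.range i).filter fun i' => σ.narr 4 i' = σ.narr 4 i).card k' -
        σ.rarr 0 (n * i + k))
    (by decide) (by decide) (by decide) (fun _ _ _ h => by simpa using h) ?_ ?_)) ?_ ?_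
  · simp [exec, NExpr.eval, h5]
  · rintro j τ hj hx hF ⟨⟨i1, i2⟩, i3⟩
    have e1 : τ.nreg 1 = n := (hF.nreg 1 (by decide)).trans hn
    have e2 : τ.nreg 2 = p := (hF.nreg 2 (by decide)).trans hp
    have e7 : τ.nreg 7 = p * n := (hF.nreg 7 (by decide)).trans hq
    have eB : τ.rreg 0 = B := (hF.rreg 0 (by decide)).trans hB
    have eL : τ.narr 0 = σ.narr 0 := hF.narr 0 (by decide)
    have eU : τ.narr 1 = σ.narr 1 := hF.narr 1 (by decide)
    have e4 : τ.narr 4 = σ.narr 4 := hF.narr 4 (by decide)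
    have eW : τ.rarr 0 = σ.rarr 0 := hF.rarr 0 (by decide)
    set c := σ.narr 4 j with hc
    set υ := exec startColumn τ with hυ
    have v4 : υ.nreg 1 = n := by simpa [hυ, startColumn, exec] using e1
    have v2 : υ.nreg 2 = p := by simpa [hυ, startColumn, exec] using e2
    have v8 : υ.nreg 8 = c := by simp [hυ, startColumn, exec, NExpr.eval, hx, e4, hc]
    have v9 : υ.nreg 9 = τ.narr 5 c := by simp [hυ, startColumn, exec, NExpr.eval, hx, e4, hc]
    have v10 : υ.nreg 10 = n * j + n := by simp [hυ, startColumn, exec, NExpr.eval, i1, e1]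
    have v11 : υ.nreg 11 = p * n + c := by
      simp [hυ, startColumn, exec, NExpr.eval, hx, e4, hc, e7]
    have v1 : υ.rreg 1 = 0 := by simp [hυ, startColumn, exec, RExpr.eval]
    have vB : υ.rreg 0 = B := by simpa [hυ, startColumn, exec] using eB
    have f5 : υ.narr 5 = Function.update (τ.narr 5) c (τ.narr 5 c + 1) := by
      simp [hυ, startColumn, exec, NExpr.eval, hx, e4, hc]
    have f6 : υ.narr 6 = Function.update (τ.narr 6) j (n * j) := by
      simp [hυ, startColumn, exec, NExpr.eval, hx, i1]
    have f0 : υ.narr 0 = σ.narr 0 := by simpa [hυ, startColumn, exec] using eL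
    have f1 : υ.narr 1 = σ.narr 1 := by simpa [hυ, startColumn, exec] using eU
    have f6' : υ.nreg 6 = n * (j + 1) := by
      simp [hυ, startColumn, exec, NExpr.eval, i1, e1, Nat.mul_succ]
    have r0 : υ.rarr 0 = σ.rarr 0 := by simpa [hυ, startColumn, exec] using eW
    have r1 : υ.rarr 1 = τ.rarr 1 := by simp [hυ, startColumn, exec]
    refine Ends.mono (Ends.exec_seq rfl ((costColumn_ends v4 v2 v8 v9 v10 v11 v1 vB).mono le_rfl
      (Q' := fun ω => (ω.nreg 6 = n * (j + 1) ∧ ∀ c, ω.narr 5 c =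
          ((Finset.range (j + 1)).filter fun i' => σ.narr 4 i' = c).card) ∧
        ∀ i < j + 1, ω.narr 6 i = n * i ∧ ∀ k < n,
          ω.rarr 1 (n * i + k) = ∑ k' ∈ Finset.Ico k n,
            rawPenalty p (σ.narr 0) (σ.narr 1) B (σ.narr 4 i)
              ((Finset.range i).filter fun i' => σ.narr 4 i' = σ.narr 4 i).card k' -
            σ.rarr 0 (n * i + k)) ?_)) ?_ fun _ _ h => h
    · rintro ω hω ⟨q1, q2⟩
      rw [hω.nreg 6 (by decide), hω.narr 5 (by decide), hω.narr 6 (by decide), f5, f6, f6']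
      rw [f0, f1, r0] at q1
      rw [r1] at q2
      refine ⟨⟨rfl, fun c' => ?_⟩, fun i hi => ?_⟩
      · rw [Finset.range_add_one, Finset.filter_insert]
        by_cases hcc : c' = c
        · rw [hcc, Function.update_self, if_pos rfl, Finset.card_insert_of_notMem (by simp), i2]
        · rw [Function.update_of_ne hcc, if_neg fun h => hcc h.symm, i2]
      · by_cases hij : i = j
        · subst hij
          refine ⟨Function.update_self _ _ _, fun k hk => ?_⟩
          rw [q1 k hk, i2]
        · have hij' : i < j := by omega
          refine ⟨(Function.update_of_ne hij _ _).trans (i3 i hij').1, fun k hk => ?_⟩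
          rw [q2, (i3 i hij').2 k hk]
          have : n * (i + 1) ≤ n * j := Nat.mul_le_mul_left n hij'
          rw [Nat.mul_succ] at this
          omega
    · have : bound startColumn ≤ 36 := by decide
      omega
  · rw [hm']
    have : bound (.setN 6 (.const 0)) = 2 := rfl
    rw [this]
    have : n * 80 + 42 + 8 = n * 80 + 50 := by ring
    rw [this]
    omega
  · intro τ _ hτ
    rw [hm'] at hτ
    exact hτ.2

end Prog

namespace Prog

/-! ### Reading off the ranking -/

/-- Store the inverse of the matching in the array `7` in the array `10`. -/
def matchToRanking : Prog :=
  forLoop 4 0 (.cond (.nlt (.const 0) (.get 7 (.reg 4)))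
    (.putN 10 (.sub (.get 7 (.reg 4)) (.const 1)) (.reg 4)) .skip)

/-- Compare the count of one property with its bounds. -/
def checkCell : Prog :=
  .seq (.cond (.conj (.neg (.nlt (.get 11 (.add (.reg 4) (.const 1))) (.get 0 (.reg 6))))
      (.neg (.nlt (.get 1 (.reg 6)) (.get 11 (.add (.reg 4) (.const 1))))))
      .skip (.setN 13 (.const 0)))
    (.setN 6 (.add (.reg 6) (.const 1)))

/-- Count the item at one position. -/
def countItem : Prog :=
  .seq (.setN 8 (.get 4 (.get 10 (.reg 5))))
    (.putN 11 (.reg 8) (.add (.get 11 (.reg 8)) (.const 1)))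

/-- Decide whether the ranking in the array `10` is feasible. -/
def checkRanking : Prog :=
  .seq (.seq (.setN 13 (.const 1)) (.setN 6 (.const 0)))
    (forLoop 5 1 (.seq countItem (forLoop 4 2 checkCell)))

/-- Copy the ranking to the output. -/
def copyRanking : Prog :=
  .seq (forLoop 5 1 (.putN 0 (.reg 5) (.get 10 (.reg 5)))) (.setN 0 (.reg 13))

theorem matchToRanking_ends {σ : State} {m n : ℕ} (hm : σ.nreg 0 = m)
    (hinj : ∀ i < m, ∀ j < m, σ.narr 7 i = σ.narr 7 j → σ.narr 7 i ≠ 0 → i = j)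
    (hsurj : ∀ k < n, ∃ i < m, σ.narr 7 i = k + 1) :
    matchToRanking.Ends σ (m * 30 + 6) fun τ =>
      ∀ k < n, τ.narr 10 k < m ∧ σ.narr 7 (τ.narr 10 k) = k + 1 := by
  subst hm
  refine Ends.mono (Ends.forLoop (B := 22) (fun j τ =>
    ∀ i < j, σ.narr 7 i ≠ 0 → τ.narr 10 (σ.narr 7 i - 1) = i)
    (by decide) (by decide) (by decide) (fun _ _ _ h => h) (by simp) ?_) le_rfl ?_
  · intro j τ hj hx hF hI
    have e7 : τ.narr 7 = σ.narr 7 := hF.narr 7 (by decide)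
    refine ends_of_exec rfl (by decide) fun i hi hne => ?_
    simp only [exec, Cond.Holds, NExpr.eval, hx, e7]
    by_cases hij : i = j
    · subst hij
      rw [if_pos (Nat.pos_of_ne_zero hne)]
      simp
    · split_ifs with h0
      · simp only [Function.update_self]
        rw [Function.update_of_ne]
        · exact hI i (by omega) hne
        · intro h
          exact hij (hinj i (by omega) j hj (by omega) hne)
      · exact hI i (by omega) hne
  · intro τ _ hτ k hk
    obtain ⟨i, hi, hik⟩ := hsurj k hk
    have := hτ i hi (by omega)
    rw [hik, Nat.add_sub_cancel] at this
    rw [this]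
    exact ⟨hi, hik⟩

/-- Counts by class code are updated once per position and compared with all bounds there; the flag
is only ever cleared. Keeping `good` opaque separates the logic of the flag from the counts. -/
theorem checkRanking_ends {σ : State} {n p : ℕ} (hn : σ.nreg 1 = n) (hp : σ.nreg 2 = p)
    (h11 : σ.narr 11 = fun _ => 0) (good : ℕ → ℕ → Prop)
    (hgood : ∀ k < n, ∀ ℓ < p, good k ℓ ↔
      σ.narr 0 (p * k + ℓ) ≤
          ((Finset.range (k + 1)).filter fun j => σ.narr 4 (σ.narr 10 j) = ℓ + 1).card ∧
        ((Finset.range (k + 1)).filter fun j => σ.narr 4 (σ.narr 10 j) = ℓ + 1).card ≤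
          σ.narr 1 (p * k + ℓ)) :
    checkRanking.Ends σ (n * (p * 40 + 30) + 10) fun τ =>
      (τ.nreg 13 = 0 ∨ τ.nreg 13 = 1) ∧ (τ.nreg 13 = 1 ↔ ∀ k < n, ∀ ℓ < p, good k ℓ) := by
  set cnt : ℕ → ℕ → ℕ := fun k c =>
    ((Finset.range k).filter fun j => σ.narr 4 (σ.narr 10 j) = c).card with hcnt
  set G : ℕ → ℕ → State → Prop := fun k l τ => τ.nreg 6 = p * k + l ∧
    (τ.nreg 13 = 0 ∨ τ.nreg 13 = 1) ∧
    (τ.nreg 13 = 1 ↔ (∀ k' < k, ∀ ℓ < p, good k' ℓ) ∧ ∀ ℓ < l, good k ℓ) with hG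
  have hn' : (exec (.seq (.setN 13 (.const 1)) (.setN 6 (.const 0))) σ).nreg 1 = n := by
    simpa [exec] using hn
  refine Ends.mono (Ends.exec_seq rfl (Ends.forLoop (B := p * 40 + 22) (fun k τ =>
    G k 0 τ ∧ ∀ c, τ.narr 11 c = cnt k c)
    (by decide) (by decide) (by decide) (fun _ _ _ h => by simpa [hG] using h) ?_ ?_)) ?_ ?_
  · simp [hG, hcnt, exec, NExpr.eval, h11]
  · rintro k τ hk hx hF ⟨hI, hI'⟩
    rw [hn'] at hk
    have e2 : τ.nreg 2 = p := (hF.nreg 2 (by decide)).trans (by simpa [exec] using hp)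
    have e0 : τ.narr 0 = σ.narr 0 := hF.narr 0 (by decide)
    have e1 : τ.narr 1 = σ.narr 1 := hF.narr 1 (by decide)
    have e4 : τ.narr 4 = σ.narr 4 := hF.narr 4 (by decide)
    have e10 : τ.narr 10 = σ.narr 10 := hF.narr 10 (by decide)
    set υ := exec countItem τ with hυ
    have v2 : υ.nreg 2 = p := by simpa [hυ, countItem, exec] using e2
    have v6 : υ.nreg 6 = τ.nreg 6 := by simp [hυ, countItem, exec]
    have v13 : υ.nreg 13 = τ.nreg 13 := by simp [hυ, countItem, exec]
    have v0 : υ.narr 0 = σ.narr 0 := by simpa [hυ, countItem, exec] using e0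
    have v1 : υ.narr 1 = σ.narr 1 := by simpa [hυ, countItem, exec] using e1
    have v11 : ∀ c, υ.narr 11 c = cnt (k + 1) c := by
      intro c
      have h : υ.narr 11 = Function.update (τ.narr 11) (σ.narr 4 (σ.narr 10 k))
          (τ.narr 11 (σ.narr 4 (σ.narr 10 k)) + 1) := by
        simp [hυ, countItem, exec, NExpr.eval, hx, e4, e10]
      rw [h]
      simp only [hcnt]
      rw [Finset.range_add_one, Finset.filter_insert]
      by_cases hcc : c = σ.narr 4 (σ.narr 10 k)
      · rw [hcc, Function.update_self, if_pos rfl, Finset.card_insert_of_notMem (by simp), hI']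
      · rw [Function.update_of_ne hcc, if_neg fun h => hcc h.symm, hI']
    refine Ends.mono (Ends.exec_seq rfl ((Ends.forLoop (B := 32) (fun l ω => G k l ω)
      (by decide) (by decide) (by decide) (fun _ _ _ h => by simpa [hG] using h) ?_ ?_).mono le_rfl
      (Q' := fun ω => G (k + 1) 0 ω ∧ ∀ c, ω.narr 11 c = cnt (k + 1) c) ?_)) ?_ fun _ _ h => h
    · exact ⟨v6.trans hI.1, v13.symm ▸ hI.2.1, v13.symm ▸ hI.2.2⟩
    · rintro l ω hl hxω hFω ⟨g1, g2, g3⟩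
      rw [v2] at hl
      have w0 : ω.narr 0 = σ.narr 0 := (hFω.narr 0 (by decide)).trans v0
      have w1 : ω.narr 1 = σ.narr 1 := (hFω.narr 1 (by decide)).trans v1
      have w11 : ω.narr 11 (l + 1) = cnt (k + 1) (l + 1) := by
        rw [hFω.narr 11 (by decide), v11]
      have hgl : good k l ↔ σ.narr 0 (p * k + l) ≤ cnt (k + 1) (l + 1) ∧
        cnt (k + 1) (l + 1) ≤ σ.narr 1 (p * k + l) := hgood k hk l hl
      have hl' : (∀ ℓ < l + 1, good k ℓ) ↔ (∀ ℓ < l, good k ℓ) ∧ good k l := by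
        simp only [Nat.lt_succ_iff_lt_or_eq, or_imp, forall_and, forall_eq]
      refine ends_of_exec rfl (by decide) ?_
      simp only [hG, hl', hgl, checkCell, exec, Cond.Holds, NExpr.eval, hxω, w0, w1, w11, g1, not_lt]
      split_ifs with hc
      · simpa [g1, g3, hc, add_assoc] using g2
      · simp [g1, hc, add_assoc]
    · intro ω hω hg
      rw [v2] at hg
      refine ⟨?_, fun c => by rw [hω.narr 11 (by decide), v11]⟩
      obtain ⟨g1, g2, g3⟩ := hg
      refine ⟨by rw [g1, Nat.mul_succ, add_zero], g2, g3.trans ?_⟩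
      simp only [Nat.lt_succ_iff_lt_or_eq, or_imp, forall_and, forall_eq, Nat.not_lt_zero,
        IsEmpty.forall_iff, implies_true, and_true]
    · rw [v2]
      have : bound countItem ≤ 12 := by decide
      omega
  · rw [hn']
    have : bound (.seq (.setN 13 (.const 1)) (.setN 6 (.const 0))) = 4 := rfl
    rw [this]
    have : p * 40 + 22 + 8 = p * 40 + 30 := by ring
    rw [this]
    omega
  · rintro τ _ ⟨⟨-, g2, g3⟩, -⟩
    rw [hn'] at g3
    exact ⟨g2, g3.trans (by simp)⟩

/-- The output overwrites the array of lower bounds and the register of `m`, so it must come after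
the check. -/
theorem copyRanking_ends {σ : State} {n : ℕ} (hn : σ.nreg 1 = n) :
    copyRanking.Ends σ (n * 16 + 10) fun τ =>
      (∀ k < n, τ.narr 0 k = σ.narr 10 k) ∧ τ.nreg 0 = σ.nreg 13 := by
  subst hn
  refine Ends.mono (Ends.seq (T₂ := 2) (Ends.forLoop (B := 6) (fun j τ =>
    ∀ k < j, τ.narr 0 k = σ.narr 10 k)
    (by decide) (by decide) (by decide) (fun _ _ _ h => h) (by simp) ?_) ?_) ?_ fun _ _ h => h
  · intro j τ hj hx hF hI
    have e10 : τ.narr 10 = σ.narr 10 := hF.narr 10 (by decide)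
    refine ends_of_exec rfl (by decide) fun k hk => ?_
    simp only [exec, NExpr.eval, hx, e10, Function.update_self]
    by_cases hkj : k = j
    · rw [hkj, Function.update_self]
    · rw [Function.update_of_ne hkj]
      exact hI k (by omega)
  · intro τ hF hτ
    refine ends_of_exec rfl (by decide) ⟨hτ, ?_⟩
    simp only [exec, NExpr.eval, Function.update_self]
    exact hF.nreg 13 (by decide)
  · omega

end Prog

namespace Prog

/-! ### The complete program -/

/-- Compute the cost matrix from the input. -/
def prepare : Prog :=
  .seq readClasses (.seq largeNumber (.seq boundsSize costMatrix))

/-- Turn a matching into the output. -/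
def finish : Prog :=
  .seq matchToRanking (.seq checkRanking copyRanking)

/-- The program for instances that have at least as many items as positions. -/
def solve : Prog :=
  .seq prepare (.seq hungarian finish)

/-- The program for all instances. -/
def main : Prog :=
  .cond (.nlt (.reg 0) (.reg 1)) (.setN 0 (.const 0)) solve

/-- The costs in terms of the input arrays. -/
noncomputable def rawCost (m n p : ℕ) (L U : ℕ → ℕ) (W : ℕ → ℝ) (cl : ℕ → ℕ) (k i : ℕ) : ℝ :=
  ∑ k' ∈ Finset.Ico k n, rawPenalty p L U (1 + 2 * ∑ x ∈ Finset.range (m * n), |W x|) (cl i)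
    ((Finset.range i).filter fun i' => cl i' = cl i).card k' - W (n * i + k)

theorem prepare_ends {σ : State} {m n p len : ℕ} {cl : ℕ → ℕ} (hm : σ.nreg 0 = m)
    (hn : σ.nreg 1 = n) (hp : σ.nreg 2 = p) (hlen : σ.nreg 3 = len)
    (hcl : ∀ x < len, cl (σ.narr 2 x) = σ.narr 3 x + 1)
    (hcl0 : ∀ i, (∀ x < len, σ.narr 2 x ≠ i) → cl i = 0)
    (h4 : σ.narr 4 = fun _ => 0) (h5 : σ.narr 5 = fun _ => 0) :
    prepare.Ends σ ((len * 20 + 6) + ((m * (n * 60 + 6 + 8) + 12) + ((n * 20 + 10) +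
        (m * (n * 80 + 50) + 10)))) fun τ =>
      τ.narr 4 = cl ∧
        Costs m n (rawCost m n p (σ.narr 0) (σ.narr 1) (σ.rarr 0) cl) τ := by
  subst hlen
  refine (readClasses_ends σ cl hcl).seq fun τ₁ F₁ h₁ => ?_
  have c1 : τ₁.narr 4 = cl := by
    funext i
    by_cases hi : ∃ x < σ.nreg 3, σ.narr 2 x = i
    · exact (h₁ i).1 hi
    · have hi' : ∀ x < σ.nreg 3, σ.narr 2 x ≠ i := fun x hx h => hi ⟨x, hx, h⟩
      rw [(h₁ i).2 hi', h4, hcl0 i hi']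
  have a0 : τ₁.nreg 0 = m := (F₁.nreg 0 (by decide)).trans hm
  have a1 : τ₁.nreg 1 = n := (F₁.nreg 1 (by decide)).trans hn
  have hl := largeNumber_ends τ₁
  rw [a0, a1, F₁.rarr 0 (by decide)] at hl
  refine hl.seq fun τ₂ F₂ h₂ => ?_
  have hb := boundsSize_ends τ₂
  have b1 : τ₂.nreg 1 = n := (F₂.nreg 1 (by decide)).trans a1
  have b2 : τ₂.nreg 2 = p :=
    (F₂.nreg 2 (by decide)).trans ((F₁.nreg 2 (by decide)).trans hp)
  rw [b1, b2] at hb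
  refine hb.seq fun τ₃ F₃ h₃ => ?_
  have d0 : τ₃.nreg 0 = m := (F₃.nreg 0 (by decide)).trans ((F₂.nreg 0 (by decide)).trans a0)
  have d1 : τ₃.nreg 1 = n := (F₃.nreg 1 (by decide)).trans b1
  have d2 : τ₃.nreg 2 = p := (F₃.nreg 2 (by decide)).trans b2
  have d5 : τ₃.narr 5 = fun _ => 0 := (F₃.narr 5 (by decide)).trans
    ((F₂.narr 5 (by decide)).trans ((F₁.narr 5 (by decide)).trans h5))
  have dB := (F₃.rreg 0 (by decide)).trans h₂
  have d4 : τ₃.narr 4 = cl :=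
    (F₃.narr 4 (by decide)).trans ((F₂.narr 4 (by decide)).trans c1)
  have dL : τ₃.narr 0 = σ.narr 0 := (F₃.narr 0 (by decide)).trans
    ((F₂.narr 0 (by decide)).trans (F₁.narr 0 (by decide)))
  have dU : τ₃.narr 1 = σ.narr 1 := (F₃.narr 1 (by decide)).trans
    ((F₂.narr 1 (by decide)).trans (F₁.narr 1 (by decide)))
  have dW : τ₃.rarr 0 = σ.rarr 0 := (F₃.rarr 0 (by decide)).trans
    ((F₂.rarr 0 (by decide)).trans (F₁.rarr 0 (by decide)))
  refine (costMatrix_ends d0 d1 d2 h₃ d5 dB).mono le_rfl fun τ F h => ?_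
  refine ⟨(F.narr 4 (by decide)).trans d4, (F.nreg 0 (by decide)).trans d0,
    (F.nreg 1 (by decide)).trans d1, fun i hi k hk => ?_⟩
  rw [(h i hi).1, (h i hi).2 k hk, d4, dL, dU, dW]
  rfl

theorem finish_ends {σ : State} {m n p : ℕ} {a : ℕ → ℕ → ℝ} {v : ℕ → ℝ} (hm : σ.nreg 0 = m)
    (hn : σ.nreg 1 = n) (hp : σ.nreg 2 = p) (h11 : σ.narr 11 = fun _ => 0)
    (h : PricedMatching m n a (σ.narr 7) v) :
    finish.Ends σ ((m * 30 + 6) + ((n * (p * 40 + 30) + 10) + (n * 16 + 10))) fun τ =>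
      (∀ k < n, τ.narr 0 k < m ∧ σ.narr 7 (τ.narr 0 k) = k + 1) ∧
      (τ.nreg 0 = 0 ∨ τ.nreg 0 = 1) ∧ (τ.nreg 0 = 1 ↔ ∀ k < n, ∀ ℓ < p,
        σ.narr 0 (p * k + ℓ) ≤
            ((Finset.range (k + 1)).filter fun j => σ.narr 4 (τ.narr 0 j) = ℓ + 1).card ∧
          ((Finset.range (k + 1)).filter fun j => σ.narr 4 (τ.narr 0 j) = ℓ + 1).card ≤
            σ.narr 1 (p * k + ℓ)) := by
  refine (matchToRanking_ends hm h.inj h.surj).seq fun τ₁ F₁ h₁ => ?_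
  have a1 : τ₁.nreg 1 = n := (F₁.nreg 1 (by decide)).trans hn
  have a2 : τ₁.nreg 2 = p := (F₁.nreg 2 (by decide)).trans hp
  refine (checkRanking_ends a1 a2 ((F₁.narr 11 (by decide)).trans h11) _
    fun _ _ _ _ => Iff.rfl).seq fun τ₂ F₂ h₂ => ?_
  refine (copyRanking_ends ((F₂.nreg 1 (by decide)).trans a1)).mono le_rfl fun τ _ h₃ => ?_
  have e : ∀ k < n, τ.narr 0 k = τ₁.narr 10 k := fun k hk => by
    rw [h₃.1 k hk, F₂.narr 10 (by decide)]
  refine ⟨fun k hk => ?_, h₃.2 ▸ h₂.1, ?_⟩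
  · rw [e k hk]
    exact h₁ k hk
  · rw [h₃.2, h₂.2, F₁.narr 0 (by decide), F₁.narr 1 (by decide), F₁.narr 4 (by decide)]
    refine forall₂_congr fun k hk => forall₂_congr fun ℓ hℓ => ?_
    rw [Finset.filter_congr (q := fun j => σ.narr 4 (τ.narr 0 j) = ℓ + 1)]
    intro j hj
    rw [e j (by have := Finset.mem_range.1 hj; omega)]

/-- A bound on the running time. -/
theorem time_le {m n p len : ℕ} (hm : 1 ≤ m) (hn : 1 ≤ n) (hp : p ≤ m) (hlen : len ≤ m) :
    ((len * 20 + 6) + ((m * (n * 60 + 6 + 8) + 12) + ((n * 20 + 10) + (m * (n * 80 + 50) + 10)))) +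
      ((n * (n * (m * 90 + 100) + m * 60 + 58) + 6) +
        ((m * 30 + 6) + ((n * (p * 40 + 30) + 10) + (n * 16 + 10)))) ≤ 800 * (n * n * m) := by
  have h1 : 1 ≤ n * n * m := Nat.mul_pos (Nat.mul_pos hn hn) hm
  have h2 : n * m ≤ n * n * m := Nat.mul_le_mul_right m (Nat.le_mul_of_pos_left n hn)
  have h3 : m ≤ n * m := Nat.le_mul_of_pos_left m hn
  have h4 : n ≤ n * m := Nat.le_mul_of_pos_right n hm
  have h5 : n * n ≤ n * n * m := Nat.le_mul_of_pos_right _ hm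
  have h6 : n * p ≤ n * m := Nat.mul_le_mul_left n hp
  nlinarith

theorem solve_ends {σ : State} {m n p len : ℕ} {cl : ℕ → ℕ} (hm : σ.nreg 0 = m)
    (hn : σ.nreg 1 = n) (hp : σ.nreg 2 = p) (hlen : σ.nreg 3 = len)
    (hcl : ∀ x < len, cl (σ.narr 2 x) = σ.narr 3 x + 1)
    (hcl0 : ∀ i, (∀ x < len, σ.narr 2 x ≠ i) → cl i = 0)
    (hN : ∀ a, 4 ≤ a → σ.narr a = fun _ => 0) (h3 : σ.rarr 3 = fun _ => 0)
    (hm1 : 1 ≤ m) (hn1 : 1 ≤ n) (hpm : p ≤ m) (hlm : len ≤ m) (hnm : n ≤ m) :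
    solve.Ends σ (800 * (n * n * m)) fun τ => ∃ mt v,
      PricedMatching m n (rawCost m n p (σ.narr 0) (σ.narr 1) (σ.rarr 0) cl) mt v ∧
      (∀ k < n, τ.narr 0 k < m ∧ mt (τ.narr 0 k) = k + 1) ∧
      (τ.nreg 0 = 0 ∨ τ.nreg 0 = 1) ∧ (τ.nreg 0 = 1 ↔ ∀ k < n, ∀ ℓ < p,
        σ.narr 0 (p * k + ℓ) ≤
            ((Finset.range (k + 1)).filter fun j => cl (τ.narr 0 j) = ℓ + 1).card ∧
          ((Finset.range (k + 1)).filter fun j => cl (τ.narr 0 j) = ℓ + 1).card ≤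
            σ.narr 1 (p * k + ℓ)) := by
  refine Ends.mono ((prepare_ends hm hn hp hlen hcl hcl0 (hN 4 le_rfl) (hN 5 (by decide))).seq
    fun τ₁ F₁ h₁ => (hungarian_ends h₁.2 hnm ((F₁.narr 7 (by decide)).trans (hN 7 (by decide)))
      ((F₁.rarr 3 (by decide)).trans h3)).seq fun τ₂ F₂ h₂ => (finish_ends
        ((F₂.nreg 0 (by decide)).trans h₁.2.cols) ((F₂.nreg 1 (by decide)).trans h₁.2.rows)
        ((F₂.nreg 2 (by decide)).trans ((F₁.nreg 2 (by decide)).trans hp))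
        ((F₂.narr 11 (by decide)).trans ((F₁.narr 11 (by decide)).trans (hN 11 (by decide))))
        h₂).mono le_rfl
        (Q' := fun τ => ∃ mt v,
          PricedMatching m n (rawCost m n p (σ.narr 0) (σ.narr 1) (σ.rarr 0) cl) mt v ∧
          (∀ k < n, τ.narr 0 k < m ∧ mt (τ.narr 0 k) = k + 1) ∧
          (τ.nreg 0 = 0 ∨ τ.nreg 0 = 1) ∧ (τ.nreg 0 = 1 ↔ ∀ k < n, ∀ ℓ < p,
            σ.narr 0 (p * k + ℓ) ≤
                ((Finset.range (k + 1)).filter fun j => cl (τ.narr 0 j) = ℓ + 1).card ∧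
              ((Finset.range (k + 1)).filter fun j => cl (τ.narr 0 j) = ℓ + 1).card ≤
                σ.narr 1 (p * k + ℓ)))
        fun τ _ h => ⟨_, _, h₂, h.1, h.2.1, ?_⟩) (time_le hm1 hn1 hpm hlm) fun _ _ h => h
  have e0 : τ₂.narr 0 = σ.narr 0 := (F₂.narr 0 (by decide)).trans (F₁.narr 0 (by decide))
  have e1 : τ₂.narr 1 = σ.narr 1 := (F₂.narr 1 (by decide)).trans (F₁.narr 1 (by decide))
  have e4 : τ₂.narr 4 = cl := (F₂.narr 4 (by decide)).trans h₁.1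
  have h2 := h.2.2
  rw [e0, e1, e4] at h2
  exact h2

end Prog

/-! ### Encoding of the input matrices. -/

theorem rowMajor_apply {α : Type} [Zero α] {a b : ℕ} (A : Fin a → Fin b → α) (i : Fin a)
    (j : Fin b) : rowMajor A (b * i + j) = A i j := by
  have h : finProdFinEquiv (i, j) = b * (i : ℕ) + j := by simp [finProdFinEquiv, add_comm]
  rw [rowMajor, dif_pos (h ▸ (finProdFinEquiv (i, j)).2)]
  have h' : (⟨b * i + j, h ▸ (finProdFinEquiv (i, j)).2⟩ : Fin (a * b)) =
      finProdFinEquiv (i, j) := Fin.ext h.symm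
  rw [h', Equiv.symm_apply_apply]

theorem sum_abs_rowMajor {a b : ℕ} (A : Fin a → Fin b → ℝ) :
    ∑ x ∈ Finset.range (a * b), |rowMajor A x| = ∑ i, ∑ j, |A i j| := by
  rw [Finset.sum_range, ← Fintype.sum_prod_type' fun i j => |A i j|,
    ← finProdFinEquiv.symm.sum_comp]
  refine Finset.sum_congr rfl fun x _ => ?_
  rw [rowMajor, dif_pos x.2]

theorem sum_fin_ge {n : ℕ} (g : ℕ → ℝ) (j : Fin n) :
    ∑ k : Fin n with j ≤ k, g k = ∑ k ∈ Finset.Ico (j : ℕ) n, g k := by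
  simp only [Finset.sum_filter, Fin.le_def]
  rw [← Finset.sum_range fun k : ℕ => if (j : ℕ) ≤ k then g k else 0,
    ← Finset.sum_filter]
  refine Finset.sum_congr ?_ fun _ _ => rfl
  ext k
  simp only [Finset.mem_filter, Finset.mem_range, Finset.mem_Ico]
  exact and_comm

namespace Instance

variable {m n p : ℕ} {I : Instance m n p}

/-! ### The program on an instance -/

/-- The number that stands for a class. -/
def classCode : Option (Fin p) → ℕ
  | none => 0
  | some ℓ => ℓ + 1

theorem classCode_inj {c c' : Option (Fin p)} (h : classCode c = classCode c') : c = c' := by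
  cases c <;> cases c' <;> simp [classCode] at h ⊢
  exact Fin.ext h

/-- The number that stands for the class of an item. -/
noncomputable def itemCode (I : Instance m n p) (i : ℕ) : ℕ :=
  if h : i < m then classCode (I.classOf ⟨i, h⟩) else 0

theorem itemCode_fin (i : Fin m) : I.itemCode i = classCode (I.classOf i) := by
  rw [itemCode, dif_pos i.2]

theorem itemCode_eq_iff {i j : Fin m} :
    I.itemCode i = I.itemCode j ↔ I.classOf i = I.classOf j := by
  rw [itemCode_fin, itemCode_fin]
  exact ⟨classCode_inj, congrArg _⟩

/-- Identifies the rank in the network with the counter kept by the program. -/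
theorem rank_classOf (hΔ : I.Delta = 1) (i : Fin m) : I.rank (I.classOf i) i =
    ((Finset.range i).filter fun i' => I.itemCode i' = I.itemCode i).card := by
  rw [rank, ← Finset.card_image_of_injective _ Fin.val_injective]
  congr 1
  ext x
  simp only [Finset.mem_image, Finset.mem_filter, Finset.mem_range, mem_classItems_iff hΔ]
  constructor
  · rintro ⟨y, ⟨h1, h2⟩, rfl⟩
    exact ⟨h2, itemCode_eq_iff.2 h1⟩
  · rintro ⟨h1, h2⟩
    exact ⟨⟨x, h1.trans i.2⟩, ⟨itemCode_eq_iff.1 h2, h1⟩, rfl⟩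

theorem topCount_eq_card (hΔ : I.Delta = 1) (π : Fin n ↪ Fin m) {s : ℕ → ℕ}
    (hs : ∀ k : Fin n, s k = π k) (k : Fin n) (ℓ : Fin p) : I.topCount π k ℓ =
      ((Finset.range (k + 1)).filter fun j => I.itemCode (s j) = ℓ + 1).card := by
  have hc : ∀ j, π j ∈ I.P ℓ ↔ I.itemCode (s j) = ℓ + 1 := by
    intro j
    rw [hs, itemCode_fin]
    exact (mem_classItems_iff (c := some ℓ) hΔ).trans ⟨congrArg _, classCode_inj (c' := some ℓ)⟩
  rw [topCount, ← Finset.card_image_of_injective _ Fin.val_injective]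
  congr 1
  ext x
  simp only [Finset.mem_image, Finset.mem_filter, Finset.mem_univ, Finset.mem_range, true_and, hc]
  constructor
  · rintro ⟨y, ⟨h1, h2⟩, rfl⟩
    exact ⟨Nat.lt_succ_of_le h1, h2⟩
  · rintro ⟨h1, h2⟩
    exact ⟨⟨x, by omega⟩, ⟨Nat.le_of_lt_succ h1, h2⟩, rfl⟩

theorem rawCost_eq_assignCost (hΔ : I.Delta = 1) (k : Fin n) (i : Fin m) :
    Prog.rawCost m n p (rowMajor I.L) (rowMajor I.U) (rowMajor I.W) I.itemCode k i =
      I.assignCost (1 + 2 * ∑ i, ∑ j, |I.W i j|) k i := by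
  rw [Prog.rawCost, assignCost, rowMajor_apply, sum_abs_rowMajor, ← sum_fin_ge]
  congr 1
  refine Finset.sum_congr rfl fun k' _ => ?_
  rw [← rank_classOf hΔ, itemCode_fin]
  cases hc : I.classOf i with
  | none => simp [Prog.rawPenalty, penalty, classCode]
  | some ℓ =>
    rw [Prog.rawPenalty, if_pos (by simp [classCode])]
    simp only [penalty, classCode, Nat.add_sub_cancel, rowMajor_apply]

/-- An item occurs in at most one pair, so reading the list takes time linear in `m`. -/
theorem Lists.length_le (hΔ : I.Delta = 1) {inc : List (Fin m × Fin p)} (h : I.Lists inc) :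
    inc.length ≤ m := by
  have h1 : (inc.map Prod.fst).Nodup := by
    refine h.1.map_on fun x hx y hy hxy => Prod.ext hxy ?_
    refine eq_of_mem_of_mem hΔ ((h.2 x.1 x.2).1 hx) ?_
    rw [hxy]
    exact (h.2 y.1 y.2).1 hy
  simpa using h1.length_le_card

theorem itemCode_of_lists (hΔ : I.Delta = 1) {inc : List (Fin m × Fin p)} (h : I.Lists inc)
    {x : ℕ} (hx : x < inc.length) : I.itemCode ((I.input inc).narr 2 x) =
      (I.input inc).narr 3 x + 1 := by
  have h1 : inc[x].1 ∈ I.P inc[x].2 := (h.2 _ _).1 (List.getElem_mem hx)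
  have h2 : I.classOf inc[x].1 = some inc[x].2 := (mem_classItems_iff (c := some _) hΔ).1 h1
  have e2 : (I.input inc).narr 2 x = inc[x].1 := by simp [input, hx]
  have e3 : (I.input inc).narr 3 x = inc[x].2 := by simp [input, hx]
  rw [e2, e3, itemCode_fin, h2]
  rfl

theorem itemCode_eq_zero (hΔ : I.Delta = 1) {inc : List (Fin m × Fin p)} (h : I.Lists inc) {i : ℕ}
    (hi : ∀ x < inc.length, (I.input inc).narr 2 x ≠ i) : I.itemCode i = 0 := by
  unfold itemCode
  split_ifs with him
  · cases hc : I.classOf ⟨i, him⟩ with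
    | none => rfl
    | some ℓ =>
      have h1 : (⟨i, him⟩, ℓ) ∈ inc := (h.2 _ _).2 ((mem_classItems_iff (c := some ℓ) hΔ).2 hc)
      obtain ⟨x, hx, hxe⟩ := List.getElem_of_mem h1
      exact absurd (by simp [input, hx, hxe]) (hi x hx)
  · rfl

theorem main_ends (hΔ : I.Delta = 1) (hM : I.MonotoneMonge) (hn : 1 ≤ n) (hpm : p ≤ m)
    {inc : List (Fin m × Fin p)} (h : I.Lists inc) :
    Prog.main.Ends (I.input inc) (4 + 800 * (n * n * m)) I.Answers := by
  have hm := one_le_items hΔ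
  refine Prog.Ends.mono (Prog.Ends.cond (T := 800 * (n * n * m)) (fun hmn => ?_) fun hmn => ?_)
    le_rfl fun _ _ h => h
  -- With fewer items than positions there is no injection, hence no ranking at all.
  · have hmn' : m < n := hmn
    have : 1 ≤ n * n * m := Nat.mul_pos (Nat.mul_pos hn hn) hm
    refine Prog.ends_of_exec rfl (by simp only [Prog.bound, NExpr.size]; omega) (.inr ⟨?_, ?_⟩)
    · simp [Prog.exec, NExpr.eval]
    · rintro ⟨π, -⟩
      have := Fintype.card_le_of_embedding π
      simp at this
      omega
  · have hmn' : n ≤ m := not_lt.1 hmn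
    refine (Prog.solve_ends (σ := I.input inc) (m := m) (n := n) (p := p) rfl rfl rfl rfl
      (fun x hx => itemCode_of_lists hΔ h hx) (fun i hi => itemCode_eq_zero hΔ h hi) ?_ rfl hm hn
      hpm (h.length_le hΔ) hmn').mono le_rfl ?_
    · intro a ha
      obtain ⟨b, rfl⟩ := Nat.exists_eq_add_of_le ha
      rw [add_comm]
      rfl
    · rintro τ - ⟨mt, v, h1, h2, h3, h4⟩
      let π : Fin n ↪ Fin m := ⟨fun k => ⟨τ.narr 0 k, (h2 k k.2).1⟩, fun k k' e => by
        have e1 := (h2 k k.2).2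
        have e2 := (h2 k' k'.2).2
        rw [show τ.narr 0 k = τ.narr 0 k' from congrArg Fin.val e] at e1
        exact Fin.ext (by omega)⟩
      have hπ : ∀ k : Fin n, τ.narr 0 k = π k := fun k => rfl
      have hmin : ∀ σ : Fin n ↪ Fin m,
          ∑ j, I.assignCost (1 + 2 * ∑ i, ∑ j, |I.W i j|) j (π j) ≤
            ∑ j, I.assignCost (1 + 2 * ∑ i, ∑ j, |I.W i j|) j (σ j) := by
        intro σ
        simp only [← rawCost_eq_assignCost hΔ]
        exact h1.sum_le (fun k => (h2 k k.2).2) σ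
      have hfeas : τ.nreg 0 = 1 ↔ I.Feasible π := by
        rw [h4]
        constructor
        · intro hg k ℓ
          rw [topCount_eq_card hΔ π hπ, ← rowMajor_apply I.L, ← rowMajor_apply I.U]
          exact hg k k.2 ℓ ℓ.2
        · intro hf k hk ℓ hℓ
          have := hf ⟨k, hk⟩ ⟨ℓ, hℓ⟩
          rw [topCount_eq_card hΔ π hπ, ← rowMajor_apply I.L, ← rowMajor_apply I.U] at this
          exact this
      have hB : 0 ≤ ∑ i, ∑ j, |I.W i j| :=
        Finset.sum_nonneg fun i _ => Finset.sum_nonneg fun j _ => abs_nonneg _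
      rcases h3 with h0 | h0
      · refine .inr ⟨h0, fun hex => ?_⟩
        have := hfeas.2 (feasible_of_minCost hΔ hM (by linarith) hmin hex)
        omega
      · exact .inl ⟨h0, π, optimal_of_minCost hΔ hM (by linarith) hmin (hfeas.1 h0), hπ⟩

end Instance

end FairRanking

/-! ### Assembly of both statements. -/

theorem theorem3p2 :
    ∃ (C : ℕ) (A : FairRanking.Prog), ∀ (m n p : ℕ) (I : FairRanking.Instance m n p),
      1 ≤ n → p ≤ m → I.Delta = 1 → I.MonotoneMonge →
      -- the reduction to minimum cost flow, and its solution by successive shortest paths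
      (∀ M : ℝ, 2 * ∑ i, ∑ j, |I.W i j| < M →
        (I.network M).Acyclic ∧
        Fintype.card (FairRanking.Vertex n p) ≤ C * (n * p) ∧
        (I.network M).edges.card ≤ C * (n * m) ∧
        ((∃ π, I.Feasible π) ↔
          ∃ f, (I.network M).IsMinCostFlow f n ∧ (I.network M).Integral f ∧
            I.MeetsLowerBounds f) ∧
        ((∃ π, I.Feasible π) →
          ∀ f, (I.network M).IsMinCostFlow f n → (I.network M).Integral f →
            ∃ π, I.ReadsOff f π ∧ I.Optimal π ∧
              I.value π = -(I.network M).flowCost f - M * ∑ k, ∑ ℓ, (I.L k ℓ : ℝ)) ∧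
        (∀ f, (I.network M).SSP n f →
          (I.network M).IsMinCostFlow f n ∧ (I.network M).Integral f) ∧
        ((∃ g, (I.network M).IsFlow g n) →
          ∀ r f, r < n → (I.network M).SSP r f →
            ∃ l, (I.network M).IsShortestAugmentingPath f l)) ∧
      -- the running time
      (∀ inc, I.Lists inc → ∃ (σ : FairRanking.State) (t : ℕ),
        FairRanking.Run A (I.input inc) σ t ∧ I.Answers σ ∧
        (t : ℝ) ≤ C * ((n : ℝ) ^ 2 * m * Real.log (m + 1))) := by
  open FairRanking Instance Network in
  -- 1608 = 2(4 + 800): the running time is at most 4 + 800n²m, and log(m + 1) ≥ log 2 exceeds 1/2.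
  -- The constants 7 and 5 of the network size are smaller.
  refine ⟨1608, Prog.main, fun m n p I hn hpm hΔ hMM => ⟨fun M hM => ?_, fun inc hinc => ?_⟩⟩
  · have hp := one_le_properties hΔ
    refine ⟨acyclic_network M, (card_vertex_le hn hp).trans (Nat.mul_le_mul_right _ (by decide)),
      (card_edges_le hΔ hn hpm M).trans (Nat.mul_le_mul_right _ (by decide)), ⟨fun h => ?_, ?_⟩,
      fun h f hf hi => ?_, fun f hf => ?_, fun hg r f hr hf => ?_⟩
    · obtain ⟨π, hπ⟩ := h
      obtain ⟨f, hf, hi⟩ := exists_isMinCostFlow_of_feasible hΔ hπ M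
      exact ⟨f, hf, hi, (optimal_of_isMinCostFlow hΔ hMM hM ⟨π, hπ⟩ hf hi).2⟩
    · rintro ⟨f, hf, hi, hl⟩
      exact feasible_of_meetsLowerBounds hΔ hf.1 hi hl
    · exact (optimal_of_isMinCostFlow hΔ hMM hM h hf hi).1
    · exact hf.isMinCostFlow (source_ne_sink M) (exists_isPotential_zero M)
    · exact hf.exists_next (source_ne_sink M) (exists_isPotential_zero M) hg hr
  · obtain ⟨σ, t, hr, ht, hA⟩ := main_ends hΔ hMM hn hpm hinc
    refine ⟨σ, t, hr, hA, ?_⟩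
    have hm := one_le_items hΔ
    have h1 : (1 : ℝ) ≤ n * n * m := by exact_mod_cast Nat.mul_pos (Nat.mul_pos hn hn) hm
    have h2 : (t : ℝ) ≤ 4 + 800 * (n * n * m) := by exact_mod_cast ht
    have h3 : 1 / 2 ≤ Real.log (m + 1) := by
      have hm' : (1 : ℝ) ≤ m := by exact_mod_cast hm
      have := Real.log_le_log (by norm_num : (0 : ℝ) < 2) (by linarith : (2 : ℝ) ≤ m + 1)
      linarith [Real.log_two_gt_d9]
    have h4 := mul_le_mul_of_nonneg_left h3 (by linarith : (0 : ℝ) ≤ n * n * m)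
    rw [pow_two]
    push_cast
    nlinarith
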